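/- **Theorem (tractability of DIMEs).** An *unordered word* over an alphabet $\Sigma$ is a finite multiset of symbols of $\Sigma$; write $\uplus$ for multiset union, $\varepsilon$ for the empty word, and $L_1\uplus L_2=\{w_1\uplus w_2\mid w_1\in L_1,\,w_2\in L_2\}$. An *interval* is $I=[n,m]$ or $I=[n,m]^?$ with $n\in\mathbb N_0$, $m\in\mathbb N_0\cup\{\infty\}$; put $1=[1,1]$, $?=[0,1]$, $+=[1,\infty]$, $*=[0,\infty]$. Expressions define languages of unordered words by $L(\epsilon)=\{\varepsilon\}$, $L(a)=\{a\}$, $L(E_1\mid E_2)=L(E_1)\cup L(E_2)$, $L(E_1\parallel E_2)=L(E_1)\uplus L(E_2)$, $L(E^{[n,m]})=\{w_1\uplus\dots\uplus w_i\mid w_1,\dots,w_i\in L(E),\ n\le i\le m\}$ and $L(E^{[n,m]^?})=L(E^{[n,m]})\cup\{\varepsilon\}$. An *atom* is $(a_1^{I_1}\parallel\dots\parallel a_k^{I_k})$, $k\ge1$, with symbols $a_i\in\Sigma$ and all $I_i\in\{1,?\}$. A *clause* is $(A_1^{I_1}\mid\dots\mid A_k^{I_k})$, $k\ge 1$, with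 atoms $A_i$ and arbitrary intervals $I_i$; it is *simple* if all $I_i\in\{1,?\}$. A *disjunctive interval multiplicity expression* (DIME) is $(D_1^{I_1}\parallel\dots\parallel D_k^{I_k})$, $k\ge0$ (for $k=0$ it is $\epsilon$), where for each $i$ either $D_i$ is a simple clause and $I_i\in\{+,*\}$, or $D_i$ is a clause and $I_i\in\{1,?\}$, and where each symbol of $\Sigma$ occurs at most once in the whole expression. The following two problems are in PTIME, that is, each is decided by a Turing machine in time polynomial in the length of its input. The alphabet is not fixed: symbols are natural numbers. Symbols and the bounds of intervals are written in binary, and an unordered word is given in unary, that is, by listing its symbol occurrences (in any order). 1. Given an unordered word $w$ and a DIME $E$, decide whether $w\in L(E)$. 2. Given two DIMEs $E'$ and $E$, decide whether $L(E')\subseteq L(E)$. -/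

import Mathlib

/-! ### Intervals -/

/-- The interval multiplicity `[lo, hi]`, or `[lo, hi]^?` when `opt` is set, with
`lo ∈ ℕ` and `hi ∈ ℕ ∪ {∞}`. -/
structure IntMult where
  lo : ℕ
  hi : ℕ∞
  opt : Bool

namespace IntMult

/-- `1 := [1,1]`. -/
def one : IntMult := ⟨1, 1, false⟩

/-- `? := [0,1]`. -/
def maybe : IntMult := ⟨0, 1, false⟩

/-- `+ := [1,∞]`. -/
def plus : IntMult := ⟨1, ⊤, false⟩

/-- `* := [0,∞]`. -/
def star : IntMult := ⟨0, ⊤, false⟩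

end IntMult

/-! ### Unordered regular expressions with intervals -/

/-- Unordered regular expressions over the alphabet `α`; `conc` is the unordered concatenation
and `rep E I` is `E^I`. -/
inductive URE (α : Type) where
  | eps : URE α
  | sym : α → URE α
  | alt : URE α → URE α → URE α
  | conc : URE α → URE α → URE α
  | rep : URE α → IntMult → URE α

namespace URE

variable {α : Type}

/-- The language of an expression. An unordered word over `α` is a multiset of symbols, the
unordered concatenation of words is the sum of multisets, the empty word is `0`. -/
def lang : URE α → Set (Multiset α)
  | eps => {0}
  | sym a => {{a}}
  | alt E F => lang E ∪ lang F
  | conc E F => {w | ∃ u ∈ lang E, ∃ v ∈ lang F, w = u + v}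
  | rep E I =>
      {w | ∃ us : List (Multiset α), (∀ u ∈ us, u ∈ lang E) ∧
        I.lo ≤ us.length ∧ (us.length : ℕ∞) ≤ I.hi ∧ w = us.sum} ∪
      {w | I.opt = true ∧ w = 0}

/-- `E₁ ∥ … ∥ Eₖ` (for `k = 0` the expression `ε`). -/
def concAll : List (URE α) → URE α
  | [] => eps
  | [E] => E
  | E :: F :: l => conc E (concAll (F :: l))

/-- `E₁ | … | Eₖ`; only used with `k ≥ 1`. -/
def altAll : List (URE α) → URE α
  | [] => eps
  | [E] => E
  | E :: F :: l => alt E (altAll (F :: l))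

end URE

/-! ### Disjunctive interval multiplicity expressions -/

/-- The shape `a₁^I₁ ∥ … ∥ aₖ^Iₖ`. -/
abbrev RawAtom (α : Type) := List (α × IntMult)

/-- The shape `A₁^I₁ | … | Aₖ^Iₖ`. -/
abbrev RawClause (α : Type) := List (RawAtom α × IntMult)

/-- The shape `D₁^I₁ ∥ … ∥ Dₖ^Iₖ`. -/
abbrev RawDIME (α : Type) := List (RawClause α × IntMult)

section

variable {α : Type}

/-- In an atom all intervals are `?` or `1`. -/
def IsAtomExpr (A : RawAtom α) : Prop :=
  A ≠ [] ∧ ∀ x ∈ A, x.2 = IntMult.maybe ∨ x.2 = IntMult.one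

/-- A clause is a disjunction of atoms with arbitrary intervals. -/
def IsClauseExpr (D : RawClause α) : Prop :=
  D ≠ [] ∧ ∀ x ∈ D, IsAtomExpr x.1

/-- A clause is simple if all its intervals are `?` or `1`. -/
def IsSimpleClauseExpr (D : RawClause α) : Prop :=
  IsClauseExpr D ∧ ∀ x ∈ D, x.2 = IntMult.maybe ∨ x.2 = IntMult.one

/-- The list of all occurrences of symbols. -/
def RawDIME.symbols (E : RawDIME α) : List α :=
  E.flatMap fun D => D.1.flatMap fun A => A.1.map Prod.fst

/-- The grammar of DIMEs, with at most one occurrence of each symbol. The empty concatenation,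
i.e. the expression `ε`, is admitted. -/
def IsDIME (E : RawDIME α) : Prop :=
  (∀ x ∈ E,
    (IsSimpleClauseExpr x.1 ∧ (x.2 = IntMult.plus ∨ x.2 = IntMult.star)) ∨
    (IsClauseExpr x.1 ∧ (x.2 = IntMult.one ∨ x.2 = IntMult.maybe))) ∧
  E.symbols.Nodup

/-- An atom as an unordered regular expression. -/
def RawAtom.toURE (A : RawAtom α) : URE α :=
  URE.concAll (A.map fun x => URE.rep (URE.sym x.1) x.2)

/-- A clause as an unordered regular expression. -/
def RawClause.toURE (D : RawClause α) : URE α :=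
  URE.altAll (D.map fun x => URE.rep (RawAtom.toURE x.1) x.2)

/-- A concatenation of clauses as an unordered regular expression. -/
def RawDIME.toURE (E : RawDIME α) : URE α :=
  URE.concAll (E.map fun x => URE.rep (RawClause.toURE x.1) x.2)

end

/-- Disjunctive interval multiplicity expressions over the alphabet `α`. -/
def DIME (α : Type) : Type := {E : RawDIME α // IsDIME E}

/-- The language `L(E)`. -/
def DIME.lang {α : Type} (E : DIME α) : Set (Multiset α) := (RawDIME.toURE E.1).lang

/-! ### Encoding of instances as strings over a finite alphabet

Symbols of the alphabet are natural numbers, so that the alphabet is not fixed in advance but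
part of the instance. Numbers are written in binary. -/

/-- The input alphabet. -/
inductive Token where
  | bit : Bool → Token
  | endm : Token
  | infty : Token
  | opn : Token
  | cls : Token
  deriving DecidableEq, Fintype

namespace Encode

/-- Binary digits, least significant digit first, followed by an end marker. -/
def nat (n : ℕ) : List Token := n.bits.map Token.bit ++ [Token.endm]

/-- Elements of `ℕ ∪ {∞}`. -/
def enat : ℕ∞ → List Token
  | ⊤ => [Token.infty]
  | (n : ℕ) => nat n

/-- Intervals: the two end points, then the bit that marks `[n,m]^?`. -/
def interval (I : IntMult) : List Token :=
  nat I.lo ++ enat I.hi ++ [Token.bit I.opt]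

/-- The entries of a list one after the other, between brackets. -/
def list {β : Type} (enc : β → List Token) (l : List β) : List Token :=
  Token.opn :: (l.flatMap enc ++ [Token.cls])

/-- Atoms, as lists of symbols with intervals. -/
def atom : RawAtom ℕ → List Token := list fun x => nat x.1 ++ interval x.2

/-- Clauses, as lists of atoms with intervals. -/
def clause : RawClause ℕ → List Token := list fun x => atom x.1 ++ interval x.2

/-- DIMEs, as lists of clauses with intervals. -/
def dime (E : DIME ℕ) : List Token := list (fun x => clause x.1 ++ interval x.2) E.1

/-- Unordered words in unary representation: each occurrence of a symbol is listed. -/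
def word : List ℕ → List Token := list nat

/-- Instances of the membership problem. -/
def membership (x : List ℕ × DIME ℕ) : List Token := word x.1 ++ dime x.2

/-- Instances of the containment problem. -/
def containment (x : DIME ℕ × DIME ℕ) : List Token := dime x.1 ++ dime x.2

end Encode

/-! ### Polynomial time -/

/-- The decision problem `P`, whose instances are written as strings by `enc`, is decided by a
(multi-stack) Turing machine in time polynomial in the length of the string. -/
def InPTIME {ι Γ : Type} (enc : ι → List Γ) (P : ι → Prop) : Prop :=
  ∃ f : ι → Bool, (∀ x, f x = true ↔ P x) ∧
    Nonempty (Turing.TM2ComputableInPolyTime enc Computability.encodeBool f)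

/-! Since every symbol occurs at most once in a DIME, a word can be split along the expression in
only one way, and membership depends only on the numbers `c a` of occurrences. The words made of `k`
copies of an atom are those in which every mandatory symbol occurs `k` times and every optional one
at most `k` times (`isSum_atom`). A clause under `1` or `?` uses at most one of its atoms; a simple
clause under `+` or `*` is, up to the empty word, the unordered concatenation of its iterated atoms.
This gives a normal form `norm`, and `L(E)` becomes a conjunction of constraints `Sat` on `c`: only
symbols of `E` occur; `c b ≤ c a` if `a` is mandatory in the atom of `b`; lower and upper bounds;
mutual exclusion of atoms; presence of some symbol of a clause (`mem_lang_iff`).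

Hence `L(E) ⊆ L(E')` iff each constraint of `E'` holds in all words of `E`. Each constraint concerns
one symbol, two symbols, or the absence of the symbols of one clause. If it can be violated, it is
violated by a word in which the multiplicities of at most two atoms are prescribed and the other
clauses are filled in conveniently (`exists_accepts`). So it can be tested by inspecting clauses,
atoms and interval bounds of `E` (`contained_iff`). Membership of `w` is the containment of `{w}`,
which has a normal form of its own (`wordNorm`).

For the time bound, all data are binary trees, stored as bit strings in registers. A register
program runs step for step on a multi-stack machine (`Exec.steps`). The relation `Comp`,
polynomial-time computability by such programs, is closed under composition, pairing, projection,
case distinction and iteration with polynomially many rounds and polynomially large states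
(`Comp.iterate`). List operations, binary arithmetic, the decoding of the input (`Parses`) and the
decision procedure are built from these. -/

/-! ### A register language and its compilation to multi-stack Turing machines -/

namespace RegMachine

open Function

/-- Programs acting on an infinite supply of registers, each of which holds a stack of bits.
Tests look at the top of a register. -/
inductive Cmd where
  | push (r : ℕ) (b : Bool)
  | pop (r : ℕ)
  | seq (c d : Cmd)
  | ite (r : ℕ) (p : Option Bool → Bool) (c d : Cmd)
  | loop (r : ℕ) (p : Option Bool → Bool) (c : Cmd)

/-- The contents of all registers. -/
abbrev Store := ℕ → List Bool

/-- `Exec c s s' t`: the program `c` takes `s` to `s'` in exactly `t` steps. -/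
inductive Exec : Cmd → Store → Store → ℕ → Prop
  | push (r b s) : Exec (.push r b) s (update s r (b :: s r)) 1
  | pop (r s) : Exec (.pop r) s (update s r (s r).tail) 1
  | seq {c d s s' s'' t t'} (h : Exec c s s' t) (h' : Exec d s' s'' t') :
      Exec (.seq c d) s s'' (t + t')
  | ite_true {r p c d s s' t} (hp : p (s r).head? = true) (h : Exec c s s' t) :
      Exec (.ite r p c d) s s' (t + 1)
  | ite_false {r p c d s s' t} (hp : p (s r).head? = false) (h : Exec d s s' t) :
      Exec (.ite r p c d) s s' (t + 1)
  | loop_done {r p c s} (hp : p (s r).head? = false) : Exec (.loop r p c) s s 1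
  | loop_step {r p c s s' s'' t t'} (hp : p (s r).head? = true) (h : Exec c s s' t)
      (h' : Exec (.loop r p c) s' s'' t') : Exec (.loop r p c) s s'' (t + t' + 1)

namespace Cmd

/-- All registers used by the program are at most `n`. -/
def RegsLE (n : ℕ) : Cmd → Prop
  | push r _ => r ≤ n
  | pop r => r ≤ n
  | seq c d => RegsLE n c ∧ RegsLE n d
  | ite r _ c d => r ≤ n ∧ RegsLE n c ∧ RegsLE n d
  | loop r _ c => r ≤ n ∧ RegsLE n c

theorem RegsLE.mono {m n : ℕ} (hmn : m ≤ n) {c : Cmd} (h : c.RegsLE m) : c.RegsLE n := by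
  induction c with
  | push => exact le_trans h hmn
  | pop => exact le_trans h hmn
  | seq c d hc hd => exact ⟨hc h.1, hd h.2⟩
  | ite r p c d hc hd => exact ⟨le_trans h.1 hmn, hc h.2.1, hd h.2.2⟩
  | loop r p c hc => exact ⟨le_trans h.1 hmn, hc h.2⟩

/-- The control points of a program. -/
def Label : Cmd → Type
  | push _ _ => Unit
  | pop _ => Unit
  | seq c d => Label c ⊕ Label d
  | ite _ _ c d => Option (Label c ⊕ Label d)
  | loop _ _ c => Option (Label c)

/-- A program has finitely many control points. -/
@[reducible] def labelFintype : (c : Cmd) → Fintype c.Label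
  | push _ _ => inferInstanceAs (Fintype Unit)
  | pop _ => inferInstanceAs (Fintype Unit)
  | seq c d =>
      letI := labelFintype c
      letI := labelFintype d
      inferInstanceAs (Fintype (Label c ⊕ Label d))
  | ite _ _ c d =>
      letI := labelFintype c
      letI := labelFintype d
      inferInstanceAs (Fintype (Option (Label c ⊕ Label d)))
  | loop _ _ c =>
      letI := labelFintype c
      inferInstanceAs (Fintype (Option (Label c)))

instance (c : Cmd) : Fintype c.Label := labelFintype c

/-- The first control point. -/
def entry : (c : Cmd) → c.Label
  | push _ _ => ()
  | pop _ => ()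
  | seq c _ => Sum.inl c.entry
  | ite _ _ _ _ => (none : Option _)
  | loop _ _ _ => (none : Option _)

end Cmd

/-- The stack alphabets: the input alphabet, and bits for the registers. -/
abbrev StackAlph (Γ : Type) (n : ℕ) : Option (Fin (n + 1)) → Type
  | none => Γ
  | some _ => Bool

/-- The finite memory of the machine: the symbol last read from the input, and the bit last read
from a register. -/
abbrev Mem (Γ : Type) := Option Γ × Option Bool

section

variable {Γ : Type} {n : ℕ} {Λ : Type}

/-- The stacks that hold the rest `l` of the input and the registers `s`. -/
def stackOf (n : ℕ) (l : List Γ) (s : Store) : ∀ k, List (StackAlph Γ n k)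
  | none => l
  | some i => s i

theorem update_stackOf_some (l : List Γ) (s : Store) (i : Fin (n + 1)) (v : List Bool) :
    update (stackOf n l s) (some i) v = stackOf n l (update s i v) := by
  funext k
  rcases k with _ | j
  · rfl
  · by_cases h : j = i
    · subst h
      simp [stackOf]
    · rw [update_of_ne (by simpa using h)]
      simp [stackOf, update_of_ne (fun e => h (Fin.ext e) : (j : ℕ) ≠ i)]

theorem update_stackOf_none (l l' : List Γ) (s : Store) :
    update (stackOf n l s) none l' = stackOf n l' s := by
  funext k
  rcases k with _ | i <;> rfl

/-- Push a bit onto a register. -/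
def pushReg (r : ℕ) (f : Mem Γ → Bool) (q : Turing.TM2.Stmt (StackAlph Γ n) Λ (Mem Γ)) :
    Turing.TM2.Stmt (StackAlph Γ n) Λ (Mem Γ) :=
  .push (some (Fin.ofNat (n + 1) r)) f q

/-- Pop a bit from a register. -/
def popReg (r : ℕ) (f : Mem Γ → Option Bool → Mem Γ)
    (q : Turing.TM2.Stmt (StackAlph Γ n) Λ (Mem Γ)) : Turing.TM2.Stmt (StackAlph Γ n) Λ (Mem Γ) :=
  .pop (some (Fin.ofNat (n + 1) r)) f q

/-- Look at the top of a register. -/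
def peekReg (r : ℕ) (f : Mem Γ → Option Bool → Mem Γ)
    (q : Turing.TM2.Stmt (StackAlph Γ n) Λ (Mem Γ)) : Turing.TM2.Stmt (StackAlph Γ n) Λ (Mem Γ) :=
  .peek (some (Fin.ofNat (n + 1) r)) f q

/-- Read a symbol of the input. -/
def popInput (f : Mem Γ → Option Γ → Mem Γ) (q : Turing.TM2.Stmt (StackAlph Γ n) Λ (Mem Γ)) :
    Turing.TM2.Stmt (StackAlph Γ n) Λ (Mem Γ) :=
  .pop none f q

theorem val_ofNat {r : ℕ} (hr : r ≤ n) : (Fin.ofNat (n + 1) r).val = r := by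
  simp [Fin.ofNat, Nat.mod_eq_of_lt (by omega : r < n + 1)]

section

variable {r : ℕ} (q : Turing.TM2.Stmt (StackAlph Γ n) Λ (Mem Γ)) (v : Mem Γ)
  (l : List Γ) (s : Store)

theorem stepAux_pushReg (hr : r ≤ n) (f : Mem Γ → Bool) :
    Turing.TM2.stepAux (pushReg r f q) v (stackOf n l s) =
      Turing.TM2.stepAux q v (stackOf n l (update s r (f v :: s r))) := by
  have h := update_stackOf_some l s (Fin.ofNat (n + 1) r)
    (f v :: s (Fin.ofNat (n + 1) r : Fin (n + 1)))
  rw [val_ofNat hr] at h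
  rw [← h, pushReg, Turing.TM2.stepAux, stackOf, val_ofNat hr]

theorem stepAux_popReg (hr : r ≤ n) (f : Mem Γ → Option Bool → Mem Γ) :
    Turing.TM2.stepAux (popReg r f q) v (stackOf n l s) =
      Turing.TM2.stepAux q (f v (s r).head?) (stackOf n l (update s r (s r).tail)) := by
  have h := update_stackOf_some l s (Fin.ofNat (n + 1) r)
    (s (Fin.ofNat (n + 1) r : Fin (n + 1))).tail
  rw [val_ofNat hr] at h
  rw [← h, popReg, Turing.TM2.stepAux, stackOf, val_ofNat hr]

theorem stepAux_peekReg (hr : r ≤ n) (f : Mem Γ → Option Bool → Mem Γ) :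
    Turing.TM2.stepAux (peekReg r f q) v (stackOf n l s) =
      Turing.TM2.stepAux q (f v (s r).head?) (stackOf n l s) := by
  rw [peekReg, Turing.TM2.stepAux, stackOf, val_ofNat hr]

theorem stepAux_popInput (f : Mem Γ → Option Γ → Mem Γ) :
    Turing.TM2.stepAux (popInput f q) v (stackOf n l s) =
      Turing.TM2.stepAux q (f v l.head?) (stackOf n l.tail s) := by
  rw [popInput, Turing.TM2.stepAux, ← update_stackOf_none l l.tail s]
  rfl

end

/-- The statement for a test of the top of a register. -/
def testReg (r : ℕ) (p : Option Bool → Bool) (x y : Λ) :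
    Turing.TM2.Stmt (StackAlph Γ n) Λ (Mem Γ) :=
  peekReg r (fun v o => (v.1, o))
    (.branch (fun v => p v.2) (.goto fun _ => x) (.goto fun _ => y))

theorem stepAux_testReg {r : ℕ} (hr : r ≤ n) (p : Option Bool → Bool) (x y : Λ) (v : Mem Γ)
    (l : List Γ) (s : Store) :
    Turing.TM2.stepAux (testReg r p x y) v (stackOf n l s) =
      ⟨some (if p (s r).head? = true then x else y), (v.1, (s r).head?), stackOf n l s⟩ := by
  rw [testReg, stepAux_peekReg _ _ _ _ hr]
  cases h : p (s r).head? <;> simp [Turing.TM2.stepAux, h]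

/-- The statement of a TM2 machine at a control point of a program; `emb` places the control
points among the labels, `ex` is the label to continue with. -/
def Cmd.code (Γ : Type) (n : ℕ) {Λ : Type} : (c : Cmd) → (c.Label → Λ) → Λ → c.Label →
    Turing.TM2.Stmt (StackAlph Γ n) Λ (Mem Γ)
  | .push r b, _, ex, _ => pushReg r (fun _ => b) (.goto fun _ => ex)
  | .pop r, _, ex, _ => popReg r (fun v _ => v) (.goto fun _ => ex)
  | .seq c d, emb, ex, l =>
      Sum.casesOn l (fun l => c.code Γ n (fun x => emb (Sum.inl x)) (emb (Sum.inr d.entry)) l)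
        (fun l => d.code Γ n (fun x => emb (Sum.inr x)) ex l)
  | .ite r p c d, emb, ex, l =>
      Option.casesOn l
        (testReg r p (emb (some (Sum.inl c.entry))) (emb (some (Sum.inr d.entry))))
        (fun l => Sum.casesOn l
          (fun l => c.code Γ n (fun x => emb (some (Sum.inl x))) ex l)
          (fun l => d.code Γ n (fun x => emb (some (Sum.inr x))) ex l))
  | .loop r p c, emb, ex, l =>
      Option.casesOn l (testReg r p (emb (some c.entry)) ex)
        (fun l => c.code Γ n (fun x => emb (some x)) (emb none) l)

/-- The machine goes from one configuration to another in `t` steps. -/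
def Steps (M : Λ → Turing.TM2.Stmt (StackAlph Γ n) Λ (Mem Γ)) (t : ℕ)
    (a b : Turing.TM2.Cfg (StackAlph Γ n) Λ (Mem Γ)) : Prop :=
  (flip bind (Turing.TM2.step M))^[t] (some a) = some b

theorem Steps.trans {M : Λ → Turing.TM2.Stmt (StackAlph Γ n) Λ (Mem Γ)} {t t' : ℕ}
    {a b c : Turing.TM2.Cfg (StackAlph Γ n) Λ (Mem Γ)} (h : Steps M t a b) (h' : Steps M t' b c) :
    Steps M (t + t') a c := by
  unfold Steps at *
  rw [add_comm t t', iterate_add_apply, h, h']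

theorem Steps.one {M : Λ → Turing.TM2.Stmt (StackAlph Γ n) Λ (Mem Γ)} {l : Λ} {v : Mem Γ}
    {S : ∀ k, List (StackAlph Γ n k)} {b : Turing.TM2.Cfg (StackAlph Γ n) Λ (Mem Γ)}
    (h : Turing.TM2.stepAux (M l) v S = b) : Steps M 1 ⟨some l, v, S⟩ b := by
  simp [Steps, flip, ← h]

/-- The two step counts agree exactly: a push, a pop and a test are one machine step each, and
leaving a subprogram is free because its last statement jumps directly to `ex`. For the induction
`emb` and `ex` must be arbitrary. The final memory is left unspecified because every test looks at
its register afresh. -/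
theorem Exec.steps {M : Λ → Turing.TM2.Stmt (StackAlph Γ n) Λ (Mem Γ)} {c : Cmd} {s s' : Store}
    {t : ℕ} (h : Exec c s s' t) : ∀ (emb : c.Label → Λ) (ex : Λ),
    (∀ l, M (emb l) = c.code Γ n emb ex l) → c.RegsLE n → ∀ (l : List Γ) (v : Mem Γ),
    ∃ v', Steps M t ⟨some (emb c.entry), v, stackOf n l s⟩ ⟨some ex, v', stackOf n l s'⟩ := by
  induction h with
  | push r b s =>
    intro emb ex hM hr l v
    refine ⟨v, Steps.one ?_⟩
    rw [hM, Cmd.code, stepAux_pushReg _ _ _ _ hr, Turing.TM2.stepAux]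
  | pop r s =>
    intro emb ex hM hr l v
    refine ⟨v, Steps.one ?_⟩
    rw [hM, Cmd.code, stepAux_popReg _ _ _ _ hr, Turing.TM2.stepAux]
  | seq _ _ ih ih' =>
    intro emb ex hM hr l v
    obtain ⟨v₁, h₁⟩ := ih (fun x => emb (Sum.inl x)) _ (fun x => hM (Sum.inl x)) hr.1 l v
    obtain ⟨v₂, h₂⟩ := ih' (fun x => emb (Sum.inr x)) _ (fun x => hM (Sum.inr x)) hr.2 l v₁
    exact ⟨v₂, h₁.trans h₂⟩
  | @ite_true r p c d s s' t hp _ ih =>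
    intro emb ex hM hr l v
    obtain ⟨v₁, h₁⟩ := ih (fun x => emb (some (Sum.inl x))) _ (fun x => hM (some (Sum.inl x)))
      hr.2.1 l (v.1, (s r).head?)
    refine ⟨v₁, ?_⟩
    rw [add_comm]
    refine Steps.trans (Steps.one ?_) h₁
    rw [hM]
    refine (stepAux_testReg hr.1 _ _ _ _ _ _).trans ?_
    rw [if_pos hp]
  | @ite_false r p c d s s' t hp _ ih =>
    intro emb ex hM hr l v
    obtain ⟨v₁, h₁⟩ := ih (fun x => emb (some (Sum.inr x))) _ (fun x => hM (some (Sum.inr x)))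
      hr.2.2 l (v.1, (s r).head?)
    refine ⟨v₁, ?_⟩
    rw [add_comm]
    refine Steps.trans (Steps.one ?_) h₁
    rw [hM]
    refine (stepAux_testReg hr.1 _ _ _ _ _ _).trans ?_
    rw [if_neg (by simp [hp])]
  | @loop_done r p c s hp =>
    intro emb ex hM hr l v
    refine ⟨(v.1, (s r).head?), Steps.one ?_⟩
    rw [hM]
    refine (stepAux_testReg hr.1 _ _ _ _ _ _).trans ?_
    rw [if_neg (by simp [hp])]
  | @loop_step r p c s s' s'' t t' hp _ _ ih ih' =>
    intro emb ex hM hr l v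
    obtain ⟨v₁, h₁⟩ := ih (fun x => emb (some x)) _ (fun x => hM (some x)) hr.2 l
      (v.1, (s r).head?)
    obtain ⟨v₂, h₂⟩ := ih' emb ex hM hr l v₁
    refine ⟨v₂, ?_⟩
    rw [add_comm]
    refine Steps.trans (Steps.one ?_) (h₁.trans h₂)
    rw [hM]
    refine (stepAux_testReg hr.1 _ _ _ _ _ _).trans ?_
    rw [if_pos hp]

end

/-! ### Binary trees as data -/

/-- Binary trees, the universal data type. -/
inductive Tree where
  | nil
  | node (x y : Tree)

namespace Tree

/-- The prefix code of a tree. -/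
def bits : Tree → List Bool
  | nil => [false]
  | node x y => true :: (bits x ++ bits y)

/-- The length of the prefix code. -/
def size (x : Tree) : ℕ := x.bits.length

@[simp] theorem size_nil : nil.size = 1 := rfl

@[simp] theorem size_node (x y : Tree) : (node x y).size = x.size + y.size + 1 := by
  simp [size, bits]

/-- The two truth values as trees. -/
def ofBool : Bool → Tree
  | false => nil
  | true => node nil nil

/-- The list of trees as a tree. -/
def ofList : List Tree → Tree
  | [] => nil
  | x :: l => node x (ofList l)

end Tree

/-! ### Machines that read their input as a tree -/

section

variable {Γ : Type}

/-- The labels of the machine that first turns its input into a tree, then runs `c`, and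
finally outputs a bit. -/
inductive MainLabel (Γ : Type) (c : Cmd) where
  | start
  | read
  | emit (a : Γ)
  | run (l : c.Label)
  | finish

instance [Fintype Γ] (c : Cmd) : Fintype (MainLabel Γ c) :=
  Fintype.ofEquiv (Option (Option (Option (Γ ⊕ c.Label))))
    { toFun := fun
        | none => .start
        | some none => .read
        | some (some none) => .finish
        | some (some (some (Sum.inl a))) => .emit a
        | some (some (some (Sum.inr l))) => .run l
      invFun := fun
        | .start => none
        | .read => some none
        | .finish => some (some none)
        | .emit a => some (some (some (Sum.inl a)))
        | .run l => some (some (some (Sum.inr l)))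
      left_inv := by rintro (_ | _ | _ | _ | _) <;> rfl
      right_inv := by rintro (_ | _ | _ | _ | _) <;> rfl }

/-- Push a constant string. -/
def pushList {n : ℕ} {Λ : Type} (r : ℕ) : List Bool →
    Turing.TM2.Stmt (StackAlph Γ n) Λ (Mem Γ) → Turing.TM2.Stmt (StackAlph Γ n) Λ (Mem Γ)
  | [], q => q
  | b :: l, q => pushList r l (pushReg r (fun _ => b) q)

theorem stepAux_pushList {n : ℕ} {Λ : Type} {r : ℕ} (hr : r ≤ n) (l : List Bool)
    (q : Turing.TM2.Stmt (StackAlph Γ n) Λ (Mem Γ)) (v : Mem Γ) (i : List Γ) (s : Store) :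
    Turing.TM2.stepAux (pushList r l q) v (stackOf n i s) =
      Turing.TM2.stepAux q v (stackOf n i (update s r (l ++ s r))) := by
  induction l generalizing q with
  | nil => simp [pushList]
  | cons b l ih =>
    rw [pushList, ih, stepAux_pushReg _ _ _ _ hr, update_idem]
    simp

/-- The machine that turns its input into a tree, runs `c`, and outputs a bit. -/
def mainCode (code : Γ → Tree) (n : ℕ) (c : Cmd) :
    MainLabel Γ c → Turing.TM2.Stmt (StackAlph Γ n) (MainLabel Γ c) (Mem Γ)
  | .start => pushList 0 Tree.nil.bits (.goto fun _ => .read)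
  | .read => popInput (fun _ o => (o, none)) (.goto fun v => v.1.elim (.run c.entry) .emit)
  | .emit a => pushList 0 (true :: (code a).bits) (.goto fun _ => .read)
  | .run l => c.code Γ n .run .finish l
  | .finish => popReg 0 (fun _ o => (none, o)) (popReg 0 (fun v _ => v) (popReg 0 (fun v _ => v)
      (pushReg 0 (fun v => v.2.getD false) (.load (fun _ => (none, none)) .halt))))

/-- The machine with code `mainCode`. -/
def mainMachine [Fintype Γ] (code : Γ → Tree) (n : ℕ) (c : Cmd) : Turing.FinTM2 where
  K := Option (Fin (n + 1))
  k₀ := none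
  k₁ := some 0
  Γ := StackAlph Γ n
  Λ := MainLabel Γ c
  main := .start
  σ := Mem Γ
  initialState := (none, none)
  Γk₀Fin := inferInstanceAs (Fintype Γ)
  m := mainCode code n c

/-- Pushing `true` and the code of a symbol in front of the code of a list adds that symbol to the
list, so the register always holds the symbols read so far, the last one first. This takes two steps
for each symbol, and one more to notice the end of the input. -/
theorem read_steps (code : Γ → Tree) (n : ℕ) (c : Cmd) (l : List Γ) (acc : List Tree) (s : Store)
    (v : Mem Γ) : Steps (mainCode code n c) (2 * l.length + 1)
      ⟨some .read, v, stackOf n l (update s 0 (Tree.ofList acc).bits)⟩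
      ⟨some (.run c.entry), (none, none),
        stackOf n [] (update s 0 (Tree.ofList ((l.map code).reverse ++ acc)).bits)⟩ := by
  induction l generalizing acc v with
  | nil =>
    refine Steps.one ?_
    rw [mainCode, stepAux_popInput]
    rfl
  | cons a l ih =>
    have h₁ : Steps (mainCode code n c) 1
        ⟨some .read, v, stackOf n (a :: l) (update s 0 (Tree.ofList acc).bits)⟩
        ⟨some (.emit a), (some a, none), stackOf n l (update s 0 (Tree.ofList acc).bits)⟩ := by
      refine Steps.one ?_
      rw [mainCode, stepAux_popInput]
      rfl
    have h₂ : Steps (mainCode code n c) 1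
        ⟨some (.emit a), (some a, none), stackOf n l (update s 0 (Tree.ofList acc).bits)⟩
        ⟨some .read, (some a, none),
          stackOf n l (update s 0 (Tree.ofList (code a :: acc)).bits)⟩ := by
      refine Steps.one ?_
      rw [mainCode, stepAux_pushList (Nat.zero_le _)]
      simp [Turing.TM2.stepAux, Tree.ofList, Tree.bits]
    have := (h₁.trans h₂).trans (ih (code a :: acc) (some a, none))
    convert this using 1
    · simp; ring
    · simp

/-- The first bit of `Tree.ofBool b` is `b`. The code has one or three bits, so three pops empty the
register in either case, a pop from an empty stack being harmless. The memory is reset because the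
final configuration has to carry the initial state. -/
theorem finish_steps (code : Γ → Tree) (n : ℕ) (c : Cmd) (b : Bool) (v : Mem Γ) :
    Steps (mainCode code n c) 1
      ⟨some .finish, v, stackOf n [] (update (fun _ => []) 0 (Tree.ofBool b).bits)⟩
      ⟨none, (none, none), stackOf n [] (update (fun _ => []) 0 [b])⟩ := by
  refine Steps.one ?_
  rw [mainCode, stepAux_popReg _ _ _ _ (Nat.zero_le n), stepAux_popReg _ _ _ _ (Nat.zero_le n),
    stepAux_popReg _ _ _ _ (Nat.zero_le n), stepAux_pushReg _ _ _ _ (Nat.zero_le n)]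
  cases b <;> simp [Turing.TM2.stepAux, Tree.ofBool, Tree.bits]

/-- A decision problem is decided in polynomial time if a register program, started with the
reversed list of the input symbols, computes the answer in polynomial time. -/
theorem nonempty_computableInPolyTime [Fintype Γ] {ι : Type} (enc : ι → List Γ) (f : ι → Bool)
    (code : Γ → Tree) (n : ℕ) (c : Cmd) (hc : c.RegsLE n) (p : Polynomial ℕ)
    (h : ∀ i, ∃ t ≤ p.eval (enc i).length,
      Exec c (update (fun _ => []) 0 (Tree.ofList ((enc i).map code).reverse).bits)
        (update (fun _ => []) 0 (Tree.ofBool (f i)).bits) t) :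
    Nonempty (Turing.TM2ComputableInPolyTime enc Computability.encodeBool f) := by
  refine ⟨{
    tm := mainMachine code n c
    inputAlphabet := Equiv.refl Γ
    outputAlphabet := Equiv.refl Bool
    time := p + 2 * Polynomial.X + 3
    outputsFun := fun i => Classical.choice ?_ }⟩
  obtain ⟨t, ht, hex⟩ := h i
  obtain ⟨v, hrun⟩ := hex.steps (M := mainCode code n c) (n := n) MainLabel.run .finish
    (fun _ => rfl) hc [] (none, none)
  have hstart : Steps (mainCode code n c) 1
      ⟨some .start, (none, none), stackOf n (enc i) fun _ => []⟩
      ⟨some .read, (none, none),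
        stackOf n (enc i) (update (fun _ => []) 0 (Tree.ofList []).bits)⟩ := by
    refine Steps.one ?_
    rw [mainCode, stepAux_pushList (Nat.zero_le _)]
    rfl
  have hread := read_steps code n c (enc i) [] (fun _ => []) (none, none)
  rw [List.append_nil] at hread
  have hall := ((hstart.trans hread).trans hrun).trans (finish_steps code n c (f i) v)
  refine ⟨⟨⟨1 + (2 * (enc i).length + 1) + t + 1, ?_⟩, ?_⟩⟩
  · have e₁ : Turing.initList (mainMachine code n c)
        (List.map (Equiv.refl Γ).invFun (enc i)) =
          (⟨some .start, (none, none), stackOf n (enc i) fun _ => []⟩ :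
            Turing.TM2.Cfg (StackAlph Γ n) (MainLabel Γ c) (Mem Γ)) := by
      unfold Turing.initList
      congr 1
      funext k
      rcases k with _ | k
      · exact List.map_id _
      · rfl
    have e₂ : Turing.haltList (mainMachine code n c)
        (List.map (Equiv.refl Bool).invFun (Computability.encodeBool (f i))) =
          (⟨none, (none, none), stackOf n [] (update (fun _ => []) 0 [f i])⟩ :
            Turing.TM2.Cfg (StackAlph Γ n) (MainLabel Γ c) (Mem Γ)) := by
      unfold Turing.haltList
      congr 1
      funext k
      rcases k with _ | k
      · rfl
      · by_cases hk : k = 0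
        · subst hk
          rfl
        · have h₁ : (some k : Option (Fin (n + 1))) ≠ some 0 := by simpa using hk
          have h₂ : (k : ℕ) ≠ 0 := fun e => hk (Fin.ext e)
          exact (dif_neg h₁).trans (update_of_ne h₂ [f i] fun _ => []).symm
    rw [Option.map_some]
    unfold Steps at hall
    refine Eq.trans ?_ (Eq.trans hall ?_)
    · rw [e₁]
      rfl
    · rw [e₂]
      rfl
  · simp
    omega

end

end RegMachine

/-! ### Tree transformations computable in polynomial time -/

namespace RegMachine

open Function

/-- The coefficients are natural numbers, so size estimates can be inserted into time bounds. -/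
theorem eval_mono (p : Polynomial ℕ) {m n : ℕ} (h : m ≤ n) : p.eval m ≤ p.eval n := by
  rw [Polynomial.eval_eq_sum_range, Polynomial.eval_eq_sum_range]
  exact Finset.sum_le_sum fun i _ => Nat.mul_le_mul_left _ (Nat.pow_le_pow_left h i)

/-- A step adds at most one bit. Hence a time bound is also a bound for the size of the result,
which is what composition needs. -/
theorem Exec.length_le {c : Cmd} {s s' : Store} {t : ℕ} (h : Exec c s s' t) (r : ℕ) :
    (s' r).length ≤ (s r).length + t := by
  induction h with
  | push r' b s =>
    by_cases hr : r = r'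
    · subst hr; simp
    · simp [hr]
  | pop r' s =>
    by_cases hr : r = r'
    · subst hr; simp; omega
    · simp [hr]
  | seq _ _ ih ih' => omega
  | ite_true _ _ ih => omega
  | ite_false _ _ ih => omega
  | loop_done => omega
  | loop_step _ _ _ ih ih' => omega

theorem Exec.congr {c : Cmd} {s s' s'' : Store} {t t' : ℕ} (h : Exec c s s' t) (e : s' = s'')
    (ht : t = t') : Exec c s s'' t' := by
  subst e ht
  exact h

/-- The test whether a register is not empty. -/
def nonempty (o : Option Bool) : Bool := o.isSome

/-- The test whether the top of a register is `true`. -/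
def top (o : Option Bool) : Bool := o.getD false

namespace Cmd

/-- Move the contents of a register onto another one, in reverse order. -/
def move (a b : ℕ) : Cmd :=
  loop a nonempty (seq (ite a top (push b true) (push b false)) (pop a))

/-- Move the contents of a register onto two other ones, in reverse order. -/
def moveTwo (a b c : ℕ) : Cmd :=
  loop a nonempty (seq (ite a top (seq (push b true) (push c true))
    (seq (push b false) (push c false))) (pop a))

/-- Empty a register. -/
def clear (a : ℕ) : Cmd := loop a nonempty (pop a)

/-- Run a program, then push a constant. -/
def thenPush (r : ℕ) (c : Cmd) : List Bool → Cmd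
  | [] => c
  | b :: l => seq (thenPush r c l) (push r b)

/-- Overwrite a register with a constant. -/
def setConst (r : ℕ) (l : List Bool) : Cmd := thenPush r (clear r) l

/-- Copy a register to the next one. -/
def copyUp (b : ℕ) : Cmd := seq (move b (b + 2)) (moveTwo (b + 2) b (b + 1))

/-- Exchange a register with the next one. -/
def swapUp (b : ℕ) : Cmd :=
  seq (move b (b + 2)) (seq (move (b + 1) (b + 3)) (seq (move (b + 2) (b + 1)) (move (b + 3) b)))

/-- The loop of `split`. -/
def splitLoop (b : ℕ) : Cmd :=
  loop (b + 2) nonempty (seq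
    (ite b top (seq (push (b + 1) true) (push (b + 2) true))
      (seq (push (b + 1) false) (pop (b + 2)))) (pop b))

/-- Take a node apart: the left subtree goes, reversed, to the next register. -/
def split (b : ℕ) : Cmd := seq (pop b) (seq (push (b + 2) true) (splitLoop b))

end Cmd

/-! ### Effect and running time of the basic programs. -/

open Cmd

theorem exec_move {a b : ℕ} (hab : a ≠ b) (l : List Bool) (s : Store) (hl : s a = l) :
    Exec (move a b) s (update (update s a []) b (l.reverse ++ s b)) (4 * l.length + 1) := by
  induction l generalizing s with
  | nil =>
    have hs : update s a [] = s := by rw [← hl, update_eq_self]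
    exact (Exec.loop_done (by simp [hl, nonempty])).congr (by simp [hs]) rfl
  | cons x l ih =>
    have h := ih (update (update s b (x :: s b)) a l) (by simp)
    have hbody : Exec (seq (ite a top (push b true) (push b false)) (pop a)) s
        (update (update s b (x :: s b)) a l) 3 := by
      have hpop : Exec (pop a) (update s b (x :: s b)) (update (update s b (x :: s b)) a l) 1 := by
        refine (Exec.pop a _).congr ?_ rfl
        rw [update_of_ne hab, hl, List.tail_cons]
      cases x
      · exact .seq (.ite_false (by simp [hl, top]) (.push b false s)) hpop
      · exact .seq (.ite_true (by simp [hl, top]) (.push b true s)) hpop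
    refine (Exec.loop_step (by simp [hl, nonempty]) hbody h).congr ?_ (by simp; ring)
    funext r
    by_cases hb : r = b
    · subst hb; simp [hab.symm]
    · by_cases ha : r = a
      · subst ha; simp [hb]
      · simp [ha, hb]

theorem exec_moveTwo {a b c : ℕ} (hab : a ≠ b) (hac : a ≠ c) (hbc : b ≠ c) (l : List Bool)
    (s : Store) (hl : s a = l) :
    Exec (moveTwo a b c) s (update (update (update s a []) b (l.reverse ++ s b)) c
      (l.reverse ++ s c)) (5 * l.length + 1) := by
  induction l generalizing s with
  | nil =>
    have hs : update s a [] = s := by rw [← hl, update_eq_self]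
    exact (Exec.loop_done (by simp [hl, nonempty])).congr (by simp [hs]) rfl
  | cons x l ih =>
    have h := ih (update (update (update s b (x :: s b)) c (x :: s c)) a l) (by simp)
    have hbody : Exec (seq (ite a top (seq (push b true) (push c true))
        (seq (push b false) (push c false))) (pop a)) s
        (update (update (update s b (x :: s b)) c (x :: s c)) a l) 4 := by
      have hpush : ∀ x, Exec (seq (push b x) (push c x)) s
          (update (update s b (x :: s b)) c (x :: s c)) 2 := by
        intro x
        refine (Exec.seq (.push b x s) (.push c x _)).congr ?_ rfl
        rw [update_of_ne hbc.symm]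
      have hpop : Exec (pop a) (update (update s b (x :: s b)) c (x :: s c))
          (update (update (update s b (x :: s b)) c (x :: s c)) a l) 1 := by
        refine (Exec.pop a _).congr ?_ rfl
        rw [update_of_ne hac, update_of_ne hab, hl, List.tail_cons]
      cases x
      · exact .seq (.ite_false (by simp [hl, top]) (hpush false)) hpop
      · exact .seq (.ite_true (by simp [hl, top]) (hpush true)) hpop
    refine (Exec.loop_step (by simp [hl, nonempty]) hbody h).congr ?_ (by simp; ring)
    funext r
    by_cases hc : r = c
    · subst hc; simp [hac.symm]
    · by_cases hb : r = b
      · subst hb; simp [hab.symm, hbc]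
      · by_cases ha : r = a
        · subst ha; simp [hb, hc]
        · simp [ha, hb, hc]

theorem exec_clear (a : ℕ) (l : List Bool) (s : Store) (hl : s a = l) :
    Exec (clear a) s (update s a []) (2 * l.length + 1) := by
  induction l generalizing s with
  | nil =>
    have hs : update s a [] = s := by rw [← hl, update_eq_self]
    exact (Exec.loop_done (by simp [hl, nonempty])).congr (by simp [hs]) rfl
  | cons x l ih =>
    have h := ih (update s a l) (by simp)
    have hpop : Exec (pop a) s (update s a l) 1 := (Exec.pop a s).congr (by rw [hl]; rfl) rfl
    exact (Exec.loop_step (by simp [hl, nonempty]) hpop h).congr (by simp) (by simp; ring)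

theorem exec_thenPush {r : ℕ} {c : Cmd} {s s' : Store} {t : ℕ} (h : Exec c s s' t)
    (l : List Bool) :
    Exec (thenPush r c l) s (update s' r (l ++ s' r)) (t + l.length) := by
  induction l with
  | nil => simpa [thenPush] using h
  | cons b l ih => exact (Exec.seq ih (.push r b _)).congr (by simp) (by simp; ring)

theorem exec_setConst (r : ℕ) (l : List Bool) (s : Store) :
    Exec (setConst r l) s (update s r l) (2 * (s r).length + 1 + l.length) :=
  (exec_thenPush (exec_clear r (s r) s rfl) l).congr (by simp) rfl

theorem regsLE_thenPush {r n : ℕ} {c : Cmd} (hr : r ≤ n) (hc : c.RegsLE n) (l : List Bool) :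
    (thenPush r c l).RegsLE n := by
  induction l with
  | nil => exact hc
  | cons b l ih => exact ⟨ih, hr⟩

theorem regsLE_setConst {r n : ℕ} (hr : r ≤ n) (l : List Bool) : (setConst r l).RegsLE n :=
  regsLE_thenPush hr (c := clear r) ⟨hr, hr⟩ l

/-- A store that has the four given words in the registers from `b` on, and elsewhere is `s`. -/
def frame (s : Store) (b : ℕ) (x y z u : List Bool) : Store :=
  update (update (update (update s b x) (b + 1) y) (b + 2) z) (b + 3) u

section

variable (s : Store) (b : ℕ) (x y z u l : List Bool)

@[simp] theorem frame_zero : frame s b x y z u b = x := by simp [frame]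

@[simp] theorem frame_one : frame s b x y z u (b + 1) = y := by simp [frame]

@[simp] theorem frame_two : frame s b x y z u (b + 2) = z := by simp [frame]

@[simp] theorem frame_three : frame s b x y z u (b + 3) = u := by simp [frame]

@[simp] theorem update_frame_zero : update (frame s b x y z u) b l = frame s b l y z u := by
  funext r
  simp only [frame, update_apply]
  split_ifs <;> first | rfl | omega

@[simp] theorem update_frame_one : update (frame s b x y z u) (b + 1) l = frame s b x l z u := by
  funext r
  simp only [frame, update_apply]
  split_ifs <;> first | rfl | omega

@[simp] theorem update_frame_two : update (frame s b x y z u) (b + 2) l = frame s b x y l u := by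
  funext r
  simp only [frame, update_apply]
  split_ifs <;> first | rfl | omega

@[simp] theorem update_frame_three :
    update (frame s b x y z u) (b + 3) l = frame s b x y z l := by
  simp [frame]

theorem frame_eq_update (h : ∀ r > b, s r = []) : frame s b x [] [] [] = update s b x := by
  funext r
  simp only [frame, update_apply]
  split_ifs <;> first | rfl | omega | rw [h r (by omega)]

/-- A move reverses the word, hence the detour through register `b + 2`. -/
theorem exec_copyUp :
    Exec (copyUp b) (frame s b x [] [] []) (frame s b x x [] []) (9 * x.length + 2) := by
  have h₁ := exec_move (a := b) (b := b + 2) (by omega) x (frame s b x [] [] []) (by simp)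
  have h₂ := exec_moveTwo (a := b + 2) (b := b) (c := b + 1) (by omega) (by omega) (by omega)
    x.reverse (frame s b [] [] x.reverse []) (by simp)
  simp only [update_frame_zero, update_frame_one, update_frame_two, frame_zero, frame_one,
    frame_two, List.append_nil, List.reverse_reverse, List.length_reverse] at h₁ h₂
  exact (Exec.seq h₁ h₂).congr rfl (by ring)

theorem exec_swapUp :
    Exec (swapUp b) (frame s b x y [] []) (frame s b y x [] [])
      (8 * x.length + 8 * y.length + 4) := by
  have h₁ := exec_move (a := b) (b := b + 2) (by omega) x (frame s b x y [] []) (by simp)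
  have h₂ := exec_move (a := b + 1) (b := b + 3) (by omega) y (frame s b [] y x.reverse [])
    (by simp)
  have h₃ := exec_move (a := b + 2) (b := b + 1) (by omega) x.reverse
    (frame s b [] [] x.reverse y.reverse) (by simp)
  have h₄ := exec_move (a := b + 3) (b := b) (by omega) y.reverse
    (frame s b [] x [] y.reverse) (by simp)
  simp only [update_frame_zero, update_frame_one, update_frame_two, update_frame_three,
    frame_zero, frame_one, frame_two, frame_three, List.append_nil, List.reverse_reverse,
    List.length_reverse] at h₁ h₂ h₃ h₄
  exact (Exec.seq h₁ (.seq h₂ (.seq h₃ h₄))).congr rfl (by ring)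

/-- Register `b + 2` counts in unary the subtrees that are still to be read: a `true` replaces one
pending tree by two, a `false` completes one. The code of `v` therefore uses up exactly one unit.
The statement prefixes the reading of `v` to a given run, so that the two subtrees of a node can be
chained. -/
theorem exec_splitLoop (v : Tree) (rest acc cnt : List Bool) (s' : Store) (t : ℕ)
    (h : Exec (splitLoop b) (frame s b rest (v.bits.reverse ++ acc) cnt []) s' t) :
    Exec (splitLoop b) (frame s b (v.bits ++ rest) acc (true :: cnt) []) s' (t + 5 * v.size) := by
  induction v generalizing rest acc cnt t with
  | nil =>
    have hbody : Exec (seq (ite b top (seq (push (b + 1) true) (push (b + 2) true))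
        (seq (push (b + 1) false) (pop (b + 2)))) (pop b))
        (frame s b (false :: rest) acc (true :: cnt) []) (frame s b rest (false :: acc) cnt [])
        4 := by
      refine (Exec.seq (.ite_false (by simp [top]) (.seq (.push _ _ _) (.pop _ _)))
        (.pop _ _)).congr ?_ rfl
      simp
    exact (Exec.loop_step (by simp [nonempty]) hbody h).congr rfl (by simp; ring)
  | node v₁ v₂ ih₁ ih₂ =>
    have hbody : Exec (seq (ite b top (seq (push (b + 1) true) (push (b + 2) true))
        (seq (push (b + 1) false) (pop (b + 2)))) (pop b))
        (frame s b ((Tree.node v₁ v₂).bits ++ rest) acc (true :: cnt) [])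
        (frame s b (v₁.bits ++ (v₂.bits ++ rest)) (true :: acc) (true :: true :: cnt) [])
        4 := by
      refine (Exec.seq (.ite_true (by simp [top, Tree.bits]) (.seq (.push _ _ _) (.push _ _ _)))
        (.pop _ _)).congr ?_ rfl
      simp [Tree.bits]
    have h₂ := ih₁ (v₂.bits ++ rest) (true :: acc) (true :: cnt) _
      (ih₂ rest (v₁.bits.reverse ++ true :: acc) cnt t (by simpa [Tree.bits] using h))
    exact (Exec.loop_step (by simp [nonempty]) hbody h₂).congr rfl (by simp; ring)

theorem exec_split (v₁ v₂ : Tree) :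
    Exec (split b) (frame s b (Tree.node v₁ v₂).bits [] [] [])
      (frame s b v₂.bits v₁.bits.reverse [] []) (5 * v₁.size + 3) := by
  have h : Exec (splitLoop b) (frame s b v₂.bits v₁.bits.reverse [] [])
    (frame s b v₂.bits v₁.bits.reverse [] []) 1 := .loop_done (by simp [nonempty])
  have h₁ := exec_splitLoop s b v₁ v₂.bits [] [] _ _ (by simpa using h)
  have h₂ : Exec (pop b) (frame s b (Tree.node v₁ v₂).bits [] [] [])
    (frame s b (v₁.bits ++ v₂.bits) [] [] []) 1 :=
    (Exec.pop _ _).congr (by simp [Tree.bits]) rfl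
  have h₃ : Exec (push (b + 2) true) (frame s b (v₁.bits ++ v₂.bits) [] [] [])
    (frame s b (v₁.bits ++ v₂.bits) [] [true] []) 1 :=
    (Exec.push _ _ _).congr (by simp) rfl
  exact (Exec.seq h₂ (.seq h₃ h₁)).congr rfl (by ring)

end

/-- Whether a tree is not a leaf. -/
def Tree.isNode : Tree → Bool
  | nil => false
  | node _ _ => true

/-- The tree `e' i` is computed from `e i` by a program in polynomial time, uniformly in `i`.
The program works in place in any register `b` above which all registers are empty. -/
def Comp {ι : Type} (e e' : ι → Tree) : Prop :=
  ∃ (c : ℕ → Cmd) (w : ℕ) (p : Polynomial ℕ), (∀ b, (c b).RegsLE (b + w)) ∧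
    ∀ (i : ι) (b : ℕ) (s : Store), (∀ r > b, s r = []) → ∃ t ≤ p.eval (e i).size,
      Exec (c b) (update s b (e i).bits) (update s b (e' i).bits) t

/-! ### Closure properties of polynomial-time tree transformations. -/

namespace Comp

variable {ι : Type} {e e' e'' : ι → Tree}

theorem congr {d d' : ι → Tree} (h : Comp e e') (he : ∀ i, e i = d i) (he' : ∀ i, e' i = d' i) :
    Comp d d' := by
  obtain rfl : e = d := funext he
  obtain rfl : e' = d' := funext he'
  exact h

/-- The index type is arbitrary, so a program need only be correct on a given family of inputs, for
instance on the codes of instances or where a test succeeds. -/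
theorem restrict {κ : Type} (h : Comp e e') (g : κ → ι) :
    Comp (fun k => e (g k)) (fun k => e' (g k)) := by
  obtain ⟨c, w, p, hw, h⟩ := h
  exact ⟨c, w, p, hw, fun k => h (g k)⟩

theorem size_le (h : Comp e e') : ∃ p : Polynomial ℕ, ∀ i, (e' i).size ≤ p.eval (e i).size := by
  obtain ⟨c, w, p, -, h⟩ := h
  refine ⟨Polynomial.X + p, fun i => ?_⟩
  obtain ⟨t, ht, hex⟩ := h i 0 (fun _ => []) (fun _ _ => rfl)
  have := hex.length_le 0
  simp only [update_self] at this
  simp only [Polynomial.eval_add, Polynomial.eval_X]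
  exact this.trans (Nat.add_le_add_left ht _)

theorem trans (h : Comp e e') (h' : Comp e' e'') : Comp e e'' := by
  obtain ⟨q, hq⟩ := h.size_le
  obtain ⟨c, w, p, hw, h⟩ := h
  obtain ⟨c', w', p', hw', h'⟩ := h'
  refine ⟨fun b => seq (c b) (c' b), w + w', p + p'.comp q, fun b =>
    ⟨(hw b).mono (by omega), (hw' b).mono (by omega)⟩, fun i b s hs => ?_⟩
  obtain ⟨t, ht, hex⟩ := h i b s hs
  obtain ⟨t', ht', hex'⟩ := h' i b s hs
  refine ⟨t + t', ?_, hex.seq hex'⟩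
  simp only [Polynomial.eval_add, Polynomial.eval_comp]
  exact Nat.add_le_add ht (ht'.trans (eval_mono p' (hq i)))

theorem const (e : ι → Tree) (x : Tree) : Comp e (fun _ => x) := by
  refine ⟨fun b => setConst b x.bits, 0, 2 * Polynomial.X + 1 + Polynomial.C x.size, fun b =>
    regsLE_setConst le_rfl _, fun i b s _ =>
      ⟨_, ?_, (exec_setConst b x.bits _).congr (by simp) rfl⟩⟩
  simp [Tree.size]

theorem refl (e : ι → Tree) : Comp e e := by
  -- There is no empty program; a push followed by a pop serves as one.
  refine ⟨fun b => seq (push b true) (pop b), 0, 2, fun b => ⟨le_rfl, le_rfl⟩, fun i b s _ =>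
    ⟨2, by simp, (Exec.seq (.push _ _ _) (.pop _ _)).congr (by simp) rfl⟩⟩

/-- A run of the program in register `b + 1` of a frame. -/
theorem exec_one {c : ℕ → Cmd} {x y : Tree} {n : ℕ}
    (h : ∀ (b : ℕ) (s : Store), (∀ r > b, s r = []) → ∃ t ≤ n,
      Exec (c b) (update s b x.bits) (update s b y.bits) t)
    (b : ℕ) (s : Store) (hs : ∀ r > b, s r = []) (z : List Bool) : ∃ t ≤ n,
      Exec (c (b + 1)) (frame s b z x.bits [] []) (frame s b z y.bits [] []) t := by
  obtain ⟨t, ht, hex⟩ := h (b + 1) (frame s b z [] [] []) (fun r hr => by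
    rw [frame_eq_update s b z hs, update_of_ne (by omega), hs r (by omega)])
  exact ⟨t, ht, by simpa using hex⟩

/-- The second component is computed from a copy in register `b + 1`; after an exchange the first
one is computed there from the original. Two moves, which together preserve the order, put the first
code in front of the second, and `true` marks the node. -/
theorem node (h : Comp e e') (h' : Comp e e'') : Comp e (fun i => Tree.node (e' i) (e'' i)) := by
  obtain ⟨q, hq⟩ := h.size_le
  obtain ⟨q', hq'⟩ := h'.size_le
  obtain ⟨c, w, p, hw, h⟩ := h
  obtain ⟨c', w', p', hw', h'⟩ := h'
  refine ⟨fun b => seq (copyUp b) (seq (c' (b + 1)) (seq (swapUp b) (seq (c (b + 1))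
    (seq (move (b + 1) (b + 2)) (seq (move (b + 2) b) (push b true)))))), w + w' + 4,
    9 * Polynomial.X + 2 + p' + (8 * Polynomial.X + 8 * q' + 4) + p + (8 * q + 3), fun b => ?_,
    fun i b s hs => ?_⟩
  · have h₁ := (hw (b + 1)).mono (show b + 1 + w ≤ b + (w + w' + 4) by omega)
    have h₂ := (hw' (b + 1)).mono (show b + 1 + w' ≤ b + (w + w' + 4) by omega)
    simp only [RegsLE, copyUp, move, moveTwo, swapUp, h₁, h₂, true_and]
    omega
  · obtain ⟨t₁, ht₁, h₁⟩ := exec_one (h' i) b s hs (e i).bits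
    obtain ⟨t₂, ht₂, h₂⟩ := exec_one (h i) b s hs (e'' i).bits
    have m₁ := exec_move (a := b + 1) (b := b + 2) (by omega) (e' i).bits
      (frame s b (e'' i).bits (e' i).bits [] []) (by simp)
    have m₂ := exec_move (a := b + 2) (b := b) (by omega) (e' i).bits.reverse
      (frame s b (e'' i).bits [] (e' i).bits.reverse []) (by simp)
    have m₃ := Exec.push b true (frame s b ((e' i).bits ++ (e'' i).bits) [] [] [])
    simp only [update_frame_zero, update_frame_one, update_frame_two, frame_zero,
      frame_two, List.append_nil, List.reverse_reverse, List.length_reverse] at m₁ m₂ m₃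
    have hex := (exec_copyUp s b (e i).bits).seq (h₁.seq ((exec_swapUp s b _ _).seq
      (h₂.seq (m₁.seq (m₂.seq m₃)))))
    rw [frame_eq_update s b _ hs, frame_eq_update s b _ hs] at hex
    refine ⟨_, ?_, hex⟩
    have a₁ := hq i
    have a₂ := hq' i
    simp only [Tree.size] at *
    simp
    omega

/-- The left subtree of a node. -/
theorem left (h : Comp e fun i => Tree.node (e' i) (e'' i)) : Comp e e' := by
  refine h.trans ⟨fun b => seq (split b) (seq (clear b) (move (b + 1) b)), 2,
    11 * Polynomial.X + 6, fun b => ?_, fun i b s hs => ?_⟩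
  · simp only [RegsLE, clear, move, split, splitLoop]
    omega
  · have m₁ := exec_clear b (e'' i).bits (frame s b (e'' i).bits (e' i).bits.reverse [] [])
      (by simp)
    have m₂ := exec_move (a := b + 1) (b := b) (by omega) (e' i).bits.reverse
      (frame s b [] (e' i).bits.reverse [] []) (by simp)
    simp only [update_frame_zero, update_frame_one, frame_zero, List.append_nil,
      List.reverse_reverse, List.length_reverse] at m₁ m₂
    have hex := (exec_split s b (e' i) (e'' i)).seq (m₁.seq m₂)
    rw [frame_eq_update s b _ hs, frame_eq_update s b _ hs] at hex
    refine ⟨_, ?_, hex⟩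
    simp [Tree.size, Tree.bits]
    omega

/-- The right subtree of a node. -/
theorem right (h : Comp e fun i => Tree.node (e' i) (e'' i)) : Comp e e'' := by
  refine h.trans ⟨fun b => seq (split b) (clear (b + 1)), 2,
    7 * Polynomial.X + 6, fun b => ?_, fun i b s hs => ?_⟩
  · simp only [RegsLE, clear, split, splitLoop]
    omega
  · have m₁ := exec_clear (b + 1) (e' i).bits.reverse
      (frame s b (e'' i).bits (e' i).bits.reverse [] []) (by simp)
    simp only [update_frame_one, List.length_reverse] at m₁
    have hex := (exec_split s b (e' i) (e'' i)).seq m₁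
    rw [frame_eq_update s b _ hs, frame_eq_update s b _ hs] at hex
    refine ⟨_, ?_, hex⟩
    simp [Tree.size, Tree.bits]
    omega

theorem isNode (h : Comp e e') : Comp e fun i => Tree.ofBool (e' i).isNode := by
  refine h.trans ⟨fun b => ite b top (setConst b (Tree.ofBool true).bits)
    (setConst b (Tree.ofBool false).bits), 0, 2 * Polynomial.X + 5, fun b =>
    ⟨le_rfl, regsLE_setConst le_rfl _,
      regsLE_setConst le_rfl _⟩, fun i b s _ => ?_⟩
  cases hx : e' i with
  | nil =>
    exact ⟨_, by simp [Tree.size, Tree.bits, Tree.ofBool],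
      (Exec.ite_false (by simp [top, Tree.bits])
      (exec_setConst b _ _)).congr (by dsimp only; rw [hx]; simp [Tree.isNode]) rfl⟩
  | node x y =>
    exact ⟨_, by simp [Tree.size, Tree.bits, Tree.ofBool]; omega,
      (Exec.ite_true (by simp [top, Tree.bits])
        (exec_setConst b _ _)).congr (by dsimp only; rw [hx]; simp [Tree.isNode]) rfl⟩

theorem head_ofBool (b : Bool) : top (Tree.ofBool b).bits.head? = b := by
  cases b <;> rfl

theorem size_ofBool_le (b : Bool) : (Tree.ofBool b).size ≤ 3 := by
  cases b <;> simp [Tree.ofBool]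

/-- The test is applied to a copy. Each branch has to be correct only on the inputs that reach it,
which makes partial operations such as taking the head of a nonempty list available. -/
theorem cond {g : ι → Bool} (hg : Comp e fun i => Tree.ofBool (g i))
    (h : Comp (fun i : {i // g i = true} => e i) fun i => e' i)
    (h' : Comp (fun i : {i // g i = false} => e i) fun i => e'' i) :
    Comp e fun i => if g i = true then e' i else e'' i := by
  obtain ⟨c₀, w₀, p₀, hw₀, h₀⟩ := hg
  obtain ⟨c, w, p, hw, h⟩ := h
  obtain ⟨c', w', p', hw', h'⟩ := h'
  refine ⟨fun b => seq (copyUp b) (seq (c₀ (b + 1)) (Cmd.ite (b + 1) top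
    (seq (clear (b + 1)) (c b)) (seq (clear (b + 1)) (c' b)))), w₀ + w + w' + 2,
    9 * Polynomial.X + 2 + p₀ + 8 + p + p', fun b => ?_, fun i b s hs => ?_⟩
  · have h₁ := (hw₀ (b + 1)).mono (show b + 1 + w₀ ≤ b + (w₀ + w + w' + 2) by omega)
    have h₂ := (hw b).mono (show b + w ≤ b + (w₀ + w + w' + 2) by omega)
    have h₃ := (hw' b).mono (show b + w' ≤ b + (w₀ + w + w' + 2) by omega)
    simp only [RegsLE, copyUp, move, moveTwo, clear, h₁, h₂, h₃, true_and, and_true]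
    omega
  · obtain ⟨t₀, ht₀, h₀⟩ := exec_one (h₀ i) b s hs (e i).bits
    have m₁ := exec_clear (b + 1) (Tree.ofBool (g i)).bits
      (frame s b (e i).bits (Tree.ofBool (g i)).bits [] []) (by simp)
    simp only [update_frame_one] at m₁
    rw [frame_eq_update s b _ hs] at m₁
    have hcopy := exec_copyUp s b (e i).bits
    rw [frame_eq_update s b _ hs] at hcopy
    have hsz := size_ofBool_le (g i)
    cases hi : g i with
    | true =>
      obtain ⟨t, ht, h⟩ := h ⟨i, hi⟩ b s hs
      refine ⟨_, ?_, (hcopy.seq (h₀.seq (.ite_true ?_ (m₁.seq h)))).congr (by simp [hi]) rfl⟩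
      · simp only [Tree.size] at *
        simp
        omega
      · rw [frame_one, head_ofBool, hi]
    | false =>
      obtain ⟨t, ht, h⟩ := h' ⟨i, hi⟩ b s hs
      refine ⟨_, ?_, (hcopy.seq (h₀.seq (.ite_false ?_ (m₁.seq h)))).congr (by simp [hi]) rfl⟩
      · simp only [Tree.size] at *
        simp
        omega
      · rw [frame_one, head_ofBool, hi]

/-- Iteration. The states are `S i 0, …, S i (N i)`; their number and their sizes have to be
bounded by a polynomial. -/
theorem iterate (S : ι → ℕ → Tree) (N : ι → ℕ)
    (hcond : Comp (fun x : {x : ι × ℕ // x.2 ≤ N x.1} => S x.1.1 x.1.2)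
      fun x => Tree.ofBool (decide (x.1.2 < N x.1.1)))
    (hstep : Comp (fun x : {x : ι × ℕ // x.2 < N x.1} => S x.1.1 x.1.2)
      fun x => S x.1.1 (x.1.2 + 1))
    (q : Polynomial ℕ) (hN : ∀ i, N i ≤ q.eval (S i 0).size)
    (hS : ∀ i, ∀ k ≤ N i, (S i k).size ≤ q.eval (S i 0).size) :
    Comp (fun i => S i 0) fun i => S i (N i) := by
  obtain ⟨c₀, w₀, p₀, hw₀, h₀⟩ := hcond
  obtain ⟨c, w, p, hw, h⟩ := hstep
  refine ⟨fun b => seq (seq (copyUp b) (c₀ (b + 1))) (seq (Cmd.loop (b + 1) top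
    (seq (clear (b + 1)) (seq (c b) (seq (copyUp b) (c₀ (b + 1)))))) (clear (b + 1))),
    w₀ + w + 2, (9 * q + 2 + p₀.comp q) + q * (8 + p.comp q + (9 * q + 2 + p₀.comp q)) + 1 + 7,
    fun b => ?_, fun i b s hs => ?_⟩
  · have h₁ := (hw₀ (b + 1)).mono (show b + 1 + w₀ ≤ b + (w₀ + w + 2) by omega)
    have h₂ := (hw b).mono (show b + w ≤ b + (w₀ + w + 2) by omega)
    simp only [RegsLE, copyUp, move, moveTwo, clear, h₁, h₂, true_and, and_true]
    omega
  · obtain ⟨n, hn⟩ : ∃ n, n = q.eval (S i 0).size := ⟨_, rfl⟩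
    have htest : ∀ k ≤ N i, ∃ t ≤ 9 * n + 2 + p₀.eval n,
        Exec (seq (copyUp b) (c₀ (b + 1))) (update s b (S i k).bits)
          (frame s b (S i k).bits (Tree.ofBool (decide (k < N i))).bits [] []) t := by
      intro k hk
      obtain ⟨t₀, ht₀, h₀⟩ := exec_one (h₀ ⟨(i, k), hk⟩) b s hs (S i k).bits
      have hcopy := exec_copyUp s b (S i k).bits
      rw [frame_eq_update s b _ hs] at hcopy
      refine ⟨_, ?_, hcopy.seq h₀⟩
      have h₁ := hS i k hk
      have h₂ := ht₀.trans (eval_mono p₀ h₁)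
      rw [← hn] at h₁ h₂
      simp only [Tree.size] at h₁
      omega
    -- Induction on the number `d` of rounds that remain; register `b + 1` holds the outcome of the
    -- test for the next round.
    have hloop : ∀ d k, k + d = N i →
        ∃ t ≤ d * (8 + p.eval n + (9 * n + 2 + p₀.eval n)) + 1,
        Exec (Cmd.loop (b + 1) top
          (seq (clear (b + 1)) (seq (c b) (seq (copyUp b) (c₀ (b + 1))))))
          (frame s b (S i k).bits (Tree.ofBool (decide (k < N i))).bits [] [])
          (frame s b (S i (N i)).bits (Tree.ofBool false).bits [] []) t := by
      intro d
      induction d with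
      | zero =>
        intro k hk
        obtain rfl : k = N i := by omega
        refine ⟨1, by omega, (Exec.loop_done ?_).congr (by simp) rfl⟩
        rw [frame_one, head_ofBool]
        simp
      | succ d ih =>
        intro k hk
        obtain ⟨t₁, ht₁, h₁⟩ := ih (k + 1) (by omega)
        obtain ⟨t₂, ht₂, h₂⟩ := htest (k + 1) (by omega)
        obtain ⟨t₃, ht₃, h₃⟩ := h ⟨(i, k), by simp; omega⟩ b s hs
        have m₁ := exec_clear (b + 1) (Tree.ofBool (decide (k < N i))).bits
          (frame s b (S i k).bits (Tree.ofBool (decide (k < N i))).bits [] []) (by simp)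
        simp only [update_frame_one] at m₁
        rw [frame_eq_update s b _ hs] at m₁
        refine ⟨_, ?_, Exec.loop_step ?_ (m₁.seq (h₃.seq h₂)) h₁⟩
        · have hsz := size_ofBool_le (decide (k < N i))
          have h₁ := ht₃.trans (eval_mono p (hS i k (by omega)))
          rw [← hn] at h₁
          simp only [Tree.size] at hsz
          have hmul := Nat.add_one_mul d (8 + p.eval n + (9 * n + 2 + p₀.eval n))
          omega
        · rw [frame_one, head_ofBool]
          simp
          omega
    obtain ⟨t₁, ht₁, h₁⟩ := htest 0 (by omega)
    obtain ⟨t₂, ht₂, h₂⟩ := hloop (N i) 0 (by omega)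
    have m₁ := exec_clear (b + 1) (Tree.ofBool false).bits
      (frame s b (S i (N i)).bits (Tree.ofBool false).bits [] []) (by simp)
    simp only [update_frame_one] at m₁
    rw [frame_eq_update s b _ hs] at m₁
    refine ⟨_, ?_, h₁.seq (h₂.seq m₁)⟩
    have hsz := size_ofBool_le false
    have hb := Nat.mul_le_mul_right (8 + p.eval n + (9 * n + 2 + p₀.eval n)) (hN i)
    rw [← hn] at hb
    simp only [Tree.size] at hsz
    simp only [Polynomial.eval_add, Polynomial.eval_mul, Polynomial.eval_comp,
      Polynomial.eval_ofNat,
      Polynomial.eval_one, ← hn]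
    omega

end Comp

end RegMachine

/-! ### Functions between types of data that are computable in polynomial time -/

namespace RegMachine

/-- Types whose elements are represented by trees. -/
class Enc (α : Type) where
  /-- The representation. -/
  enc : α → Tree

open Enc

instance : Enc Bool := ⟨Tree.ofBool⟩

instance {α β : Type} [Enc α] [Enc β] : Enc (α × β) := ⟨fun x => .node (enc x.1) (enc x.2)⟩

instance {α : Type} [Enc α] : Enc (List α) := ⟨fun l => Tree.ofList (l.map enc)⟩

instance : Enc ℕ := ⟨fun n => enc n.bits⟩

/-- The representation of extended natural numbers. -/
def encENat : ℕ∞ → Tree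
  | ⊤ => .nil
  | (n : ℕ) => .node .nil (enc n)

instance : Enc ℕ∞ := ⟨encENat⟩

/-- The size of the representation. -/
def esize {α : Type} [Enc α] (a : α) : ℕ := (enc a).size

/-- The function is computable in polynomial time. -/
@[fun_prop]
def PolyTime {α β : Type} [Enc α] [Enc β] (f : α → β) : Prop :=
  Comp (fun a => enc a) fun a => enc (f a)

section

variable {α β γ δ : Type} [Enc α] [Enc β] [Enc γ] [Enc δ]

theorem enc_prod (a : α) (b : β) : enc (a, b) = .node (enc a) (enc b) := rfl

theorem enc_cons (a : α) (l : List α) : enc (a :: l) = .node (enc a) (enc l) := rfl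

@[simp] theorem esize_prod (a : α) (b : β) : esize (a, b) = esize a + esize b + 1 := by
  simp [esize, enc_prod]

@[simp] theorem esize_nil : esize ([] : List α) = 1 := rfl

@[simp] theorem esize_cons (a : α) (l : List α) : esize (a :: l) = esize a + esize l + 1 := by
  simp [esize, enc_cons]

theorem esize_bool_le (b : Bool) : esize b ≤ 3 := Comp.size_ofBool_le b

theorem length_lt_esize (l : List α) : l.length < esize l := by
  induction l with
  | nil => simp
  | cons a l ih => simp; omega

theorem esize_le_of_mem {a : α} {l : List α} (h : a ∈ l) : esize a ≤ esize l := by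
  induction l with
  | nil => simp at h
  | cons b l ih =>
    rcases List.mem_cons.mp h with rfl | h
    · simp; omega
    · have := ih h
      simp; omega

theorem esize_le_of_sublist {l l' : List α} (h : l.Sublist l') : esize l ≤ esize l' := by
  induction h with
  | slnil => rfl
  | cons a _ ih => simp; omega
  | cons_cons a _ ih => simp; omega

theorem esize_append (l l' : List α) : esize (l ++ l') + 1 = esize l + esize l' := by
  induction l with
  | nil => simp; omega
  | cons a l ih => simp; omega

@[simp] theorem esize_reverse (l : List α) : esize l.reverse = esize l := by
  induction l with
  | nil => rfl
  | cons a l ih =>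
    have := esize_append l.reverse [a]
    simp at *
    omega

theorem esize_le_of_forall {l : List α} {n : ℕ} (h : ∀ a ∈ l, esize a ≤ n) :
    esize l ≤ l.length * (n + 1) + 1 := by
  induction l with
  | nil => simp
  | cons a l ih =>
    have h₁ := h a (by simp)
    have h₂ := ih fun b hb => h b (by simp [hb])
    simp only [esize_cons, List.length_cons, Nat.add_one_mul]
    omega

/-! ### Polynomial-time functions on pairs, truth values and lists. -/

namespace PolyTime

theorem congr {f g : α → β} (hf : PolyTime f) (h : ∀ a, f a = g a) : PolyTime g := by
  obtain rfl : f = g := funext h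
  exact hf

theorem esize_le {f : α → β} (hf : PolyTime f) :
    ∃ p : Polynomial ℕ, ∀ a, esize (f a) ≤ p.eval (esize a) := Comp.size_le hf

@[fun_prop]
theorem id : PolyTime fun a : α => a := Comp.refl _

@[fun_prop]
theorem const (b : β) : PolyTime fun _ : α => b := Comp.const _ _

@[fun_prop]
theorem comp {g : β → γ} {f : α → β} (hg : PolyTime g) (hf : PolyTime f) :
    PolyTime fun a => g (f a) := Comp.trans hf (Comp.restrict hg f)

@[fun_prop]
theorem prodMk {f : α → β} {g : α → γ} (hf : PolyTime f) (hg : PolyTime g) :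
    PolyTime fun a => (f a, g a) := Comp.node hf hg

@[fun_prop]
theorem fst {f : α → β × γ} (hf : PolyTime f) : PolyTime fun a => (f a).1 := Comp.left hf

@[fun_prop]
theorem snd {f : α → β × γ} (hf : PolyTime f) : PolyTime fun a => (f a).2 := Comp.right hf

@[fun_prop]
theorem cond {c : α → Bool} {f g : α → β} (hc : PolyTime c) (hf : PolyTime f)
    (hg : PolyTime g) : PolyTime fun a => bif c a then f a else g a := by
  refine (Comp.cond (e' := fun a => enc (f a)) (e'' := fun a => enc (g a)) hc
    (Comp.restrict hf Subtype.val) (Comp.restrict hg Subtype.val)).congr (fun _ => rfl) fun a => ?_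
  dsimp only
  cases c a <;> rfl

@[fun_prop]
theorem and {f g : α → Bool} (hf : PolyTime f) (hg : PolyTime g) :
    PolyTime fun a => f a && g a := by
  have : (fun a => f a && g a) = fun a => bif f a then g a else false := by
    funext a; cases f a <;> rfl
  rw [this]
  fun_prop

@[fun_prop]
theorem or {f g : α → Bool} (hf : PolyTime f) (hg : PolyTime g) :
    PolyTime fun a => f a || g a := by
  have : (fun a => f a || g a) = fun a => bif f a then true else g a := by
    funext a; cases f a <;> rfl
  rw [this]
  fun_prop

@[fun_prop]
theorem not {f : α → Bool} (hf : PolyTime f) : PolyTime fun a => !f a := by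
  have : (fun a => !f a) = fun a => bif f a then false else true := by
    funext a; cases f a <;> rfl
  rw [this]
  fun_prop

@[fun_prop]
theorem cons {f : α → β} {g : α → List β} (hf : PolyTime f) (hg : PolyTime g) :
    PolyTime fun a => f a :: g a := Comp.node hf hg

@[fun_prop]
theorem isEmpty {l : α → List β} (hl : PolyTime l) : PolyTime fun a => (l a).isEmpty := by
  have h : PolyTime fun a => !(l a).isEmpty := by
    refine (Comp.isNode hl).congr (fun _ => rfl) fun a => ?_
    dsimp only
    cases l a <;> rfl
  simpa using h.not

/-- Definition by cases on a list. -/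
theorem listCases {l : α → List β} {f : α → γ} {g : α × β × List β → γ} (hl : PolyTime l)
    (hf : PolyTime f) (hg : PolyTime g) :
    PolyTime fun a => match l a with
      | [] => f a
      | b :: t => g (a, b, t) := by
  refine (Comp.cond (e' := fun a => enc (f a)) (e'' := fun a => match l a with
      | [] => enc (f a)
      | b :: t => enc (g (a, b, t))) (isEmpty hl) (Comp.restrict hf Subtype.val) ?_).congr
    (fun _ => rfl) fun a => ?_
  · have hne (a : {a // (l a).isEmpty = false}) : l a.1 ≠ [] := by simpa using a.2
    have h₁ : Comp (fun a : {a // (l a).isEmpty = false} => enc a.1)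
        fun a => enc (a.1, (l a.1).head (hne a), (l a.1).tail) :=
      Comp.node (Comp.refl _) ((Comp.restrict hl Subtype.val).congr (fun _ => rfl) fun a => by
        conv_lhs => rw [← List.cons_head_tail (hne a)]
        rfl)
    refine (h₁.trans (Comp.restrict hg _)).congr (fun _ => rfl) fun a => ?_
    have := hne a
    split
    · contradiction
    · next h => simp [h]
  · dsimp only
    cases l a <;> rfl

@[fun_prop]
theorem tail {l : α → List β} (hl : PolyTime l) : PolyTime fun a => (l a).tail := by
  refine (listCases (g := fun x => x.2.2) hl (const []) (by fun_prop)).congr fun a => ?_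
  cases l a <;> rfl

/-- Iteration over triples of the parameter, the accumulator and the rest of the list. The
hypothesis `hq` on intermediate accumulators is essential: iterating a polynomial-time step may
otherwise produce exponentially large values. -/
theorem foldl {l : α → List δ} {init : α → β} {step : α × β × δ → β} (hl : PolyTime l)
    (hinit : PolyTime init) (hstep : PolyTime step) (q : Polynomial ℕ)
    (hq : ∀ a, ∀ k ≤ (l a).length,
      esize (((l a).take k).foldl (fun b d => step (a, b, d)) (init a)) ≤ q.eval (esize a)) :
    PolyTime fun a => (l a).foldl (fun b d => step (a, b, d)) (init a) := by
  obtain ⟨p, hp⟩ := hl.esize_le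
  have h := Comp.iterate (ι := α)
    (fun a k => enc (a, ((l a).take k).foldl (fun b d => step (a, b, d)) (init a), (l a).drop k))
    (fun a => (l a).length) ?_ ?_ (Polynomial.X + q + p + 2) ?_ ?_
  · have h₁ : Comp (fun a => enc a) fun a => enc (a, init a, l a) :=
      prodMk id (prodMk hinit hl)
    have h₂ := h₁.trans h
    simp only [List.take_length] at h₂
    exact Comp.left (Comp.right h₂)
  · have h₁ : PolyTime fun x : α × β × List δ => !x.2.2.isEmpty := by fun_prop
    refine (Comp.restrict h₁ fun x : {x : α × ℕ // x.2 ≤ (l x.1).length} => (x.1.1,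
      ((l x.1.1).take x.1.2).foldl (fun b d => step (x.1.1, b, d)) (init x.1.1),
        (l x.1.1).drop x.1.2)).congr (fun _ => rfl) fun x => congrArg Tree.ofBool ?_
    rw [Bool.eq_iff_iff]
    simp
  · have h₁ : PolyTime fun x : α × β × δ × List δ =>
        (x.1, step (x.1, x.2.1, x.2.2.1), x.2.2.2) := by fun_prop
    refine (Comp.restrict h₁ fun x : {x : α × ℕ // x.2 < (l x.1).length} => (x.1.1,
      ((l x.1.1).take x.1.2).foldl (fun b d => step (x.1.1, b, d)) (init x.1.1),
        (l x.1.1)[x.1.2]'x.2, (l x.1.1).drop (x.1.2 + 1))).congr (fun x => ?_) fun x => ?_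
    · rw [List.drop_eq_getElem_cons x.2]
      rfl
    · simp only [List.take_add_one, List.getElem?_eq_getElem x.2, List.foldl_append]
      rfl
  · intro a
    have h₁ := hp a
    have h₂ := length_lt_esize (l a)
    have h₃ := eval_mono p (show esize a ≤ esize (a, init a, l a) by simp; omega)
    simp only [Polynomial.eval_add, Polynomial.eval_X, List.take_zero, List.drop_zero,
      List.foldl_nil]
    change _ ≤ esize (a, init a, l a) + q.eval (esize (a, init a, l a)) +
      p.eval (esize (a, init a, l a)) + _
    omega
  · intro a k hk
    have h₁ := hq a k hk
    have h₂ := esize_le_of_sublist (List.drop_sublist k (l a))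
    have h₃ := eval_mono p (show esize a ≤ esize (a, init a, l a) by simp; omega)
    have h₄ := eval_mono q (show esize a ≤ esize (a, init a, l a) by simp; omega)
    have h₅ := hp a
    simp only [Polynomial.eval_add, Polynomial.eval_X, List.take_zero, List.drop_zero,
      List.foldl_nil]
    change esize (a, _, _) ≤ esize (a, init a, l a) + q.eval (esize (a, init a, l a)) +
      p.eval (esize (a, init a, l a)) + _
    simp only [Polynomial.eval_ofNat]
    rw [esize_prod, esize_prod]
    have h₆ : esize a ≤ esize (a, init a, l a) := by simp; omega
    omega

@[fun_prop]
theorem all {l : α → List β} {p : α → β → Bool} (hl : PolyTime l)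
    (hp : PolyTime fun x : α × β => p x.1 x.2) : PolyTime fun a => (l a).all (p a) := by
  refine (foldl (step := fun x : α × Bool × β => x.2.1 && p x.1 x.2.2) (init := fun _ => true)
    hl (const true) ((snd id).fst.and (hp.comp ((fst id).prodMk (snd id).snd))) 3
    fun a k _ => by simpa using esize_bool_le _).congr fun a => ?_
  have h (l : List β) (b : Bool) : l.foldl (fun b d => b && p a d) b = (b && l.all (p a)) := by
    induction l generalizing b with
    | nil => simp
    | cons x l ih => simp [ih, Bool.and_assoc]
  simpa using h (l a) true

@[fun_prop]
theorem any {l : α → List β} {p : α → β → Bool} (hl : PolyTime l)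
    (hp : PolyTime fun x : α × β => p x.1 x.2) : PolyTime fun a => (l a).any (p a) :=
  (all (p := fun a b => !p a b) hl hp.not).not.congr fun a => by simp [List.not_all_eq_any_not]

@[fun_prop]
theorem reverse {l : α → List β} (hl : PolyTime l) : PolyTime fun a => (l a).reverse := by
  obtain ⟨q, hq⟩ := hl.esize_le
  have h (l l' : List β) : l.foldl (fun b d => d :: b) l' = l.reverse ++ l' := by
    induction l generalizing l' with
    | nil => simp
    | cons x l ih => simp [ih]
  refine (foldl (step := fun x : α × List β × β => x.2.2 :: x.2.1) (init := fun _ => [])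
    hl (const []) (by fun_prop) q fun a k _ => ?_).congr fun a => by simp [h]
  simp only [h, List.append_nil, esize_reverse]
  exact (esize_le_of_sublist (List.take_sublist k (l a))).trans (hq a)

-- The fold collects the images in reverse order, which is undone at the end. For the size bound,
-- `p` limits the number of entries and `q`, applied to the size of the parameter together with an
-- entry, the size of each image.
@[fun_prop]
theorem map {l : α → List β} {f : α → β → γ} (hl : PolyTime l)
    (hf : PolyTime fun x : α × β => f x.1 x.2) : PolyTime fun a => (l a).map (f a) := by
  obtain ⟨p, hp⟩ := hl.esize_le
  obtain ⟨q, hq⟩ := hf.esize_le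
  have h (a : α) (l : List β) (l' : List γ) :
      l.foldl (fun b d => f a d :: b) l' = (l.map (f a)).reverse ++ l' := by
    induction l generalizing l' with
    | nil => simp
    | cons x l ih => simp [ih]
  refine (foldl (step := fun x : α × List γ × β => f x.1 x.2.2 :: x.2.1) (init := fun _ => [])
    hl (const []) (by fun_prop) (p * (q.comp (Polynomial.X + p + 1) + 1) + 1)
    fun a k _ => ?_).reverse.congr
    fun a => by simp [h]
  simp only [h, List.append_nil, esize_reverse]
  refine (esize_le_of_forall (n := q.eval (esize a + p.eval (esize a) + 1)) fun c hc => ?_).trans ?_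
  · obtain ⟨b, hb, rfl⟩ := List.mem_map.mp hc
    have h₁ := esize_le_of_mem (List.mem_of_mem_take hb)
    have h₂ := hp a
    refine (hq (a, b)).trans (eval_mono q ?_)
    rw [esize_prod]
    omega
  · have h₁ := length_lt_esize (l a)
    have h₂ := hp a
    simp only [Polynomial.eval_add, Polynomial.eval_mul, Polynomial.eval_comp, Polynomial.eval_X,
      Polynomial.eval_one]
    refine Nat.add_le_add_right (Nat.mul_le_mul_right _ ?_) 1
    simp
    omega

@[fun_prop]
theorem filter {l : α → List β} {p : α → β → Bool} (hl : PolyTime l)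
    (hp : PolyTime fun x : α × β => p x.1 x.2) : PolyTime fun a => (l a).filter (p a) := by
  obtain ⟨q, hq⟩ := hl.esize_le
  have h (a : α) (l : List β) (l' : List β) :
      l.foldl (fun b d => bif p a d then d :: b else b) l' = (l.filter (p a)).reverse ++ l' := by
    induction l generalizing l' with
    | nil => simp
    | cons x l ih => cases hx : p a x <;> simp [ih, hx]
  refine (foldl (step := fun x : α × List β × β => bif p x.1 x.2.2 then x.2.2 :: x.2.1 else x.2.1)
    (init := fun _ => []) hl (const [])
    (cond (hp.comp ((fst id).prodMk (snd id).snd)) (by fun_prop) (by fun_prop))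
    q fun a k _ => ?_).reverse.congr fun a => by simp [h]
  simp only [h, List.append_nil, esize_reverse]
  exact (esize_le_of_sublist (List.filter_sublist.trans (List.take_sublist k (l a)))).trans (hq a)

@[fun_prop]
theorem append {l l' : α → List β} (hl : PolyTime l) (hl' : PolyTime l') :
    PolyTime fun a => l a ++ l' a := by
  obtain ⟨q, hq⟩ := hl.esize_le
  obtain ⟨q', hq'⟩ := hl'.esize_le
  have h (l l' : List β) : l.foldl (fun b d => d :: b) l' = l.reverse ++ l' := by
    induction l generalizing l' with
    | nil => simp
    | cons x l ih => simp [ih]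
  refine (foldl (step := fun x : α × List β × β => x.2.2 :: x.2.1) hl.reverse hl' (by fun_prop)
    (q + q') fun a k _ => ?_).congr fun a => by simp [h]
  have h₁ := hq a
  have h₂ := hq' a
  have h₃ := esize_le_of_sublist (List.take_sublist k (l a).reverse)
  have h₄ := esize_append ((l a).reverse.take k).reverse (l' a)
  rw [esize_reverse] at h₃ h₄
  rw [h, Polynomial.eval_add]
  omega

end PolyTime

end

/-! #### Numbers -/

/-- Add a carry to a binary number, least significant digit first. -/
def addCarry : Bool → List Bool → List Bool
  | c, [] => bif c then [true] else []
  | c, b :: l => (c ^^ b) :: addCarry (c && b) l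

theorem bits_bit (b : Bool) (n : ℕ) (h : n = 0 → b = true) : (Nat.bit b n).bits = b :: n.bits :=
  Nat.bits_append_bit n b h

theorem addCarry_false (l : List Bool) : addCarry false l = l := by
  induction l with
  | nil => rfl
  | cons b l ih => simp [addCarry, ih]

theorem addCarry_true (n : ℕ) : addCarry true n.bits = (n + 1).bits := by
  induction n using Nat.binaryRec' with
  | zero => simp [addCarry]
  | bit b n h ih =>
    rw [bits_bit b n h, addCarry]
    cases b
    · have : Nat.bit false n + 1 = Nat.bit true n := by simp [Nat.bit_val]
      rw [this, bits_bit true n (fun _ => rfl)]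
      simp [addCarry_false]
    · have : Nat.bit true n + 1 = Nat.bit false (n + 1) := by simp [Nat.bit_val]; ring
      rw [this, bits_bit false (n + 1) (by simp)]
      simp [ih]

/-- Compare binary numbers, least significant digit first; `v` is the verdict for equal numbers. -/
def bitsLE : Bool → List Bool → List Bool → Bool
  | v, [], l' => v || !l'.isEmpty
  | v, b :: l, l' => bitsLE (bif b == l'.headD false then v else !b) l l'.tail

theorem bits_eq_nil_iff (n : ℕ) : n.bits = [] ↔ n = 0 := by
  constructor
  · intro h
    induction n using Nat.binaryRec' with
    | zero => rfl
    | bit b n h' => rw [bits_bit b n h'] at h; simp at h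
  · rintro rfl; simp

/-- A more significant digit overrides the verdict of the less significant ones, so the verdict is
updated at each position where the digits differ. The shorter number is padded by `false`. Digits
left over in the second number make it larger, because the leading digit of a positive number is
`true`. -/
theorem bitsLE_bits (v : Bool) (m n : ℕ) :
    bitsLE v m.bits n.bits = if m = n then v else decide (m < n) := by
  induction m using Nat.binaryRec' generalizing v n with
  | zero =>
    by_cases hn : n = 0
    · subst hn; simp [bitsLE]
    · have : n.bits.isEmpty = false := by
        simpa [bits_eq_nil_iff] using hn
      simp [bitsLE, this, Ne.symm hn, Nat.pos_of_ne_zero hn]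
  | bit b m h ih =>
    rw [bits_bit b m h, bitsLE]
    induction n using Nat.binaryRec' with
    | zero =>
      have h₀ : ([] : List Bool) = (0 : ℕ).bits := by simp
      rw [Nat.zero_bits, List.tail_nil, h₀, ih]
      have : Nat.bit b m ≠ 0 := by
        rw [Nat.bit_val]
        cases b
        · have : m ≠ 0 := fun e => by simpa using h e
          simpa using this
        · simp
      rw [if_neg this]
      by_cases hm : m = 0
      · obtain rfl := h hm
        simp [hm]
      · simp [hm]
    | bit b' n h' _ =>
      rw [bits_bit b' n h', List.headD_cons, List.tail_cons, ih]
      simp only [Nat.bit_val]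
      rcases lt_trichotomy m n with hmn | rfl | hmn
      · rw [if_neg hmn.ne, if_neg]
        · simp only [hmn, decide_true]
          symm
          rw [decide_eq_true_eq]
          cases b <;> cases b' <;> simp <;> omega
        · cases b <;> cases b' <;> simp <;> omega
      · cases b <;> cases b' <;> simp
      · rw [if_neg hmn.ne', if_neg]
        · rw [decide_eq_decide]
          cases b <;> cases b' <;> simp <;> omega
        · cases b <;> cases b' <;> simp <;> omega

/-! ### Successor, length and comparison in binary. -/

namespace PolyTime

variable {α β : Type} [Enc α] [Enc β]

/-- A number and the list of its binary digits are represented by the same tree, so arithmetic can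
be done on lists of bits. -/
theorem bits {f : α → ℕ} (hf : PolyTime f) : PolyTime fun a => (f a).bits := hf

theorem of_bits {f : α → ℕ} (hf : PolyTime fun a => (f a).bits) : PolyTime f := hf

@[fun_prop]
theorem beqBool {f g : α → Bool} (hf : PolyTime f) (hg : PolyTime g) :
    PolyTime fun a => f a == g a :=
  (show PolyTime fun a => bif f a then g a else !g a by fun_prop).congr fun a => by
    cases f a <;> simp

@[fun_prop]
theorem headD {l : α → List β} (d : β) (hl : PolyTime l) : PolyTime fun a => (l a).headD d :=
  (listCases (g := fun x => x.2.1) hl (const d) (by fun_prop)).congr fun a => by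
    cases l a <;> rfl

theorem esize_bits_le (l : List Bool) : esize l ≤ l.length * 4 + 1 :=
  esize_le_of_forall fun b _ => esize_bool_le b

-- This is `addCarry` as a left fold: the accumulator consists of the carry and of the digits
-- produced so far, in reverse order.
@[fun_prop]
theorem succ {f : α → ℕ} (hf : PolyTime f) : PolyTime fun a => f a + 1 := by
  obtain ⟨q, hq⟩ := hf.bits.esize_le
  have h (c : Bool) (l l' : List Bool) :
      l.foldl (fun x b => (x.1 && b, (x.1 ^^ b) :: x.2)) (c, l') =
        ((l.foldl (fun x b => (x.1 && b, (x.1 ^^ b) :: x.2)) (c, l')).1,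
          (l.foldl (fun x b => (x.1 && b, (x.1 ^^ b) :: x.2)) (c, l')).2) := rfl
  have hfold : PolyTime fun a => (f a).bits.foldl
      (fun (x : Bool × List Bool) b => (x.1 && b, (x.1 ^^ b) :: x.2)) (true, []) := by
    refine foldl (step := fun x : α × (Bool × List Bool) × Bool =>
      (x.2.1.1 && x.2.2, (x.2.1.1 ^^ x.2.2) :: x.2.1.2)) hf.bits (const (true, []))
      (PolyTime.congr (f := fun x : α × (Bool × List Bool) × Bool =>
      (x.2.1.1 && x.2.2, (!(x.2.1.1 == x.2.2)) :: x.2.1.2)) (by fun_prop) fun x => ?_)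
      (4 * q + 5) fun a k _ => ?_
    · cases x.2.1.1 <;> cases x.2.2 <;> rfl
    · have hlen (l : List Bool) (x : Bool × List Bool) :
          (l.foldl (fun x b => (x.1 && b, (x.1 ^^ b) :: x.2)) x).2.length =
            l.length + x.2.length := by
        induction l generalizing x with
        | nil => simp
        | cons b l ih => simp [ih]; omega
      have h₁ := hlen ((f a).bits.take k) (true, [])
      have h₂ := hq a
      have h₃ := length_lt_esize (f a).bits
      generalize ((f a).bits.take k).foldl (fun x b => (x.1 && b, (x.1 ^^ b) :: x.2)) (true, []) = y
        at *
      have h₄ := esize_bits_le y.2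
      have h₅ := esize_bool_le y.1
      have h₆ := esize_prod y.1 y.2
      have h₇ : ((f a).bits.take k).length ≤ (f a).bits.length := by simp
      simp only [Polynomial.eval_add, Polynomial.eval_mul, Polynomial.eval_ofNat]
      simp only [List.length_nil] at h₁
      change esize (y.1, y.2) ≤ _
      omega
  refine of_bits (PolyTime.congr (f := fun a => ((fun x : Bool × List Bool =>
    bif x.1 then true :: x.2 else x.2) ((f a).bits.foldl
      (fun (x : Bool × List Bool) b => (x.1 && b, (x.1 ^^ b) :: x.2)) (true, []))).reverse)
      (by fun_prop) fun a => ?_)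
  have h (l l' : List Bool) (c : Bool) : ((fun x : Bool × List Bool =>
      bif x.1 then true :: x.2 else x.2) (l.foldl
        (fun (x : Bool × List Bool) b => (x.1 && b, (x.1 ^^ b) :: x.2)) (c, l'))).reverse =
        l'.reverse ++ addCarry c l := by
    induction l generalizing c l' with
    | nil => cases c <;> simp [addCarry]
    | cons b l ih =>
      rw [List.foldl_cons, ih]
      simp [addCarry]
  rw [h, addCarry_true]
  rfl

@[fun_prop]
theorem length {l : α → List β} (hl : PolyTime l) : PolyTime fun a => (l a).length := by
  obtain ⟨q, hq⟩ := hl.esize_le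
  have h (l : List β) (n : ℕ) : l.foldl (fun k _ => k + 1) n = n + l.length := by
    induction l generalizing n with
    | nil => simp
    | cons b l ih => simp [ih]; ring
  refine (foldl (step := fun x : α × ℕ × β => x.2.1 + 1) (init := fun _ => 0) hl (const 0)
    (by fun_prop) (4 * q + 1) fun a k _ => ?_).congr fun a => by simp [h]
  rw [h]
  have h₁ := hq a
  have h₂ := length_lt_esize (l a)
  have h₃ : ((l a).take k).length ≤ (l a).length := by simp
  have h₄ (n : ℕ) : n.bits.length ≤ n := by
    rw [Nat.size_eq_bits_len]
    exact Nat.size_le.mpr Nat.lt_two_pow_self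
  have h₅ := esize_bits_le (0 + ((l a).take k).length).bits
  have h₆ := h₄ (0 + ((l a).take k).length)
  simp only [Polynomial.eval_add, Polynomial.eval_mul, Polynomial.eval_ofNat, Polynomial.eval_one]
  change esize (0 + ((l a).take k).length).bits ≤ _
  omega

-- This is `bitsLE` as a fold over the digits of the first number. The accumulator holds the verdict
-- and the remaining digits of the second number, so it never grows beyond them.
@[fun_prop]
theorem natBle {f g : α → ℕ} (hf : PolyTime f) (hg : PolyTime g) :
    PolyTime fun a => Nat.ble (f a) (g a) := by
  obtain ⟨q, hq⟩ := hg.bits.esize_le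
  have hfold : PolyTime fun a => (f a).bits.foldl
      (fun (x : Bool × List Bool) b => (bif b == x.2.headD false then x.1 else !b, x.2.tail))
      (true, (g a).bits) := by
    refine foldl (step := fun x : α × (Bool × List Bool) × Bool =>
      (bif x.2.2 == x.2.1.2.headD false then x.2.1.1 else !x.2.2, x.2.1.2.tail)) hf.bits
      (init := fun a => (true, (g a).bits)) ((const true).prodMk hg.bits) ?_ (q + 4) fun a k _ => ?_
    · fun_prop
    · have hsub (l : List Bool) (x : Bool × List Bool) : (l.foldl
          (fun (x : Bool × List Bool) b => (bif b == x.2.headD false then x.1 else !b, x.2.tail))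
          x).2.Sublist x.2 := by
        induction l generalizing x with
        | nil => simp
        | cons b l ih => exact (ih _).trans (List.tail_sublist _)
      have h₁ := esize_le_of_sublist (hsub ((f a).bits.take k) (true, (g a).bits))
      generalize ((f a).bits.take k).foldl
        (fun (x : Bool × List Bool) b => (bif b == x.2.headD false then x.1 else !b, x.2.tail))
        (true, (g a).bits) = y at *
      dsimp only at h₁
      have h₂ := hq a
      have h₅ := esize_bool_le y.1
      have h₆ := esize_prod y.1 y.2
      simp only [Polynomial.eval_add, Polynomial.eval_ofNat]
      change esize (y.1, y.2) ≤ _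
      omega
  refine PolyTime.congr (f := fun a => (fun x : Bool × List Bool => x.1 || !x.2.isEmpty)
    ((f a).bits.foldl (fun (x : Bool × List Bool) b =>
      (bif b == x.2.headD false then x.1 else !b, x.2.tail)) (true, (g a).bits)))
      (by fun_prop) fun a => ?_
  have h (l l' : List Bool) (v : Bool) : (fun x : Bool × List Bool => x.1 || !x.2.isEmpty)
      (l.foldl (fun (x : Bool × List Bool) b =>
        (bif b == x.2.headD false then x.1 else !b, x.2.tail)) (v, l')) = bitsLE v l l' := by
    induction l generalizing v l' with
    | nil => rfl
    | cons b l ih => rw [List.foldl_cons, ih, bitsLE]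
  rw [h, bitsLE_bits, Bool.eq_iff_iff, Nat.ble_eq]
  split_ifs with h
  · simp [h]
  · rw [decide_eq_true_eq]
    omega

@[fun_prop]
theorem natBeq {f g : α → ℕ} (hf : PolyTime f) (hg : PolyTime g) :
    PolyTime fun a => Nat.beq (f a) (g a) :=
  (show PolyTime fun a => Nat.ble (f a) (g a) && Nat.ble (g a) (f a) by fun_prop).congr fun a => by
    rw [Bool.eq_iff_iff]
    simp
    omega

/-- The value `⊤` is represented by a leaf and every finite value by a node. -/
theorem isTop {f : α → ℕ∞} (hf : PolyTime f) : PolyTime fun a => decide (f a = ⊤) := by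
  have h : PolyTime fun a => !decide (f a = ⊤) := by
    refine (Comp.isNode hf).congr (fun _ => rfl) fun a => ?_
    dsimp only
    cases f a with
    | top => simp; rfl
    | coe n => simp; rfl
  simpa using h.not

@[fun_prop]
theorem toNat {f : α → ℕ∞} (hf : PolyTime f) : PolyTime fun a => (f a).toNat := by
  refine (Comp.cond (e' := fun _ => enc (0 : ℕ)) (e'' := fun a => enc (f a).toNat) hf.isTop
    (Comp.const _ _) ?_).congr (fun _ => rfl) fun a => ?_
  · refine Comp.right (e' := fun _ => Tree.nil)
      ((Comp.restrict hf Subtype.val).congr (fun _ => rfl) fun a => ?_)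
    have ha : f a.1 ≠ ⊤ := by simpa using a.2
    generalize f a.1 = x at *
    cases x with
    | top => contradiction
    | coe n => rfl
  · dsimp only
    cases f a with
    | top => simp
    | coe n => simp

@[fun_prop]
theorem natCast {f : α → ℕ} (hf : PolyTime f) : PolyTime fun a => (f a : ℕ∞) :=
  Comp.node (Comp.const _ _) hf

@[fun_prop]
theorem enatLE {f g : α → ℕ∞} (hf : PolyTime f) (hg : PolyTime g) :
    PolyTime fun a => decide (f a ≤ g a) := by
  have h₁ := hf.isTop
  have h₂ := hg.isTop
  refine (show PolyTime fun a => decide (g a = ⊤) ||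
    (!decide (f a = ⊤) && Nat.ble (f a).toNat (g a).toNat) by fun_prop).congr fun a => ?_
  rw [Bool.eq_iff_iff]
  cases f a <;> cases g a <;> simp

end PolyTime

end RegMachine

/-! ### Parsing the input -/

namespace RegMachine

open Enc

/-- A code of tokens by three bits. -/
def tokenBits : Token → Bool × Bool × Bool
  | .bit b => (true, b, false)
  | .endm => (false, true, true)
  | .infty => (false, true, false)
  | .opn => (false, false, true)
  | .cls => (false, false, false)

instance : Enc Token := ⟨fun t => enc (tokenBits t)⟩

@[fun_prop]
theorem polyTime_tokenBits : PolyTime tokenBits := Comp.refl _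

instance : Enc IntMult := ⟨fun I => enc (I.lo, I.hi, I.opt)⟩

/-- The representation of the objects of `α` by words of tokens, of which no one is a prefix of
another one, can be decoded in polynomial time. -/
def Parses {α : Type} [Enc α] (e : α → List Token) : Prop :=
  Comp (fun x : α × List Token => enc (e x.1 ++ x.2)) fun x => enc x

namespace Parses

variable {α β : Type} [Enc α] [Enc β]

theorem comap {e : α → List Token} (h : Parses e) (g : β → α) (hg : ∀ b, enc (g b) = enc b) :
    Parses fun b => e (g b) :=
  (Comp.restrict h fun x : β × List Token => (g x.1, x.2)).congr (fun _ => rfl) fun x => by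
    rw [enc_prod, hg]
    rfl

theorem seq {e : α → List Token} {e' : β → List Token} (h : Parses e) (h' : Parses e') :
    Parses fun x : α × β => e x.1 ++ e' x.2 := by
  have h₁ := Comp.restrict h fun x : (α × β) × List Token => (x.1.1, e' x.1.2 ++ x.2)
  have h₂ := Comp.restrict h' fun x : (α × β) × List Token => (x.1.2, x.2)
  have h₃ : Comp (fun x : (α × β) × List Token => enc (e x.1.1 ++ (e' x.1.2 ++ x.2)))
      fun x => enc (x.1.1, x.1.2, x.2) := Comp.node (Comp.left h₁) ((Comp.right h₁).trans h₂)
  have h₄ : PolyTime fun x : α × β × List Token => ((x.1, x.2.1), x.2.2) := by fun_prop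
  exact (h₃.trans (Comp.restrict h₄ _)).congr (fun x => by rw [List.append_assoc]) fun _ => rfl

theorem cons {e : α → List Token} (h : Parses e) (t : Token) : Parses fun a => t :: e a := by
  have h₁ : PolyTime fun l : List Token => l.tail := by fun_prop
  exact (Comp.restrict h₁ fun x : α × List Token => t :: (e x.1 ++ x.2)).trans h

theorem bit : Parses fun b => [Token.bit b] := by
  have h₁ : PolyTime fun l : List Token => ((tokenBits (l.headD .cls)).2.1, l.tail) := by fun_prop
  exact Comp.restrict h₁ fun x : Bool × List Token => Token.bit x.1 :: x.2

/-- One entry is decoded in each round until the terminator is on top. By `hne` the terminator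
cannot be mistaken for the start of an entry, and no code is empty, so there are at most as many
rounds as tokens. -/
theorem many {e : α → List Token} (h : Parses e) (term : Token)
    (hterm : PolyTime fun t : Token => decide (t = term))
    (hne : ∀ a, ∃ t l, e a = t :: l ∧ t ≠ term) :
    Parses fun l : List α => l.flatMap e ++ [term] := by
  obtain ⟨p, hp⟩ := Comp.size_le h
  have length_le_flatMap (l : List α) : l.length ≤ (l.flatMap e).length := by
    induction l with
    | nil => simp
    | cons a l ih =>
      obtain ⟨t, l', htl, -⟩ := hne a
      rw [List.flatMap_cons, List.length_append, htl, List.length_cons, List.length_cons]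
      omega
  -- In state `k` the first `k` entries are decoded and kept in reverse order, and the others are
  -- still tokens.
  have h₁ := Comp.iterate (ι := List α × List Token)
    (fun x k => enc ((x.1.take k).reverse, (x.1.drop k).flatMap e ++ term :: x.2))
    (fun x => x.1.length) ?_ ?_ (Polynomial.X * (p + 1) + 2 + 2 * Polynomial.X) ?_ ?_
  · have h₂ : PolyTime fun l : List Token => (([] : List α), l) := by fun_prop
    have h₃ : PolyTime fun x : List α × List Token => (x.1.reverse, x.2.tail) := by fun_prop
    refine ((Comp.restrict h₂ fun x : List α × List Token =>
      x.1.flatMap e ++ [term] ++ x.2).trans (h₁.congr (fun x => ?_) fun x => rfl)).trans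
      ((Comp.restrict h₃ fun x : List α × List Token => (x.1.reverse, term :: x.2)).congr
        (fun x => ?_) fun x => ?_)
    · simp
    · simp
    · simp
  · have h₂ : PolyTime fun x : List α × List Token => !decide (x.2.headD term = term) :=
      (hterm.comp (f := fun x : List α × List Token => x.2.headD term) (by fun_prop)).not
    refine (Comp.restrict h₂ fun x : {x : (List α × List Token) × ℕ // x.2 ≤ x.1.1.length} =>
      ((x.1.1.1.take x.1.2).reverse, (x.1.1.1.drop x.1.2).flatMap e ++ term :: x.1.1.2)).congr
      (fun _ => rfl) fun x => congrArg Tree.ofBool ?_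
    rw [Bool.eq_iff_iff]
    by_cases hlt : x.1.2 < x.1.1.1.length
    · obtain ⟨t, l, htl, ht⟩ := hne (x.1.1.1[x.1.2])
      rw [List.drop_eq_getElem_cons hlt, List.flatMap_cons, htl]
      simp [ht, hlt]
    · rw [List.drop_eq_nil_of_le (by omega)]
      simp [hlt]
  · have h₂ : PolyTime fun x : List α × α × List Token => (x.2.1 :: x.1, x.2.2) := by fun_prop
    have h₃ : Comp (fun x : {x : (List α × List Token) × ℕ // x.2 < x.1.1.length} =>
        enc ((x.1.1.1.take x.1.2).reverse, e (x.1.1.1[x.1.2]'x.2) ++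
          ((x.1.1.1.drop (x.1.2 + 1)).flatMap e ++ term :: x.1.1.2)))
        fun x => enc ((x.1.1.1.take x.1.2).reverse, x.1.1.1[x.1.2]'x.2,
          (x.1.1.1.drop (x.1.2 + 1)).flatMap e ++ term :: x.1.1.2) :=
      Comp.node (Comp.left (Comp.refl _)) ((Comp.right (Comp.refl _)).trans
        (Comp.restrict h fun x : {x : (List α × List Token) × ℕ // x.2 < x.1.1.length} =>
          (x.1.1.1[x.1.2]'x.2, (x.1.1.1.drop (x.1.2 + 1)).flatMap e ++ term :: x.1.1.2)))
    refine (h₃.trans (Comp.restrict h₂ _)).congr (fun x => ?_) fun x => ?_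
    · rw [List.drop_eq_getElem_cons x.2, List.flatMap_cons, List.append_assoc]
    · simp only [List.take_add_one, List.getElem?_eq_getElem x.2, List.reverse_append]
      rfl
  · rintro ⟨l, r⟩
    have h₂ := length_le_flatMap l
    have h₃ := length_lt_esize (l.flatMap e ++ term :: r)
    simp only [List.length_append] at h₃
    simp only [Polynomial.eval_add, Polynomial.eval_mul, Polynomial.eval_X, Polynomial.eval_ofNat]
    change _ ≤ _ + 2 * esize (([] : List α), l.flatMap e ++ term :: r)
    rw [esize_prod]
    omega
  · rintro ⟨l, r⟩ k hk
    have h₂ := length_le_flatMap l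
    have h₃ := length_lt_esize (l.flatMap e ++ term :: r)
    simp only [List.length_append] at h₃
    have h₄ : esize ((l.drop k).flatMap e ++ term :: r) ≤ esize (l.flatMap e ++ term :: r) := by
      refine esize_le_of_sublist (List.Sublist.append ?_ (List.Sublist.refl _))
      conv_rhs => rw [← List.take_append_drop k l, List.flatMap_append]
      exact List.sublist_append_right _ _
    have h₅ : ∀ a ∈ (l.take k).reverse,
        esize a ≤ p.eval (esize (([] : List α), l.flatMap e ++ term :: r)) := by
      intro a ha
      have ha' : a ∈ l := List.mem_of_mem_take (List.mem_reverse.mp ha)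
      -- The size of an entry is estimated from its own code with nothing behind it. That code is
      -- part of the original input, so the bounds of different rounds do not compound.
      have h₆ := hp (a, [])
      have h₇ : esize a ≤ (enc (a, ([] : List Token))).size := by
        change esize a ≤ esize (a, ([] : List Token))
        rw [esize_prod]
        omega
      refine h₇.trans (h₆.trans (eval_mono p ?_))
      change esize (e a ++ []) ≤ _
      rw [List.append_nil, esize_prod]
      have h₈ : (e a).Sublist (l.flatMap e ++ term :: r) :=
        (List.sublist_flatten_of_mem (List.mem_map_of_mem ha')).trans
          (List.sublist_append_left _ _)
      have := esize_le_of_sublist h₈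
      omega
    have h₉ := esize_le_of_forall h₅
    simp only [Polynomial.eval_add, Polynomial.eval_mul, Polynomial.eval_X, Polynomial.eval_ofNat,
      Polynomial.eval_one]
    change esize (_, _) ≤ esize (([] : List α), l.flatMap e ++ term :: r) *
      (p.eval (esize (([] : List α), l.flatMap e ++ term :: r)) + 1) + 2 +
      2 * esize (([] : List α), l.flatMap e ++ term :: r)
    have h₁₀ : (l.take k).reverse.length ≤ esize (([] : List α), l.flatMap e ++ term :: r) := by
      rw [esize_prod]
      simp
      omega
    have h₁₁ := Nat.mul_le_mul_right
      (p.eval (esize (([] : List α), l.flatMap e ++ term :: r)) + 1) h₁₀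
    have h₁₂ := esize_prod (l.take k).reverse ((l.drop k).flatMap e ++ term :: r)
    have h₁₃ := esize_prod ([] : List α) (l.flatMap e ++ term :: r)
    omega

theorem nat : Parses Encode.nat := by
  have h₁ : PolyTime fun t : Token => decide (t = Token.endm) :=
    PolyTime.congr (f := fun t => !(tokenBits t).1 && (tokenBits t).2.1 && (tokenBits t).2.2)
      (by fun_prop) fun t => by
        rcases t with (b | _) | _ | _ | _ | _ <;> rfl
  have h := (bit.many Token.endm h₁ fun b => ⟨_, _, rfl, by simp⟩).comap (fun n : ℕ => n.bits)
    fun _ => rfl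
  convert h using 2 with n
  rw [Encode.nat]
  congr 1
  induction n.bits with
  | nil => rfl
  | cons b l ih => simp [ih]

theorem list {e : α → List Token} (h : Parses e) (hne : ∀ a, ∃ t l, e a = t :: l ∧ t ≠ Token.cls) :
    Parses (Encode.list e) := by
  have h₁ : PolyTime fun t : Token => decide (t = Token.cls) :=
    PolyTime.congr (f := fun t => !(tokenBits t).1 && !(tokenBits t).2.1 && !(tokenBits t).2.2)
      (by fun_prop) fun t => by
        rcases t with (b | _) | _ | _ | _ | _ <;> rfl
  exact (h.many Token.cls h₁ hne).cons Token.opn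

theorem nat_ne (n : ℕ) (l' : List Token) :
    ∃ t l, Encode.nat n ++ l' = t :: l ∧ t ≠ Token.cls ∧ t ≠ Token.infty := by
  unfold Encode.nat
  cases n.bits with
  | nil => exact ⟨_, _, rfl, by simp⟩
  | cons b l => exact ⟨_, _, rfl, by simp⟩

/-- The code of a natural number never begins with `infty`, so the first token decides between the
two cases. -/
theorem enat : Parses Encode.enat := by
  have h₁ : PolyTime fun l : List Token => !(tokenBits (l.headD .cls)).1 &&
    (tokenBits (l.headD .cls)).2.1 && !(tokenBits (l.headD .cls)).2.2 := by fun_prop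
  have h₂ : PolyTime fun l : List Token => ((⊤ : ℕ∞), l.tail) := by fun_prop
  have h₃ : PolyTime fun x : ℕ × List Token => ((x.1 : ℕ∞), x.2) := by fun_prop
  have h₅ : Comp (fun x : ℕ × List Token => enc (Encode.nat x.1 ++ x.2))
      fun x => enc ((x.1 : ℕ∞), x.2) := Comp.trans nat h₃
  have h₄ : Comp (fun x : ℕ∞ × List Token => enc (Encode.enat x.1 ++ x.2))
      fun x => enc (decide (x.1 = ⊤)) := by
    refine (Comp.restrict h₁ _).congr (fun _ => rfl) fun x => congrArg Tree.ofBool ?_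
    obtain ⟨x, l⟩ := x
    cases x with
    | top => rfl
    | coe n =>
      simp only [Encode.enat, Encode.nat]
      cases n.bits <;> simp [tokenBits]
  refine (Comp.cond (e' := fun x => enc x) (e'' := fun x => enc x) h₄ ?_ ?_).congr (fun _ => rfl)
    fun x => by simp
  · refine (Comp.restrict h₂ _).congr (fun _ => rfl) fun x => ?_
    obtain ⟨⟨x, l⟩, hx⟩ := x
    obtain rfl : x = ⊤ := by simpa using hx
    rfl
  · refine (Comp.restrict h₅ fun x : {x : ℕ∞ × List Token // decide (x.1 = ⊤) = false} =>
      (x.1.1.toNat, x.1.2)).congr (fun x => ?_) fun x => ?_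
    · obtain ⟨⟨x, l⟩, hx⟩ := x
      lift x to ℕ using by simpa using hx
      rfl
    · obtain ⟨⟨x, l⟩, hx⟩ := x
      lift x to ℕ using by simpa using hx
      rfl

theorem interval : Parses Encode.interval := by
  have h := (nat.seq (enat.seq bit)).comap (fun I : IntMult => (I.lo, I.hi, I.opt)) fun _ => rfl
  convert h using 2 with I
  simp [Encode.interval]

theorem atom : Parses Encode.atom :=
  (nat.seq interval).list fun a => by
    obtain ⟨t, l, h, ht, -⟩ := nat_ne a.1 (Encode.interval a.2)
    exact ⟨t, l, h, ht⟩

theorem clause : Parses Encode.clause :=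
  (atom.seq interval).list fun _ => ⟨_, _, rfl, by simp⟩

theorem dime : Parses fun E : RawDIME ℕ =>
    Encode.list (fun x => Encode.clause x.1 ++ Encode.interval x.2) E :=
  (clause.seq interval).list fun _ => ⟨_, _, rfl, by simp⟩

theorem word : Parses Encode.word :=
  nat.list fun a => by
    obtain ⟨t, l, h, ht, -⟩ := nat_ne a []
    exact ⟨t, l, by simpa using h, ht⟩

theorem membership : Comp (fun x : List ℕ × DIME ℕ => enc (Encode.membership x))
    fun x => enc (x.1, x.2.1) :=
  Comp.left ((Comp.restrict (word.seq dime) fun x : List ℕ × DIME ℕ => ((x.1, x.2.1), [])).congr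
    (fun x => by simp [Encode.membership, Encode.dime]) fun _ => rfl)

theorem containment : Comp (fun x : DIME ℕ × DIME ℕ => enc (Encode.containment x))
    fun x => enc (x.1.1, x.2.1) :=
  Comp.left ((Comp.restrict (dime.seq dime) fun x : DIME ℕ × DIME ℕ => ((x.1.1, x.2.1), [])).congr
    (fun x => by simp [Encode.containment, Encode.dime]) fun _ => rfl)

end Parses

/-- A problem is decided in polynomial time if the answer is computed in polynomial time from the
word of tokens for the instance. -/
theorem inPTIME_of_comp {ι : Type} {e : ι → List Token} {P : ι → Prop} (f : ι → Bool)
    (hf : ∀ i, f i = true ↔ P i) (h : Comp (fun i => enc (e i)) fun i => enc (f i)) :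
    InPTIME e P := by
  refine ⟨f, hf, ?_⟩
  -- The machine presents the input in reverse order, so the program begins with a reversal.
  have h₁ : PolyTime fun l : List Token => l.reverse := by fun_prop
  obtain ⟨c, w, p, hc, hrun⟩ := ((Comp.restrict h₁ fun i => (e i).reverse).congr (fun _ => rfl)
    fun i => by dsimp only; rw [List.reverse_reverse]).trans h
  refine nonempty_computableInPolyTime e f enc w (c 0) ((hc 0).mono (by omega))
    (p.comp (12 * Polynomial.X + 1)) fun i => ?_
  obtain ⟨t, ht, hex⟩ := hrun i 0 (fun _ => []) fun _ _ => rfl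
  refine ⟨t, ht.trans ?_, ?_⟩
  · rw [Polynomial.eval_comp]
    refine eval_mono p ?_
    change esize (e i).reverse ≤ _
    rw [esize_reverse]
    -- A token is a triple of bits of size at most 3 each, and the two pairs add 1 each, which makes
    -- 11; each list cell adds 1 more.
    refine (esize_le_of_forall (n := 11) fun t _ => ?_).trans ?_
    · have h₁ : esize (tokenBits t) = _ := esize_prod (tokenBits t).1 (tokenBits t).2
      have h₂ : esize (tokenBits t).2 = _ := esize_prod (tokenBits t).2.1 (tokenBits t).2.2
      have h₃ := esize_bool_le (tokenBits t).1
      have h₄ := esize_bool_le (tokenBits t).2.1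
      have h₅ := esize_bool_le (tokenBits t).2.2
      change esize (tokenBits t) ≤ _
      omega
    · simp
      omega
  · rw [← List.map_reverse]
    exact hex

end RegMachine

/-! ### Normal forms of disjunctive interval multiplicity expressions -/

namespace NormalForm

/-- An atom with an interval: a word consists of `k` times every symbol of `mand` and at most `k`
times every symbol of `opt`, where `lo ≤ k ≤ hi`. -/
structure NAtom where
  mand : List ℕ
  opt : List ℕ
  lo : ℕ
  hi : ℕ∞

/-- The symbols of an atom. -/
def NAtom.syms (x : NAtom) : List ℕ := x.mand ++ x.opt

/-- A clause: any number of atoms (at most one if `excl` is set) may be present, and at least one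
has to be unless `zero` is set. -/
structure NFactor where
  excl : Bool
  zero : Bool
  atoms : List NAtom

/-- An unordered concatenation of clauses. -/
abbrev NExpr := List NFactor

/-- The number of occurrences of the symbols fits to `k` copies of the atom. -/
structure NAtom.Fits (x : NAtom) (c : ℕ → ℕ) (k : ℕ) : Prop where
  mand : ∀ a ∈ x.mand, c a = k
  opt : ∀ a ∈ x.opt, c a ≤ k

/-- The atom occurs `k` times, where `k` is zero or in the interval. -/
def NAtom.InRange (x : NAtom) (k : ℕ) : Prop := k = 0 ∨ x.lo ≤ k ∧ (k : ℕ∞) ≤ x.hi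

/-- The constraints that an atom puts on the numbers of occurrences of its symbols. -/
structure NAtom.Sat (x : NAtom) (c : ℕ → ℕ) : Prop where
  le : ∀ a ∈ x.mand, ∀ b ∈ x.syms, c b ≤ c a
  hi : ∀ a ∈ x.syms, (c a : ℕ∞) ≤ x.hi
  lo : ∀ a ∈ x.mand, c a = 0 ∨ x.lo ≤ c a

/-- Multiplicities `k` of the atoms are admissible. -/
structure Admissible (E : NExpr) (k : NAtom → ℕ) : Prop where
  range : ∀ F ∈ E, ∀ x ∈ F.atoms, x.InRange (k x)
  excl : ∀ F ∈ E, F.excl = true → ∀ x ∈ F.atoms, ∀ y ∈ F.atoms, k x ≠ 0 → k y ≠ 0 → x = y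
  zero : ∀ F ∈ E, F.zero = true ∨ ∃ x ∈ F.atoms, k x ≠ 0

/-- Occurrence numbers `c` result from multiplicities `k` of the atoms. -/
structure Accepts (E : NExpr) (c : ℕ → ℕ) (k : NAtom → ℕ) : Prop extends Admissible E k where
  supp : ∀ a, c a ≠ 0 → ∃ F ∈ E, ∃ x ∈ F.atoms, a ∈ x.syms
  fits : ∀ F ∈ E, ∀ x ∈ F.atoms, x.Fits c (k x)

/-- The constraints that an expression puts on occurrence numbers. -/
structure Sat (E : NExpr) (c : ℕ → ℕ) : Prop where
  supp : ∀ a, c a ≠ 0 → ∃ F ∈ E, ∃ x ∈ F.atoms, a ∈ x.syms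
  atom : ∀ F ∈ E, ∀ x ∈ F.atoms, x.Sat c
  excl : ∀ F ∈ E, F.excl = true → ∀ x ∈ F.atoms, ∀ a ∈ x.syms, ∀ y ∈ F.atoms, ∀ b ∈ y.syms,
    c a ≠ 0 → c b ≠ 0 → b ∈ x.syms
  zero : ∀ F ∈ E, F.zero = true ∨ ∃ x ∈ F.atoms, ∃ a ∈ x.syms, c a ≠ 0

/-- Well-formed atoms. -/
structure NAtom.WF (x : NAtom) : Prop where
  disj : ∀ a ∈ x.mand, a ∉ x.opt
  ne : x.syms ≠ []
  one_le : 1 ≤ x.lo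
  lo_le : (x.lo : ℕ∞) ≤ x.hi

/-- Well-formed expressions: a symbol determines the clause and the atom where it occurs, and a
clause that has an atom without mandatory symbols contains the empty word. -/
structure WF (E : NExpr) : Prop where
  atom : ∀ F ∈ E, ∀ x ∈ F.atoms, x.WF
  disj : ∀ F ∈ E, ∀ x ∈ F.atoms, ∀ G ∈ E, ∀ y ∈ G.atoms, ∀ a, a ∈ x.syms → a ∈ y.syms →
    F = G ∧ x = y
  zero : ∀ F ∈ E, ∀ x ∈ F.atoms, x.mand = [] → F.zero = true

theorem NAtom.mem_syms {x : NAtom} {a : ℕ} : a ∈ x.syms ↔ a ∈ x.mand ∨ a ∈ x.opt :=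
  List.mem_append

theorem NAtom.Fits.le {x : NAtom} {c : ℕ → ℕ} {k a : ℕ} (h : x.Fits c k) (ha : a ∈ x.syms) :
    c a ≤ k := by
  rcases NAtom.mem_syms.mp ha with ha | ha
  · exact (h.mand a ha).le
  · exact h.opt a ha

theorem NAtom.Fits.sat {x : NAtom} {c : ℕ → ℕ} {k : ℕ} (h : x.Fits c k) (hk : x.InRange k) :
    x.Sat c where
  le a ha b hb := by
    rw [h.mand a ha]
    exact h.le hb
  hi a ha := by
    have hle : (c a : ℕ∞) ≤ k := by exact_mod_cast h.le ha
    rcases hk with rfl | hk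
    · have : c a = 0 := by simpa using hle
      simp [this]
    · exact hle.trans hk.2
  lo a ha := by
    rw [h.mand a ha]
    exact hk.imp_right And.left

/-- If some symbol of the atom occurs, `k` is the common number of occurrences of the mandatory
symbols. Without mandatory symbols it is the maximum of `lo` and of the occurrence numbers, which
lies in the interval since intervals have no gaps. If no symbol occurs, `k = 0`; the last clause of
the conclusion holds because `lo ≥ 1`. -/
theorem NAtom.Sat.exists_fits {x : NAtom} (hx : x.WF) {c : ℕ → ℕ} (h : x.Sat c) :
    ∃ k, x.Fits c k ∧ x.InRange k ∧ (k ≠ 0 ↔ ∃ a ∈ x.syms, c a ≠ 0) := by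
  by_cases h₀ : ∃ b ∈ x.syms, c b ≠ 0
  · obtain ⟨b, hb, hcb⟩ := h₀
    by_cases hm : x.mand = []
    · have hsyms : x.syms = x.opt := by simp [NAtom.syms, hm]
      have hone := hx.one_le
      refine ⟨max x.lo (x.syms.toFinset.sup c), ⟨by simp [hm], fun a ha => ?_⟩,
        Or.inr ⟨le_max_left _ _, ?_⟩, ⟨fun _ => ⟨b, hb, hcb⟩, fun _ => by omega⟩⟩
      · exact le_max_of_le_right (Finset.le_sup (by simpa [hsyms] using ha))
      · obtain ⟨a, ha, hsup⟩ := Finset.exists_mem_eq_sup x.syms.toFinset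
          ⟨b, by simpa using hb⟩ c
        rw [hsup]
        rcases max_choice x.lo (c a) with e | e
        · rw [e]; exact hx.lo_le
        · rw [e]; exact h.hi a (by simpa using ha)
    · obtain ⟨a, ha⟩ := List.exists_mem_of_ne_nil _ hm
      have ha' : a ∈ x.syms := NAtom.mem_syms.mpr (.inl ha)
      have hca : c a ≠ 0 := by
        have := h.le a ha b hb
        omega
      refine ⟨c a, ⟨fun a' ha'' => ?_, fun a' ha'' => ?_⟩, Or.inr ⟨?_, h.hi a ha'⟩,
        ⟨fun _ => ⟨b, hb, hcb⟩, fun _ => hca⟩⟩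
      · exact le_antisymm (h.le a ha a' (NAtom.mem_syms.mpr (.inl ha''))) (h.le a' ha'' a ha')
      · exact h.le a ha a' (NAtom.mem_syms.mpr (.inr ha''))
      · exact (h.lo a ha).resolve_left hca
  · have h₁ : ∀ a ∈ x.syms, c a = 0 := fun a ha => by
      by_contra hc
      exact h₀ ⟨a, ha, hc⟩
    exact ⟨0, ⟨fun a ha => h₁ a (NAtom.mem_syms.mpr (.inl ha)),
      fun a ha => (h₁ a (NAtom.mem_syms.mpr (.inr ha))).le⟩, .inl rfl,
      ⟨fun h => absurd rfl h, fun h => absurd h h₀⟩⟩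

theorem Accepts.exists_atom {E : NExpr} {c : ℕ → ℕ} {k : NAtom → ℕ} (h : Accepts E c k) {a : ℕ}
    (ha : c a ≠ 0) : ∃ F ∈ E, ∃ x ∈ F.atoms, a ∈ x.syms ∧ c a ≤ k x ∧ x.lo ≤ k x ∧
      (k x : ℕ∞) ≤ x.hi := by
  obtain ⟨F, hF, x, hx, hax⟩ := h.supp a ha
  have h₁ := (h.fits F hF x hx).le hax
  exact ⟨F, hF, x, hx, hax, h₁, (h.range F hF x hx).resolve_left (by omega)⟩

/-- The multiplicities can be eliminated atom by atom. They are indexed by the atoms themselves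
rather than by positions; this is harmless because well-formed atoms have symbols, and a symbol
determines its clause and its atom. -/
theorem sat_iff {E : NExpr} (hE : WF E) (c : ℕ → ℕ) : Sat E c ↔ ∃ k, Accepts E c k := by
  constructor
  · intro h
    have hk : ∀ x : NAtom, ∃ k, (∃ F ∈ E, x ∈ F.atoms) →
        x.Fits c k ∧ x.InRange k ∧ (k ≠ 0 ↔ ∃ a ∈ x.syms, c a ≠ 0) := by
      intro x
      by_cases hx : ∃ F ∈ E, x ∈ F.atoms
      · obtain ⟨F, hF, hx⟩ := hx
        obtain ⟨k, hk⟩ := (h.atom F hF x hx).exists_fits (hE.atom F hF x hx)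
        exact ⟨k, fun _ => hk⟩
      · exact ⟨0, fun h => absurd h hx⟩
    choose k hk using hk
    refine ⟨k, ⟨fun F hF x hx => (hk x ⟨F, hF, hx⟩).2.1, fun F hF he x hx y hy hkx hky => ?_,
      fun F hF => (h.zero F hF).imp_right ?_⟩, h.supp, fun F hF x hx => (hk x ⟨F, hF, hx⟩).1⟩
    · obtain ⟨a, ha, hca⟩ := (hk x ⟨F, hF, hx⟩).2.2.mp hkx
      obtain ⟨b, hb, hcb⟩ := (hk y ⟨F, hF, hy⟩).2.2.mp hky
      exact (hE.disj F hF x hx F hF y hy b (h.excl F hF he x hx a ha y hy b hb hca hcb) hb).2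
    · rintro ⟨x, hx, hax⟩
      exact ⟨x, hx, (hk x ⟨F, hF, hx⟩).2.2.mpr hax⟩
  · rintro ⟨k, h⟩
    refine ⟨h.supp, fun F hF x hx => (h.fits F hF x hx).sat (h.range F hF x hx),
      fun F hF he x hx a ha y hy b hb hca hcb => ?_, fun F hF => ?_⟩
    · have h₁ := (h.fits F hF x hx).le ha
      have h₂ := (h.fits F hF y hy).le hb
      rw [h.excl F hF he x hx y hy (by omega) (by omega)]
      exact hb
    · rcases h.zero F hF with h₀ | ⟨x, hx, hk⟩
      · exact .inl h₀
      -- An atom without mandatory symbols may be present without leaving a symbol in the word; then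
      -- the clause admits the empty word anyway, by well-formedness.
      · by_cases hm : x.mand = []
        · exact .inl (hE.zero F hF x hx hm)
        · obtain ⟨a, ha⟩ := List.exists_mem_of_ne_nil _ hm
          refine .inr ⟨x, hx, a, NAtom.mem_syms.mpr (.inl ha), ?_⟩
          rw [(h.fits F hF x hx).mand a ha]
          exact hk

/-! #### Construction of accepted occurrence numbers -/

/-- Admissible multiplicities of the atoms are realised by occurrence numbers; those of optional
symbols are as close to prescribed numbers as possible. -/
theorem Admissible.exists_accepts {E : NExpr} (hE : WF E) {k : NAtom → ℕ} (hk : Admissible E k)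
    (o : ℕ → ℕ) : ∃ c, Accepts E c k ∧
      ∀ F ∈ E, ∀ x ∈ F.atoms, ∀ a ∈ x.opt, c a = min (o a) (k x) := by
  -- Mandatory symbols get `k x`, optional ones `min (o a) (k x)`, and foreign symbols 0. There is
  -- no conflict, since a symbol has only one atom and only one role in it.
  have hc : ∀ a, ∃ n, (∀ F ∈ E, ∀ x ∈ F.atoms, (a ∈ x.mand → n = k x) ∧
      (a ∈ x.opt → n = min (o a) (k x))) ∧ (n ≠ 0 → ∃ F ∈ E, ∃ x ∈ F.atoms, a ∈ x.syms) := by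
    intro a
    by_cases ha : ∃ F ∈ E, ∃ x ∈ F.atoms, a ∈ x.syms
    · obtain ⟨F, hF, x, hx, hax⟩ := ha
      have huniq : ∀ G ∈ E, ∀ y ∈ G.atoms, a ∈ y.syms → y = x := fun G hG y hy hay =>
        (hE.disj G hG y hy F hF x hx a hay hax).2
      rcases NAtom.mem_syms.mp hax with h | h
      · refine ⟨k x, fun G hG y hy => ⟨fun hay => ?_, fun hay => ?_⟩, fun _ => ⟨F, hF, x, hx, hax⟩⟩
        · rw [huniq G hG y hy (NAtom.mem_syms.mpr (.inl hay))]
        · obtain rfl := huniq G hG y hy (NAtom.mem_syms.mpr (.inr hay))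
          exact absurd hay ((hE.atom G hG y hy).disj a h)
      · refine ⟨min (o a) (k x), fun G hG y hy => ⟨fun hay => ?_, fun hay => ?_⟩,
          fun _ => ⟨F, hF, x, hx, hax⟩⟩
        · obtain rfl := huniq G hG y hy (NAtom.mem_syms.mpr (.inl hay))
          exact absurd h ((hE.atom G hG y hy).disj a hay)
        · rw [huniq G hG y hy (NAtom.mem_syms.mpr (.inr hay))]
    · refine ⟨0, fun G hG y hy => ⟨fun hay => ?_, fun hay => ?_⟩, fun h => absurd rfl h⟩
      · exact absurd ⟨G, hG, y, hy, NAtom.mem_syms.mpr (.inl hay)⟩ ha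
      · exact absurd ⟨G, hG, y, hy, NAtom.mem_syms.mpr (.inr hay)⟩ ha
  choose c hc hsupp using hc
  refine ⟨c, ⟨hk, hsupp, fun F hF x hx => ⟨fun a => (hc a F hF x hx).1, fun a ha => ?_⟩⟩,
    fun F hF x hx a => (hc a F hF x hx).2⟩
  rw [(hc a F hF x hx).2 ha]
  exact min_le_right _ _

/-- If a set `X` of atoms with multiplicities `v` is prescribed, and every clause that has none of
them and does not admit the empty word has an atom in `C`, then `X` extends to an accepted choice
of atoms by atoms in `C`. -/
theorem exists_accepts {E : NExpr} (hE : WF E) (X C : NAtom → Prop) (v : NAtom → ℕ) (o : ℕ → ℕ)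
    (hX : ∀ F ∈ E, ∀ x ∈ F.atoms, X x → x.lo ≤ v x ∧ (v x : ℕ∞) ≤ x.hi)
    (hexcl : ∀ F ∈ E, F.excl = true → ∀ x ∈ F.atoms, ∀ y ∈ F.atoms, X x → X y → x = y)
    (hC : ∀ F ∈ E, F.zero = true ∨ (∃ x ∈ F.atoms, X x) ∨ ∃ x ∈ F.atoms, C x) :
    ∃ c k, Accepts E c k ∧ (∀ F ∈ E, ∀ x ∈ F.atoms, X x → k x = v x) ∧
      (∀ F ∈ E, ∀ x ∈ F.atoms, ¬X x → k x ≠ 0 → C x) ∧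
      ∀ F ∈ E, ∀ x ∈ F.atoms, ∀ a ∈ x.opt, c a = min (o a) (k x) := by
  classical
  -- A choice of an atom in `C` for each clause that has one; the other clauses get a dummy.
  have hz : ∀ F : NFactor, ∃ z, (∃ x ∈ F.atoms, C x) → z ∈ F.atoms ∧ C z := by
    intro F
    by_cases h : ∃ x ∈ F.atoms, C x
    · obtain ⟨x, hx⟩ := h
      exact ⟨x, fun _ => hx⟩
    · exact ⟨⟨[], [], 0, 0⟩, fun h' => absurd h' h⟩
  choose z hz using hz
  have hsame : ∀ F ∈ E, ∀ G ∈ E, ∀ x ∈ F.atoms, x ∈ G.atoms → F = G := by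
    intro F hF G hG x hx hx'
    obtain ⟨a, ha⟩ := List.exists_mem_of_ne_nil _ (hE.atom F hF x hx).ne
    exact (hE.disj F hF x hx G hG x hx' a ha ha).1
  have hpos : ∀ F ∈ E, ∀ x ∈ F.atoms, x.lo ≠ 0 := fun F hF x hx => by
    have := (hE.atom F hF x hx).one_le
    omega
  -- The chosen atom is switched on, with least multiplicity, exactly in the clauses that must not
  -- be empty and have no prescribed atom. So at most one atom is added to a clause, and none next
  -- to a prescribed one, which preserves exclusivity.
  let On (x : NAtom) : Prop := ∃ F ∈ E, F.zero = false ∧ (¬∃ y ∈ F.atoms, X y) ∧ x = z F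
  let k (x : NAtom) : ℕ := if X x then v x else if On x then x.lo else 0
  have hkX : ∀ x, X x → k x = v x := fun x hx => if_pos hx
  have hk : ∀ x, k x ≠ 0 → X x ∨ On x := by
    intro x hx
    by_contra h
    push Not at h
    exact hx (by simp only [k, if_neg h.1, if_neg h.2])
  have hOn : ∀ x, On x → ∃ F ∈ E, x ∈ F.atoms ∧ (¬∃ y ∈ F.atoms, X y) ∧ x = z F ∧ C x := by
    rintro x ⟨F, hF, h₀, hnX, rfl⟩
    have h := hz F (((hC F hF).resolve_left (by simp [h₀])).resolve_left hnX)
    exact ⟨F, hF, h.1, hnX, rfl, h.2⟩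
  have hadm : Admissible E k := by
    refine ⟨fun F hF x hx => ?_, fun F hF he x hx y hy hkx hky => ?_, fun F hF => ?_⟩
    · by_cases h₁ : X x
      · rw [hkX x h₁]
        exact .inr (hX F hF x hx h₁)
      · by_cases h₂ : On x
        · simp only [k, if_neg h₁, if_pos h₂]
          exact .inr ⟨le_rfl, (hE.atom F hF x hx).lo_le⟩
        · simp only [k, if_neg h₁, if_neg h₂]
          exact .inl rfl
    · rcases hk x hkx with h₁ | h₁ <;> rcases hk y hky with h₂ | h₂
      · exact hexcl F hF he x hx y hy h₁ h₂
      · obtain ⟨G, hG, hyG, hnX, -, -⟩ := hOn y h₂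
        obtain rfl := hsame F hF G hG y hy hyG
        exact absurd ⟨x, hx, h₁⟩ hnX
      · obtain ⟨G, hG, hxG, hnX, -, -⟩ := hOn x h₁
        obtain rfl := hsame F hF G hG x hx hxG
        exact absurd ⟨y, hy, h₂⟩ hnX
      · obtain ⟨G, hG, hxG, -, hxz, -⟩ := hOn x h₁
        obtain ⟨G', hG', hyG', -, hyz, -⟩ := hOn y h₂
        obtain rfl := hsame F hF G hG x hx hxG
        obtain rfl := hsame F hF G' hG' y hy hyG'
        rw [hxz, hyz]
    · by_cases h₀ : F.zero = true
      · exact .inl h₀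
      · right
        by_cases hx : ∃ x ∈ F.atoms, X x
        · obtain ⟨x, hx, hXx⟩ := hx
          refine ⟨x, hx, ?_⟩
          rw [hkX x hXx]
          have := (hX F hF x hx hXx).1
          have := hpos F hF x hx
          omega
        · have h := hz F (((hC F hF).resolve_left h₀).resolve_left hx)
          have hnX : ¬X (z F) := fun h' => hx ⟨_, h.1, h'⟩
          have hOnz : On (z F) := ⟨F, hF, by simpa using h₀, hx, rfl⟩
          refine ⟨z F, h.1, ?_⟩
          simp only [k, if_neg hnX, if_pos hOnz]
          exact hpos F hF _ h.1
  obtain ⟨c, hc, ho⟩ := hadm.exists_accepts hE o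
  refine ⟨c, k, hc, fun F hF x hx => hkX x, fun F hF x hx hnX hkx => ?_, ho⟩
  obtain ⟨-, -, -, -, -, hCx⟩ := hOn x ((hk x hkx).resolve_left hnX)
  exact hCx

end NormalForm

/-! ### The decision procedure for containment of normal forms -/

namespace NormalForm

/-- Membership in a list of symbols. -/
def mem (a : ℕ) (l : List ℕ) : Bool := l.any fun b => Nat.beq a b

/-- The symbol occurs in the clause. -/
def NFactor.has (F : NFactor) (a : ℕ) : Bool := F.atoms.any fun x => mem a x.syms

/-- The symbol occurs in the expression. -/
def has (E : NExpr) (a : ℕ) : Bool := E.any fun F => F.has a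

/-- All atoms have a property. -/
def allAtoms (E : NExpr) (p : NAtom → Bool) : Bool := E.all fun F => F.atoms.all fun x => p x

/-- Some word is accepted. -/
def inhabited (E : NExpr) : Bool := E.all fun F => F.zero || !F.atoms.isEmpty

/-- Some accepted word has no symbol of the clause `G`. -/
def avoids (E : NExpr) (G : NFactor) : Bool :=
  E.all fun F => F.zero || F.atoms.any fun x => x.mand.all fun a => !G.has a

/-- Some accepted word has the symbol `b`, but not the symbol `a`, where `a` is not mandatory in
the atom of `b`. -/
def avoidsWith (E : NExpr) (b a : ℕ) : Bool :=
  E.all fun F => F.zero || F.has b || F.atoms.any fun x => !mem a x.mand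

/-- The symbols are not excluded from occurring together. -/
def compatible (E : NExpr) (a b : ℕ) : Bool :=
  E.all fun F => !(F.excl && F.has a && F.has b) ||
    F.atoms.any fun x => mem a x.syms && mem b x.syms

/-- The symbol `a` occurs at most `h` times. -/
def boundedAbove (E : NExpr) (a : ℕ) (h : ℕ∞) : Bool :=
  allAtoms E fun x => !mem a x.syms || decide (x.hi ≤ h)

/-- The symbol `a` occurs at least `n` times, or not at all. -/
def boundedBelow (E : NExpr) (a n : ℕ) : Bool :=
  allAtoms E fun x => (!mem a x.mand || Nat.ble n x.lo) && (!mem a x.opt || Nat.ble n 1)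

/-- The symbol `b` does not occur more often than `a`. -/
def dominated (E : NExpr) (b a : ℕ) : Bool :=
  Nat.beq a b || allAtoms E fun x => !mem b x.syms || mem a x.mand ||
    (!avoidsWith E b a && allAtoms E fun y => !mem a y.mand || decide (x.hi ≤ (y.lo : ℕ∞)))

/-- The symbols never occur together. -/
def exclusive (E : NExpr) (a b : ℕ) : Bool := !(has E a && has E b && compatible E a b)

/-- All accepted words satisfy the constraints of an atom. -/
def satAtom (E : NExpr) (y : NAtom) : Bool :=
  (y.syms.all fun a => boundedAbove E a y.hi) &&
    y.mand.all fun a => boundedBelow E a y.lo && y.syms.all fun b => dominated E b a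

/-- All accepted words have symbols of at most one atom of the clause. -/
def satExcl (E : NExpr) (G : NFactor) : Bool :=
  G.atoms.all fun x => x.syms.all fun a => G.atoms.all fun y => y.syms.all fun b =>
    mem b x.syms || exclusive E a b

/-- All accepted words satisfy the constraints of a clause. -/
def satFactor (E : NExpr) (G : NFactor) : Bool :=
  (G.zero || !avoids E G) && (G.atoms.all fun y => satAtom E y) && (!G.excl || satExcl E G)

/-- All words accepted by `E` are accepted by `E'`. -/
def contained (E E' : NExpr) : Bool :=
  !inhabited E || ((allAtoms E fun x => x.syms.all fun a => has E' a) &&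
    E'.all fun G => satFactor E G)

@[simp] theorem mem_iff (a : ℕ) (l : List ℕ) : mem a l = true ↔ a ∈ l := by
  simp [mem]

@[simp] theorem has_factor_iff (F : NFactor) (a : ℕ) :
    F.has a = true ↔ ∃ x ∈ F.atoms, a ∈ x.syms := by
  simp [NFactor.has]

@[simp] theorem has_iff (E : NExpr) (a : ℕ) :
    has E a = true ↔ ∃ F ∈ E, ∃ x ∈ F.atoms, a ∈ x.syms := by
  simp [has]

@[simp] theorem allAtoms_iff (E : NExpr) (p : NAtom → Bool) :
    allAtoms E p = true ↔ ∀ F ∈ E, ∀ x ∈ F.atoms, p x = true := by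
  simp [allAtoms]

theorem inhabited_iff (E : NExpr) :
    inhabited E = true ↔ ∀ F ∈ E, F.zero = true ∨ ∃ x ∈ F.atoms, True := by
  have h (l : List NAtom) : l ≠ [] ↔ ∃ x ∈ l, True := by cases l <;> simp
  simp [inhabited, h]

theorem avoids_iff (E : NExpr) (G : NFactor) : avoids E G = true ↔
    ∀ F ∈ E, F.zero = true ∨ ∃ x ∈ F.atoms, ∀ a ∈ x.mand, ∀ y ∈ G.atoms, a ∉ y.syms := by
  simp [avoids, NFactor.has]

theorem avoidsWith_iff (E : NExpr) (b a : ℕ) : avoidsWith E b a = true ↔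
    ∀ F ∈ E, F.zero = true ∨ (∃ x ∈ F.atoms, b ∈ x.syms) ∨ ∃ x ∈ F.atoms, a ∉ x.mand := by
  simp [avoidsWith, or_assoc, ← Bool.not_eq_true]

theorem compatible_iff (E : NExpr) (a b : ℕ) : compatible E a b = true ↔
    ∀ F ∈ E, F.excl = true → (∃ x ∈ F.atoms, a ∈ x.syms) → (∃ x ∈ F.atoms, b ∈ x.syms) →
      ∃ x ∈ F.atoms, a ∈ x.syms ∧ b ∈ x.syms := by
  have h (p q : Bool) : (!p || q) = true ↔ (p = true → q = true) := by cases p <;> simp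
  simp only [compatible, List.all_eq_true, h, Bool.and_eq_true, has_factor_iff, List.any_eq_true,
    mem_iff, and_imp]

/-! ### Correctness of the tests. -/

section

variable {E : NExpr}

theorem not_bool_or (p q : Bool) : (!p || q) = true ↔ (p = true → q = true) := by
  cases p <;> simp

theorem mem_eq_false_or (a : ℕ) (l : List ℕ) (p : Prop) : (mem a l = false ∨ p) ↔ (a ∈ l → p) := by
  rw [← Bool.not_eq_true, mem_iff, imp_iff_not_or]

theorem inhabited_of_accepts {c : ℕ → ℕ} {k : NAtom → ℕ} (h : Accepts E c k) :
    inhabited E = true := by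
  rw [inhabited_iff]
  exact fun F hF => (h.zero F hF).imp_right fun ⟨x, hx, _⟩ => ⟨x, hx, trivial⟩

/-- A word with a prescribed multiplicity of one atom. -/
theorem exists_accepts_one (hE : WF E) {C : NAtom → Prop} {F : NFactor} {x : NAtom} (hF : F ∈ E)
    (hx : x ∈ F.atoms) {n : ℕ} (hlo : x.lo ≤ n) (hhi : (n : ℕ∞) ≤ x.hi) (o : ℕ → ℕ)
    (hC : ∀ F ∈ E, F.zero = true ∨ (x ∈ F.atoms) ∨ ∃ x ∈ F.atoms, C x) :
    ∃ c k, Accepts E c k ∧ (∀ a ∈ x.mand, c a = n) ∧ (∀ a ∈ x.opt, c a = min (o a) n) ∧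
      (∀ F ∈ E, ∀ y ∈ F.atoms, y ≠ x → k y ≠ 0 → C y) ∧
      ∀ F ∈ E, ∀ x ∈ F.atoms, ∀ a ∈ x.opt, c a = min (o a) (k x) := by
  obtain ⟨c, k, h, hk, hCk, ho⟩ := exists_accepts hE (fun y => y = x) C (fun _ => n) o
    (by rintro _ _ y _ rfl; exact ⟨hlo, hhi⟩) (by rintro _ _ _ _ _ _ _ rfl rfl; rfl)
    fun F hF => (hC F hF).imp_right fun h => h.imp_left fun hx => ⟨x, hx, rfl⟩
  have hkx := hk F hF x hx rfl
  refine ⟨c, k, h, fun a ha => ?_, fun a ha => ?_, hCk, ho⟩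
  · rw [(h.fits F hF x hx).mand a ha, hkx]
  · rw [ho F hF x hx a ha, hkx]

/-- If the atom of `a` has `hi > h`, then `h` is a finite number `m`, and a word with `max lo (m +
1)` copies of the atom, all optional symbols included, has too many `a`. -/
theorem boundedAbove_iff (hE : WF E) (hne : inhabited E = true) (a : ℕ) (h : ℕ∞) :
    boundedAbove E a h = true ↔ ∀ c k, Accepts E c k → (c a : ℕ∞) ≤ h := by
  simp only [boundedAbove, allAtoms_iff, not_bool_or, mem_iff, decide_eq_true_eq]
  constructor
  · intro hb c k hc
    by_cases ha : c a = 0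
    · simp [ha]
    · obtain ⟨F, hF, x, hx, hax, hk, -, hhi⟩ := hc.exists_atom ha
      exact (show (c a : ℕ∞) ≤ k x by exact_mod_cast hk).trans (hhi.trans (hb F hF x hx hax))
  · intro hc F hF x hx hax
    by_contra hlt
    push Not at hlt
    obtain ⟨m, rfl⟩ := ENat.ne_top_iff_exists.mp hlt.ne_top
    have hlo := (hE.atom F hF x hx).lo_le
    have hm : ((m + 1 : ℕ) : ℕ∞) ≤ x.hi := by
      push_cast
      exact Order.add_one_le_of_lt hlt
    have hhi : ((max x.lo (m + 1) : ℕ) : ℕ∞) ≤ x.hi := by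
      rcases max_choice x.lo (m + 1) with e | e <;> rw [e] <;> assumption
    obtain ⟨c, k, h, hmand, hopt, -⟩ := exists_accepts_one hE (C := fun _ => True) hF hx
      (le_max_left _ _) hhi (fun _ => max x.lo (m + 1)) fun F hF =>
        ((inhabited_iff E).mp hne F hF).imp_right .inr
    have hca : c a = max x.lo (m + 1) := by
      rcases NAtom.mem_syms.mp hax with ha | ha
      · exact hmand a ha
      · rw [hopt a ha, min_self]
    have := hc c k h
    rw [hca] at this
    have : max x.lo (m + 1) ≤ m := by exact_mod_cast this
    omega

/-- The extreme word has `lo` copies of the atom and each of its optional symbols just once: a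
mandatory symbol can be as rare as `lo`, an optional one as rare as 1. -/
theorem boundedBelow_iff (hE : WF E) (hne : inhabited E = true) (a n : ℕ) :
    boundedBelow E a n = true ↔ ∀ c k, Accepts E c k → c a = 0 ∨ n ≤ c a := by
  simp only [boundedBelow, allAtoms_iff, Bool.and_eq_true, not_bool_or, mem_iff, Nat.ble_eq]
  constructor
  · intro hb c k hc
    by_cases ha : c a = 0
    · exact .inl ha
    · right
      obtain ⟨F, hF, x, hx, hax, -, hlo, -⟩ := hc.exists_atom ha
      rcases NAtom.mem_syms.mp hax with h | h
      · rw [(hc.fits F hF x hx).mand a h]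
        exact ((hb F hF x hx).1 h).trans hlo
      · have := (hb F hF x hx).2 h
        omega
  · intro hc F hF x hx
    have hone := (hE.atom F hF x hx).one_le
    obtain ⟨c, k, h, hmand, hopt, -⟩ := exists_accepts_one hE (C := fun _ => True) hF hx
      le_rfl (hE.atom F hF x hx).lo_le (fun _ => 1) fun F hF =>
        ((inhabited_iff E).mp hne F hF).imp_right .inr
    constructor
    · intro ha
      have := hc c k h
      rw [hmand a ha] at this
      omega
    · intro ha
      have := hc c k h
      rw [hopt a ha] at this
      omega

/-- A symbol determines its clause and atom, so the only obstacle to a joint occurrence is that both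
atoms are distinct alternatives of the same exclusive clause. -/
theorem compatible_of_atoms (hE : WF E) {F G : NFactor} {x y : NAtom} (hF : F ∈ E)
    (hx : x ∈ F.atoms) (hG : G ∈ E) (hy : y ∈ G.atoms) {a b : ℕ} (ha : a ∈ x.syms)
    (hb : b ∈ y.syms) : compatible E a b = true ↔ (F.excl = true → F = G → x = y) := by
  rw [compatible_iff]
  constructor
  · rintro h he rfl
    obtain ⟨z, hz, haz, hbz⟩ := h F hF he ⟨x, hx, ha⟩ ⟨y, hy, hb⟩
    rw [(hE.disj F hF x hx F hF z hz a ha haz).2, (hE.disj F hF y hy F hF z hz b hb hbz).2]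
  · rintro h H hH he ⟨x', hx', ha'⟩ ⟨y', hy', hb'⟩
    obtain ⟨rfl, rfl⟩ := hE.disj F hF x hx H hH x' hx' a ha ha'
    obtain ⟨rfl, rfl⟩ := hE.disj G hG y hy F hH y' hy' b hb hb'
    exact ⟨x, hx, ha, h he rfl ▸ hb⟩

/-- A word with prescribed multiplicities of two atoms. -/
theorem exists_accepts_two (hE : WF E) (hne : inhabited E = true) {F G : NFactor} {x y : NAtom}
    (hF : F ∈ E) (hx : x ∈ F.atoms) (hG : G ∈ E) (hy : y ∈ G.atoms) {m n : ℕ} (hm : x.lo ≤ m)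
    (hm' : (m : ℕ∞) ≤ x.hi) (hn : y.lo ≤ n) (hn' : (n : ℕ∞) ≤ y.hi) (hmn : x = y → m = n)
    (hFG : F.excl = true → F = G → x = y) (o : ℕ → ℕ) :
    ∃ c k, Accepts E c k ∧ (∀ a ∈ x.mand, c a = m) ∧ (∀ a ∈ x.opt, c a = min (o a) m) ∧
      (∀ a ∈ y.mand, c a = n) ∧ (∀ a ∈ y.opt, c a = min (o a) n) := by
  classical
  have hsame : ∀ F ∈ E, ∀ G ∈ E, ∀ x ∈ F.atoms, x ∈ G.atoms → F = G := by
    intro F hF G hG x hx hx'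
    obtain ⟨a, ha⟩ := List.exists_mem_of_ne_nil _ (hE.atom F hF x hx).ne
    exact (hE.disj F hF x hx G hG x hx' a ha ha).1
  have hX : ∀ H ∈ E, ∀ z ∈ H.atoms, z = x ∨ z = y →
      z.lo ≤ (if z = x then m else n) ∧ ((if z = x then m else n : ℕ) : ℕ∞) ≤ z.hi := by
    rintro H hH z hz h
    by_cases hzx : z = x
    · subst hzx
      simpa using ⟨hm, hm'⟩
    · obtain rfl := h.resolve_left hzx
      simpa [hzx] using ⟨hn, hn'⟩
  have hexcl : ∀ H ∈ E, H.excl = true → ∀ z ∈ H.atoms, ∀ z' ∈ H.atoms, z = x ∨ z = y →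
      z' = x ∨ z' = y → z = z' := by
    rintro H hH he z hz z' hz' (rfl | rfl) (rfl | rfl)
    · rfl
    · obtain rfl := hsame F hF H hH z hx hz
      exact hFG he (hsame F hF G hG z' hz' hy)
    · obtain rfl := hsame F hF H hH z' hx hz'
      exact (hFG he (hsame F hF G hG z hz hy)).symm
    · rfl
  obtain ⟨c, k, h, hk, -, ho⟩ := exists_accepts hE (fun z => z = x ∨ z = y) (fun _ => True)
    (fun z => if z = x then m else n) o hX hexcl fun F hF =>
      ((inhabited_iff E).mp hne F hF).imp_right .inr
  have hkx : k x = m := by simpa using hk F hF x hx (.inl rfl)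
  have hky : k y = n := by
    have := hk G hG y hy (.inr rfl)
    split_ifs at this with e
    · rw [this, hmn e.symm]
    · exact this
  refine ⟨c, k, h, fun a ha => ?_, fun a ha => ?_, fun a ha => ?_, fun a ha => ?_⟩
  · rw [(h.fits F hF x hx).mand a ha, hkx]
  · rw [ho F hF x hx a ha, hkx]
  · rw [(h.fits G hG y hy).mand a ha, hky]
  · rw [ho G hG y hy a ha, hky]

/-- If the symbols are compatible, their atoms can be prescribed together with least multiplicities,
each optional symbol occurring once; both symbols then occur. -/
theorem exclusive_iff (hE : WF E) (hne : inhabited E = true) (a b : ℕ) :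
    exclusive E a b = true ↔ ∀ c k, Accepts E c k → c a ≠ 0 → c b = 0 := by
  rw [exclusive, Bool.not_eq_true', ← Bool.not_eq_true, Bool.and_eq_true, Bool.and_eq_true, has_iff,
    has_iff]
  constructor
  · intro h c k hc ha
    by_contra hb
    apply h
    obtain ⟨F, hF, x, hx, hax, hk, -⟩ := hc.exists_atom ha
    obtain ⟨G, hG, y, hy, hby, hk', -⟩ := hc.exists_atom hb
    refine ⟨⟨⟨F, hF, x, hx, hax⟩, ⟨G, hG, y, hy, hby⟩⟩,
      (compatible_of_atoms hE hF hx hG hy hax hby).mpr ?_⟩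
    rintro he rfl
    exact hc.excl F hF he x hx y hy (by omega) (by omega)
  · rintro h ⟨⟨⟨F, hF, x, hx, hax⟩, ⟨G, hG, y, hy, hby⟩⟩, hcomp⟩
    rw [compatible_of_atoms hE hF hx hG hy hax hby] at hcomp
    have hx₁ := hE.atom F hF x hx
    have hy₁ := hE.atom G hG y hy
    obtain ⟨c, k, hc, h₁, h₂, h₃, h₄⟩ := exists_accepts_two hE hne hF hx hG hy le_rfl hx₁.lo_le
      le_rfl hy₁.lo_le (fun e => by rw [e]) hcomp fun _ => 1
    have hone := hx₁.one_le
    have hone' := hy₁.one_le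
    have ha : c a ≠ 0 := by
      rcases NAtom.mem_syms.mp hax with ha | ha
      · rw [h₁ a ha]; omega
      · rw [h₂ a ha]; omega
    have hb : c b ≠ 0 := by
      rcases NAtom.mem_syms.mp hby with hb | hb
      · rw [h₃ b hb]; omega
      · rw [h₄ b hb]; omega
    exact hb (h c k hc ha)

/-- Optional symbols can be left out altogether, so only mandatory symbols matter, and each clause
that must not be empty can be treated separately. -/
theorem avoids_iff_exists (hE : WF E) (G : NFactor) : avoids E G = true ↔
    ∃ c k, Accepts E c k ∧ ∀ y ∈ G.atoms, ∀ a ∈ y.syms, c a = 0 := by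
  rw [avoids_iff]
  constructor
  · intro h
    obtain ⟨c, k, hc, -, hC, ho⟩ := exists_accepts hE (fun _ => False)
      (fun x => ∀ a ∈ x.mand, ∀ y ∈ G.atoms, a ∉ y.syms) (fun _ => 0) (fun _ => 0)
      (fun _ _ _ _ h => h.elim) (fun _ _ _ _ _ _ _ h => h.elim)
      (fun F hF => (h F hF).imp_right .inr)
    refine ⟨c, k, hc, fun y hy a ha => ?_⟩
    by_contra hca
    obtain ⟨F, hF, x, hx, hax, hk, -⟩ := hc.exists_atom hca
    rcases NAtom.mem_syms.mp hax with h' | h'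
    · exact hC F hF x hx not_false (by omega) a h' y hy ha
    · rw [ho F hF x hx a h'] at hca
      simp at hca
  · rintro ⟨c, k, hc, h⟩ F hF
    refine (hc.zero F hF).imp_right ?_
    rintro ⟨x, hx, hk⟩
    refine ⟨x, hx, fun a ha y hy hay => hk ?_⟩
    rw [← (hc.fits F hF x hx).mand a ha]
    exact h y hy a hay

/-- Let `b` differ from `a` and occur in the atom `x`. If `a` is mandatory in `x`, domination is
clear. Otherwise `a` has to be forced by another clause: one that is never empty and has `a`
mandatory in each of its atoms. The two multiplicities are then independent, so the largest one of
`x` must not exceed the least one of the atom `y` of `a`. -/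
theorem dominated_iff (hE : WF E) (hne : inhabited E = true) (b a : ℕ) :
    dominated E b a = true ↔ ∀ c k, Accepts E c k → c b ≤ c a := by
  simp only [dominated, Bool.or_eq_true, Nat.beq_eq, allAtoms_iff, Bool.or_assoc,
    mem_eq_false_or, mem_iff, Bool.and_eq_true, Bool.not_eq_true', decide_eq_true_eq]
  constructor
  · rintro (rfl | hd) c k hc
    · rfl
    · by_contra hlt
      push Not at hlt
      obtain ⟨F, hF, x, hx, hbx, hk, -, hhi⟩ := hc.exists_atom (a := b) (by omega)
      rcases hd F hF x hx hbx with ha | ⟨h₁, h₂⟩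
      · rw [(hc.fits F hF x hx).mand a ha] at hlt
        omega
      · rw [← Bool.not_eq_true, avoidsWith_iff] at h₁
        push Not at h₁
        -- This clause cannot be empty, and whichever of its atoms is present brings at least `lo`
        -- occurrences of `a`.
        obtain ⟨G, hG, h₀, -, hG'⟩ := h₁
        obtain ⟨y, hy, hky⟩ := (hc.zero G hG).resolve_left h₀
        have hay := hG' y hy
        have hlo := ((hc.range G hG y hy).resolve_left hky).1
        rw [(hc.fits G hG y hy).mand a hay] at hlt
        have h₃ : (k x : ℕ∞) ≤ y.lo := hhi.trans (h₂ G hG y hy hay)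
        have h₄ : k x ≤ y.lo := by exact_mod_cast h₃
        omega
  · intro h
    by_cases hab : a = b
    · exact .inl hab
    right
    intro F hF x hx hbx
    by_cases ha : a ∈ x.mand
    · exact .inl ha
    right
    have hx₁ := hE.atom F hF x hx
    -- Otherwise there is a word that contains `x`, leaves out `a` where it is optional, and fills
    -- the other clauses with atoms where `a` is not mandatory. It has `b` but not `a`.
    have hoff : avoidsWith E b a = false := by
      rw [← Bool.not_eq_true, avoidsWith_iff]
      intro hoff
      have hcond : ∀ G ∈ E, G.zero = true ∨ x ∈ G.atoms ∨ ∃ z ∈ G.atoms, a ∉ z.mand := by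
        intro G hG
        rcases hoff G hG with h₀ | ⟨z, hz, hbz⟩ | hz
        · exact .inl h₀
        · obtain ⟨rfl, rfl⟩ := hE.disj F hF x hx G hG z hz b hbx hbz
          exact .inr (.inl hx)
        · exact .inr (.inr hz)
      obtain ⟨c, k, hc, h₁, h₂, hC, ho⟩ := exists_accepts_one hE hF hx le_rfl hx₁.lo_le
        (fun i => if i = a then 0 else 1) hcond
      have hone := hx₁.one_le
      have hb : c b ≠ 0 := by
        rcases NAtom.mem_syms.mp hbx with hb | hb
        · rw [h₁ b hb]; omega
        · rw [h₂ b hb, if_neg (Ne.symm hab)]; omega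
      have hca : c a ≠ 0 := by
        have := h c k hc
        omega
      obtain ⟨G, hG, y, hy, hay, hk, -⟩ := hc.exists_atom hca
      rcases NAtom.mem_syms.mp hay with h' | h'
      · exact hC G hG y hy (fun e => ha (e ▸ h')) (by omega) h'
      · have := ho G hG y hy a h'
        rw [if_pos rfl] at this
        omega
    refine ⟨hoff, fun G hG y hy hay => ?_⟩
    by_contra hlt
    push Not at hlt
    -- If `x` and `y` were in the same clause, no other clause could force `a`, and `avoidsWith`
    -- would hold.
    have hFG : F ≠ G := by
      rintro rfl
      rw [← Bool.not_eq_true, avoidsWith_iff] at hoff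
      apply hoff
      intro H hH
      refine ((inhabited_iff E).mp hne H hH).imp_right ?_
      rintro ⟨z, hz, -⟩
      by_cases haz : a ∈ z.mand
      · obtain ⟨rfl, -⟩ := hE.disj F hF y hy H hH z hz a (NAtom.mem_syms.mpr (.inl hay))
          (NAtom.mem_syms.mpr (.inl haz))
        exact .inl ⟨x, hx, hbx⟩
      · exact .inr ⟨z, hz, haz⟩
    have hy₁ := hE.atom G hG y hy
    have hm : ((y.lo + 1 : ℕ) : ℕ∞) ≤ x.hi := by
      push_cast
      exact Order.add_one_le_of_lt hlt
    have hhi : ((max x.lo (y.lo + 1) : ℕ) : ℕ∞) ≤ x.hi := by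
      have := hx₁.lo_le
      rcases max_choice x.lo (y.lo + 1) with e | e <;> rw [e] <;> assumption
    -- With `y` at its minimum and `x` at least one higher, `b` occurs more often than `a`.
    obtain ⟨c, k, hc, h₁, h₂, h₃, -⟩ := exists_accepts_two hE hne hF hx hG hy (le_max_left _ _) hhi
      le_rfl hy₁.lo_le (fun e => absurd (e ▸ hay) ha) (fun _ e => absurd e hFG)
      fun _ => max x.lo (y.lo + 1)
    have hb : c b = max x.lo (y.lo + 1) := by
      rcases NAtom.mem_syms.mp hbx with hb | hb
      · exact h₁ b hb
      · rw [h₂ b hb, min_self]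
    have := h c k hc
    rw [hb, h₃ a hay] at this
    omega

/-- A conjunction of constraints holds in all words iff each conjunct does, and every conjunct has
an exact test. These tests presuppose that some word is accepted; otherwise both sides are trivially
true. -/
theorem contained_iff (hE : WF E) (E' : NExpr) :
    contained E E' = true ↔ ∀ c k, Accepts E c k → Sat E' c := by
  by_cases hne : inhabited E = true
  · have hsat (y : NAtom) : satAtom E y = true ↔ ∀ c k, Accepts E c k → y.Sat c := by
      simp only [satAtom, Bool.and_eq_true, List.all_eq_true, boundedAbove_iff hE hne,
        boundedBelow_iff hE hne, dominated_iff hE hne]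
      constructor
      · rintro ⟨h₁, h₂⟩ c k hc
        exact ⟨fun a ha b hb => (h₂ a ha).2 b hb c k hc, fun a ha => h₁ a ha c k hc,
          fun a ha => (h₂ a ha).1 c k hc⟩
      · intro h
        exact ⟨fun a ha c k hc => (h c k hc).hi a ha, fun a ha =>
          ⟨fun c k hc => (h c k hc).lo a ha, fun b hb c k hc => (h c k hc).le a ha b hb⟩⟩
    simp only [contained, hne, Bool.not_true, Bool.false_or, Bool.and_eq_true, allAtoms_iff,
      List.all_eq_true, has_iff, satFactor, hsat, not_bool_or, satExcl]
    constructor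
    · rintro ⟨h₁, h₂⟩ c k hc
      refine ⟨fun a ha => ?_, fun G hG y hy => (h₂ G hG).1.2 y hy c k hc,
        fun G hG he x hx a ha y hy b hb hca hcb => ?_, fun G hG => ?_⟩
      · obtain ⟨F, hF, x, hx, hax⟩ := hc.supp a ha
        exact h₁ F hF x hx a hax
      · have h₃ := (h₂ G hG).2 he x hx a ha y hy b hb
        rw [Bool.or_eq_true, mem_iff, exclusive_iff hE hne] at h₃
        exact h₃.resolve_right fun h => hcb (h c k hc hca)
      · have h₃ := (h₂ G hG).1.1
        rw [Bool.or_eq_true, Bool.not_eq_true', ← Bool.not_eq_true, avoids_iff_exists hE] at h₃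
        refine h₃.imp_right fun h => ?_
        by_contra h'
        push Not at h'
        exact h ⟨c, k, hc, h'⟩
    · intro h
      refine ⟨fun F hF x hx a hax => ?_, fun G hG => ⟨⟨?_, fun y hy c k hc =>
        (h c k hc).atom G hG y hy⟩, fun he x hx a ha y hy b hb => ?_⟩⟩
      · have hx₁ := hE.atom F hF x hx
        obtain ⟨c, k, hc, h₁, h₂, -⟩ := exists_accepts_one hE (C := fun _ => True) hF hx le_rfl
          hx₁.lo_le (fun _ => 1) fun F hF => ((inhabited_iff E).mp hne F hF).imp_right .inr
        have hone := hx₁.one_le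
        refine (h c k hc).supp a ?_
        rcases NAtom.mem_syms.mp hax with ha | ha
        · rw [h₁ a ha]; omega
        · rw [h₂ a ha]; omega
      · rw [Bool.or_eq_true, Bool.not_eq_true', ← Bool.not_eq_true, avoids_iff_exists hE]
        by_cases h₀ : G.zero = true
        · exact .inl h₀
        · right
          rintro ⟨c, k, hc, h'⟩
          obtain ⟨y, hy, a, ha, hca⟩ := ((h c k hc).zero G hG).resolve_left h₀
          exact hca (h' y hy a ha)
      · rw [Bool.or_eq_true, mem_iff, exclusive_iff hE hne]
        by_cases hbx : b ∈ x.syms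
        · exact .inl hbx
        · refine .inr fun c k hc hca => ?_
          by_contra hcb
          exact hbx ((h c k hc).excl G hG he x hx a ha y hy b hb hca hcb)
  · refine iff_of_true ?_ fun c k hc => absurd (inhabited_of_accepts hc) hne
    rw [Bool.not_eq_true] at hne
    simp [contained, hne]

end

end NormalForm

/-! ### The languages of expressions -/

namespace URE

variable {α : Type}

/-- The word is a union of `k` words of the language. -/
def IsSum (L : Set (Multiset α)) (k : ℕ) (w : Multiset α) : Prop :=
  ∃ us : List (Multiset α), (∀ u ∈ us, u ∈ L) ∧ us.length = k ∧ w = us.sum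

theorem isSum_zero {L : Set (Multiset α)} {w : Multiset α} : IsSum L 0 w ↔ w = 0 := by
  constructor
  · rintro ⟨us, -, h, rfl⟩
    rw [List.length_eq_zero_iff.mp h, List.sum_nil]
  · rintro rfl
    exact ⟨[], by simp, rfl, rfl⟩

theorem isSum_succ {L : Set (Multiset α)} {k : ℕ} {w : Multiset α} :
    IsSum L (k + 1) w ↔ ∃ u ∈ L, ∃ v, IsSum L k v ∧ w = u + v := by
  constructor
  · rintro ⟨us, h, hk, rfl⟩
    obtain ⟨u, us, rfl⟩ := List.exists_cons_of_length_eq_add_one hk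
    rw [List.forall_mem_cons] at h
    exact ⟨u, h.1, us.sum, ⟨us, h.2, by simpa using hk, rfl⟩, List.sum_cons⟩
  · rintro ⟨u, hu, v, ⟨us, h, rfl, rfl⟩, rfl⟩
    exact ⟨u :: us, List.forall_mem_cons.mpr ⟨hu, h⟩, rfl, List.sum_cons.symm⟩

theorem isSum_one {L : Set (Multiset α)} {w : Multiset α} : IsSum L 1 w ↔ w ∈ L := by
  rw [← Nat.zero_add 1, isSum_succ]
  simp [isSum_zero]

theorem mem_lang_rep {E : URE α} {I : IntMult} {w : Multiset α} : w ∈ (rep E I).lang ↔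
    (∃ k, I.lo ≤ k ∧ (k : ℕ∞) ≤ I.hi ∧ IsSum E.lang k w) ∨ (I.opt = true ∧ w = 0) := by
  refine or_congr_left ⟨?_, ?_⟩
  · rintro ⟨us, h, hlo, hhi, rfl⟩
    exact ⟨us.length, hlo, hhi, us, h, rfl, rfl⟩
  · rintro ⟨_, hlo, hhi, us, h, rfl, rfl⟩
    exact ⟨us, h, hlo, hhi, rfl⟩

theorem mem_lang_concAll_cons {E : URE α} {l : List (URE α)} {w : Multiset α} :
    w ∈ (concAll (E :: l)).lang ↔ ∃ u ∈ E.lang, ∃ v ∈ (concAll l).lang, w = u + v := by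
  cases l with
  | nil => simp [concAll, lang]
  | cons F l => rfl

theorem mem_lang_altAll {l : List (URE α)} (hl : l ≠ []) {w : Multiset α} :
    w ∈ (altAll l).lang ↔ ∃ E ∈ l, w ∈ E.lang := by
  induction l with
  | nil => exact absurd rfl hl
  | cons E l ih =>
    cases l with
    | nil => simp [altAll]
    | cons F l =>
      rw [List.exists_mem_cons_iff, ← ih (List.cons_ne_nil _ _)]
      rfl

/-- With disjoint sets of symbols the only possible decomposition of `w` is given by its
restrictions to these sets, so membership can be checked factor by factor. -/
theorem mem_lang_concAll_map [DecidableEq α] {β : Type} (F : β → URE α) (S : β → List α)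
    {l : List β} (hS : ∀ x ∈ l, ∀ u ∈ (F x).lang, ∀ a ∈ u, a ∈ S x)
    (hd : l.Pairwise fun x y => List.Disjoint (S x) (S y)) {w : Multiset α} :
    w ∈ (concAll (l.map F)).lang ↔
      (∀ a ∈ w, ∃ x ∈ l, a ∈ S x) ∧ ∀ x ∈ l, w.filter (· ∈ S x) ∈ (F x).lang := by
  induction l generalizing w with
  | nil => simp [concAll, lang, Multiset.eq_zero_iff_forall_notMem]
  | cons x l ih =>
    rw [List.forall_mem_cons] at hS
    rw [List.pairwise_cons] at hd
    rw [List.map_cons, mem_lang_concAll_cons]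
    constructor
    · rintro ⟨u, hu, v, hv, rfl⟩
      rw [ih hS.2 hd.2] at hv
      refine ⟨fun a ha => ?_, List.forall_mem_cons.mpr ⟨?_, fun y hy => ?_⟩⟩
      · rcases Multiset.mem_add.mp ha with h | h
        · exact ⟨x, List.mem_cons_self, hS.1 u hu a h⟩
        · obtain ⟨y, hy, hay⟩ := hv.1 a h
          exact ⟨y, List.mem_cons_of_mem _ hy, hay⟩
      · rw [Multiset.filter_add, Multiset.filter_eq_self.mpr (hS.1 u hu),
          Multiset.filter_eq_nil.mpr, add_zero]
        · exact hu
        · intro a ha hax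
          obtain ⟨y, hy, hay⟩ := hv.1 a ha
          exact hd.1 y hy hax hay
      · rw [Multiset.filter_add, Multiset.filter_eq_nil.mpr, zero_add]
        · exact hv.2 y hy
        · exact fun a ha hay => hd.1 y hy (hS.1 u hu a ha) hay
    · rintro ⟨h₁, h₂⟩
      rw [List.forall_mem_cons] at h₂
      refine ⟨_, h₂.1, w.filter (· ∉ S x), ?_, (Multiset.filter_add_not _ _).symm⟩
      rw [ih hS.2 hd.2]
      refine ⟨fun a ha => ?_, fun y hy => ?_⟩
      · obtain ⟨ha, hax⟩ := Multiset.mem_filter.mp ha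
        exact (List.exists_mem_cons_iff _ _ _ |>.mp (h₁ a ha)).resolve_left hax
      · rw [Multiset.filter_filter, Multiset.filter_congr (q := (· ∈ S y))]
        · exact h₂.2 y hy
        · exact fun a _ => and_iff_left_of_imp fun hay hax => hd.1 y hy hax hay

/-- Used with the submonoid generated by a clause, to show that the concatenation of its iterated
atoms is contained in the iterated clause. -/
theorem lang_concAll_subset {M : AddSubmonoid (Multiset α)} {l : List (URE α)}
    (h : ∀ E ∈ l, E.lang ⊆ M) : (concAll l).lang ⊆ M := by
  induction l with
  | nil =>
    rintro _ rfl
    exact M.zero_mem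
  | cons E l ih =>
    rw [List.forall_mem_cons] at h
    intro w hw
    obtain ⟨u, hu, v, hv, rfl⟩ := mem_lang_concAll_cons.mp hw
    exact M.add_mem (h.1 hu) (ih h.2 hv)

theorem IsSum.mem_closure {L : Set (Multiset α)} {k : ℕ} {w : Multiset α} (h : IsSum L k w) :
    w ∈ AddSubmonoid.closure L := by
  obtain ⟨us, h, -, rfl⟩ := h
  exact AddSubmonoid.list_sum_mem _ fun u hu => AddSubmonoid.subset_closure (h u hu)

theorem IsSum.forall_mem {L : Set (Multiset α)} {k : ℕ} {w : Multiset α} (h : IsSum L k w)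
    {p : α → Prop} (hp : ∀ u ∈ L, ∀ a ∈ u, p a) : ∀ a ∈ w, p a := by
  induction k generalizing w with
  | zero => simp [isSum_zero.mp h]
  | succ k ih =>
    obtain ⟨u, hu, v, hv, rfl⟩ := isSum_succ.mp h
    intro a ha
    exact (Multiset.mem_add.mp ha).elim (hp u hu a) (ih hv a)

theorem isSum_sym {a : α} {k n : ℕ} :
    IsSum (sym a).lang k (Multiset.replicate n a) ↔ n = k := by
  constructor
  · rintro ⟨us, h, rfl, hw⟩
    have hus : us = List.replicate us.length {a} := List.eq_replicate_of_mem h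
    rw [hus, List.sum_replicate] at hw
    simpa using congrArg Multiset.card hw
  · rintro rfl
    exact ⟨List.replicate n {a}, fun u hu => (List.mem_replicate.mp hu).2, by simp,
      by simp [Multiset.nsmul_singleton]⟩

theorem replicate_mem_lang_rep {a : α} {I : IntMult} {n : ℕ} :
    Multiset.replicate n a ∈ (rep (sym a) I).lang ↔
      (I.lo ≤ n ∧ (n : ℕ∞) ≤ I.hi) ∨ (I.opt = true ∧ n = 0) := by
  rw [mem_lang_rep]
  simp only [isSum_sym]
  refine or_congr ⟨?_, fun h => ⟨n, h.1, h.2, rfl⟩⟩ (and_congr_right fun _ => ?_)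
  · rintro ⟨k, h₁, h₂, rfl⟩
    exact ⟨h₁, h₂⟩
  · rw [← Multiset.card_eq_zero, Multiset.card_replicate]

theorem eq_of_mem_lang_rep_sym {a b : α} {I : IntMult} {w : Multiset α}
    (h : w ∈ (rep (sym a) I).lang) (hb : b ∈ w) : b = a := by
  rcases mem_lang_rep.mp h with ⟨k, -, -, h⟩ | ⟨-, rfl⟩
  · refine h.forall_mem (p := (· = a)) ?_ b hb
    rintro _ rfl c hc
    exact Multiset.mem_singleton.mp hc
  · simp at hb

end URE

/-! ### The normal form of an expression -/

namespace NormalForm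

open URE

/-- The normal form of an atom with an interval. -/
def atomNorm (A : RawAtom ℕ) (lo : ℕ) (hi : ℕ∞) : NAtom :=
  ⟨(A.filter fun x => !Nat.beq x.2.lo 0).map Prod.fst,
    (A.filter fun x => Nat.beq x.2.lo 0).map Prod.fst, lo, hi⟩

/-- The least positive number in an interval. -/
def posLo (I : IntMult) : ℕ := bif Nat.beq I.lo 0 then 1 else I.lo

/-- The atom with an interval contains the empty word. -/
def atomZero (x : RawAtom ℕ × IntMult) : Bool :=
  x.2.opt || Nat.beq x.2.lo 0 ||
    ((atomNorm x.1 1 ⊤).mand.isEmpty && decide ((x.2.lo : ℕ∞) ≤ x.2.hi))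

/-- The interval contains infinity. -/
def unbounded (I : IntMult) : Bool := decide ((⊤ : ℕ∞) ≤ I.hi)

/-- The normal form of a clause with an interval. -/
def clauseNorm (D : RawClause ℕ × IntMult) : NFactor :=
  ⟨!unbounded D.2, Nat.beq D.2.lo 0 || D.1.any fun x => atomZero x,
    (D.1.filter fun x => decide ((posLo x.2 : ℕ∞) ≤ x.2.hi)).map fun x =>
      bif unbounded D.2 then atomNorm x.1 1 ⊤ else atomNorm x.1 (posLo x.2) x.2.hi⟩

/-- The normal form of an expression. -/
def norm (E : RawDIME ℕ) : NExpr := E.map fun D => clauseNorm D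

/-- The normal form of an expression for a single word. -/
def wordNorm (w : List ℕ) : NExpr := w.map fun a =>
  ⟨true, false, [⟨[a], [], (w.filter fun b => Nat.beq a b).length,
    ((w.filter fun b => Nat.beq a b).length : ℕ∞)⟩]⟩

/-! #### Atoms -/

theorem mem_mand_atomNorm {A : RawAtom ℕ} {lo : ℕ} {hi : ℕ∞} {a : ℕ} :
    a ∈ (atomNorm A lo hi).mand ↔ ∃ x ∈ A, x.2.lo ≠ 0 ∧ x.1 = a := by
  simp [atomNorm, ← Bool.not_eq_true]

theorem mem_opt_atomNorm {A : RawAtom ℕ} {lo : ℕ} {hi : ℕ∞} {a : ℕ} :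
    a ∈ (atomNorm A lo hi).opt ↔ ∃ x ∈ A, x.2.lo = 0 ∧ x.1 = a := by
  simp [atomNorm]

theorem mem_syms_atomNorm {A : RawAtom ℕ} {lo : ℕ} {hi : ℕ∞} {a : ℕ} :
    a ∈ (atomNorm A lo hi).syms ↔ a ∈ A.map Prod.fst := by
  rw [NAtom.mem_syms, mem_mand_atomNorm, mem_opt_atomNorm, List.mem_map]
  constructor
  · rintro (⟨x, hx, -, rfl⟩ | ⟨x, hx, -, rfl⟩) <;> exact ⟨x, hx, rfl⟩
  · rintro ⟨x, hx, rfl⟩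
    by_cases h : x.2.lo = 0
    · exact .inr ⟨x, hx, h, rfl⟩
    · exact .inl ⟨x, hx, h, rfl⟩

/-- The word consists of `k` words of the atom. -/
def AtomPow (A : RawAtom ℕ) (k : ℕ) (w : Multiset ℕ) : Prop :=
  (∀ a ∈ w, a ∈ A.map Prod.fst) ∧ ∀ x ∈ A, (x.2.lo = 0 → w.count x.1 ≤ k) ∧
    (x.2.lo ≠ 0 → w.count x.1 = k)

theorem atomPow_iff {A : RawAtom ℕ} {lo : ℕ} {hi : ℕ∞} {k : ℕ} {w : Multiset ℕ} :
    AtomPow A k w ↔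
      (∀ a ∈ w, a ∈ A.map Prod.fst) ∧ (atomNorm A lo hi).Fits (fun a => w.count a) k := by
  refine and_congr_right fun _ => ⟨fun h => ⟨?_, ?_⟩, fun h x hx => ⟨fun h₀ => ?_, fun h₀ => ?_⟩⟩
  · intro a ha
    obtain ⟨x, hx, h₀, rfl⟩ := mem_mand_atomNorm.mp ha
    exact (h x hx).2 h₀
  · intro a ha
    obtain ⟨x, hx, h₀, rfl⟩ := mem_opt_atomNorm.mp ha
    exact (h x hx).1 h₀
  · exact h.opt _ (mem_opt_atomNorm.mpr ⟨x, hx, h₀, rfl⟩)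
  · exact h.mand _ (mem_mand_atomNorm.mpr ⟨x, hx, h₀, rfl⟩)

theorem atomPow_zero {A : RawAtom ℕ} {w : Multiset ℕ} : AtomPow A 0 w ↔ w = 0 := by
  constructor
  · rintro ⟨h₁, h₂⟩
    refine Multiset.eq_zero_of_forall_notMem fun a ha => ?_
    obtain ⟨x, hx, rfl⟩ := List.mem_map.mp (h₁ a ha)
    have := Multiset.count_pos.mpr ha
    have := h₂ x hx
    omega
  · rintro rfl
    simp [AtomPow]

theorem atomPow_zero_word {A : RawAtom ℕ} {k : ℕ} :
    AtomPow A k 0 ↔ k = 0 ∨ (atomNorm A 1 ⊤).mand = [] := by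
  simp only [AtomPow, Multiset.notMem_zero, Multiset.count_zero, List.eq_nil_iff_forall_not_mem,
    mem_mand_atomNorm]
  constructor
  · rintro ⟨-, h⟩
    by_cases hk : k = 0
    · exact .inl hk
    · right
      rintro a ⟨x, hx, h₀, rfl⟩
      exact hk ((h x hx).2 h₀).symm
  · rintro (rfl | h)
    · simp
    · exact ⟨by simp, fun x hx => ⟨by simp, fun h₀ => absurd ⟨x, hx, h₀, rfl⟩ (h x.1)⟩⟩

theorem mem_lang_atom {A : RawAtom ℕ} (hA : IsAtomExpr A) (hnd : (A.map Prod.fst).Nodup)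
    {w : Multiset ℕ} : w ∈ (RawAtom.toURE A).lang ↔ AtomPow A 1 w := by
  rw [RawAtom.toURE, mem_lang_concAll_map _ (fun x => [x.1])]
  · simp only [List.mem_singleton, Multiset.filter_eq', replicate_mem_lang_rep, AtomPow,
      List.mem_map]
    refine and_congr ?_ (forall₂_congr fun x hx => ?_)
    · simp only [eq_comm]
    · rcases hA.2 x hx with e | e
      · simp [e, IntMult.maybe]
      · simp only [e, IntMult.one]
        norm_num
        exact ⟨fun h => le_antisymm h.2 h.1, fun h => by simp [h]⟩
  · intro x _ u hu a ha
    exact List.mem_singleton.mpr (eq_of_mem_lang_rep_sym hu ha)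
  · rw [List.Nodup, List.pairwise_map] at hnd
    exact hnd.imp fun h => by simpa [eq_comm] using h

theorem atomPow_add {A : RawAtom ℕ} {k l : ℕ} {u v : Multiset ℕ} (hu : AtomPow A k u)
    (hv : AtomPow A l v) : AtomPow A (k + l) (u + v) := by
  refine ⟨fun a ha => (Multiset.mem_add.mp ha).elim (hu.1 a) (hv.1 a), fun x hx => ?_⟩
  rw [Multiset.count_add]
  have := hu.2 x hx
  have := hv.2 x hx
  constructor <;> intro h <;> grind

/-- From a word that fits `k + 1` copies, `w.dedup` can be split off as one copy: every mandatory
symbol is present in it, and every optional symbol that occurs loses one occurrence, so that the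
rest fits `k` copies. -/
theorem isSum_atom {A : RawAtom ℕ} (hA : IsAtomExpr A) (hnd : (A.map Prod.fst).Nodup) {k : ℕ}
    {w : Multiset ℕ} : IsSum (RawAtom.toURE A).lang k w ↔ AtomPow A k w := by
  induction k generalizing w with
  | zero => rw [isSum_zero, atomPow_zero]
  | succ k ih =>
    simp only [isSum_succ, ih, mem_lang_atom hA hnd]
    constructor
    · rintro ⟨u, hu, v, hv, rfl⟩
      rw [Nat.add_comm]
      exact atomPow_add hu hv
    · rintro ⟨h₁, h₂⟩
      refine ⟨w.dedup, ⟨fun a ha => h₁ a (Multiset.mem_dedup.mp ha), fun x hx => ?_⟩,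
        w - w.dedup, ⟨fun a ha => h₁ a (Multiset.mem_of_le (Multiset.sub_le_self _ _) ha),
        fun x hx => ?_⟩, (add_tsub_cancel_of_le (Multiset.dedup_le w)).symm⟩
      · have := h₂ x hx
        rw [Multiset.count_dedup]
        split_ifs with h
        · simp
        · rw [Multiset.count_eq_zero_of_notMem h] at this
          omega
      · have := h₂ x hx
        rw [Multiset.count_sub, Multiset.count_dedup]
        split_ifs with h
        · omega
        · rw [Multiset.count_eq_zero_of_notMem h] at this ⊢
          omega

theorem mem_lang_rep_atom {x : RawAtom ℕ × IntMult} (hA : IsAtomExpr x.1)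
    (hnd : (x.1.map Prod.fst).Nodup) {w : Multiset ℕ} :
    w ∈ (rep (RawAtom.toURE x.1) x.2).lang ↔
      (∃ k, x.2.lo ≤ k ∧ (k : ℕ∞) ≤ x.2.hi ∧ AtomPow x.1 k w) ∨ (x.2.opt = true ∧ w = 0) := by
  simp only [mem_lang_rep, isSum_atom hA hnd]

theorem atomZero_iff {x : RawAtom ℕ × IntMult} (hA : IsAtomExpr x.1)
    (hnd : (x.1.map Prod.fst).Nodup) :
    atomZero x = true ↔ 0 ∈ (rep (RawAtom.toURE x.1) x.2).lang := by
  simp only [mem_lang_rep_atom hA hnd, atomPow_zero_word, atomZero, Bool.or_eq_true, Nat.beq_eq,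
    Bool.and_eq_true, List.isEmpty_iff, decide_eq_true_eq]
  constructor
  · rintro ((h | h) | ⟨h₁, h₂⟩)
    · exact .inr ⟨h, trivial⟩
    · exact .inl ⟨0, by omega, by simp, .inl rfl⟩
    · exact .inl ⟨x.2.lo, le_rfl, h₂, .inr h₁⟩
  · rintro (⟨k, h₁, h₂, rfl | h⟩ | h)
    · exact .inl (.inr (by omega))
    · exact .inr ⟨h, le_trans (by exact_mod_cast h₁) h₂⟩
    · exact .inl (.inl h.1)

/-! #### Clauses -/

/-- The symbols of a clause. -/
def clauseSyms (D : RawClause ℕ) : List ℕ := D.flatMap fun A => A.1.map Prod.fst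

theorem eq_of_mem_flatMap {β : Type} {f : β → List ℕ} {l : List β} (h : (l.flatMap f).Nodup)
    {x y : β} (hx : x ∈ l) (hy : y ∈ l) {a : ℕ} (hax : a ∈ f x) (hay : a ∈ f y) : x = y := by
  by_contra hxy
  have : Std.Symm (Function.onFun List.Disjoint f) := ⟨fun _ _ h => List.Disjoint.symm h⟩
  exact (List.nodup_flatMap.mp h).2.forall hx hy hxy hax hay

theorem posLo_eq (I : IntMult) : posLo I = max 1 I.lo := by
  cases h : Nat.beq I.lo 0
  · have := Nat.ne_of_beq_eq_false h
    simp only [posLo, h, cond_false]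
    omega
  · have := Nat.eq_of_beq_eq_true h
    simp only [posLo, h, cond_true]
    omega

theorem unbounded_iff {I : IntMult} : unbounded I = true ↔ I.hi = ⊤ := by
  simp [unbounded]

/-- The normal form of an atom of a clause. -/
def atomIn (D : RawClause ℕ × IntMult) (x : RawAtom ℕ × IntMult) : NAtom :=
  bif unbounded D.2 then atomNorm x.1 1 ⊤ else atomNorm x.1 (posLo x.2) x.2.hi

theorem mem_atoms {D : RawClause ℕ × IntMult} {y : NAtom} : y ∈ (clauseNorm D).atoms ↔
    ∃ x ∈ D.1, (posLo x.2 : ℕ∞) ≤ x.2.hi ∧ atomIn D x = y := by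
  simp only [clauseNorm, List.mem_map, List.mem_filter, decide_eq_true_eq, and_assoc]
  rfl

theorem exists_atomIn_eq (D : RawClause ℕ × IntMult) (x : RawAtom ℕ × IntMult) :
    ∃ lo hi, atomIn D x = atomNorm x.1 lo hi := by
  unfold atomIn
  cases unbounded D.2 <;> exact ⟨_, _, rfl⟩

theorem mem_syms_atomIn {D : RawClause ℕ × IntMult} {x : RawAtom ℕ × IntMult} {a : ℕ} :
    a ∈ (atomIn D x).syms ↔ a ∈ x.1.map Prod.fst := by
  obtain ⟨lo, hi, e⟩ := exists_atomIn_eq D x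
  rw [e, mem_syms_atomNorm]

theorem atomPow_iff_atomIn {D : RawClause ℕ × IntMult} {x : RawAtom ℕ × IntMult} {k : ℕ}
    {w : Multiset ℕ} : AtomPow x.1 k w ↔
      (∀ a ∈ w, a ∈ x.1.map Prod.fst) ∧ (atomIn D x).Fits (fun a => w.count a) k := by
  obtain ⟨lo, hi, e⟩ := exists_atomIn_eq D x
  rw [e, atomPow_iff]

/-- The clauses with intervals that are admitted in expressions. -/
def IsFactor (D : RawClause ℕ × IntMult) : Prop :=
  (IsSimpleClauseExpr D.1 ∧ (D.2 = IntMult.plus ∨ D.2 = IntMult.star)) ∨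
    (IsClauseExpr D.1 ∧ (D.2 = IntMult.one ∨ D.2 = IntMult.maybe))

theorem IsFactor.isClauseExpr {D : RawClause ℕ × IntMult} (h : IsFactor D) : IsClauseExpr D.1 :=
  h.elim (fun h => h.1.1) And.left

theorem atomIn_wf {D : RawClause ℕ × IntMult} (hD : IsFactor D) (hnd : (clauseSyms D.1).Nodup)
    {x : RawAtom ℕ × IntMult} (hx : x ∈ D.1) (hlive : (posLo x.2 : ℕ∞) ≤ x.2.hi) :
    (atomIn D x).WF := by
  have hxn : (x.1.map Prod.fst).Nodup := (List.nodup_flatMap.mp hnd).1 x hx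
  refine ⟨fun a ha ha' => ?_, ?_, ?_, ?_⟩
  · obtain ⟨lo, hi, e⟩ := exists_atomIn_eq D x
    rw [e] at ha ha'
    obtain ⟨y, hy, h₀, rfl⟩ := mem_mand_atomNorm.mp ha
    obtain ⟨z, hz, h₁, h⟩ := mem_opt_atomNorm.mp ha'
    rw [List.inj_on_of_nodup_map hxn hz hy h] at h₁
    exact h₀ h₁
  · obtain ⟨y, hy⟩ := List.exists_mem_of_ne_nil _ (hD.isClauseExpr.2 x hx).1
    exact List.ne_nil_of_mem (mem_syms_atomIn.mpr (List.mem_map_of_mem hy))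
  · unfold atomIn
    have := posLo_eq x.2
    cases unbounded D.2
    · simp only [atomNorm, cond_false]
      omega
    · simp [atomNorm]
  · unfold atomIn
    cases unbounded D.2
    · simpa [atomNorm] using hlive
    · simp [atomNorm]

theorem atoms_disj {D : RawClause ℕ × IntMult} (hnd : (clauseSyms D.1).Nodup)
    {y z : NAtom} (hy : y ∈ (clauseNorm D).atoms) (hz : z ∈ (clauseNorm D).atoms) {a : ℕ}
    (ha : a ∈ y.syms) (hb : a ∈ z.syms) : y = z := by
  obtain ⟨x, hx, -, rfl⟩ := mem_atoms.mp hy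
  obtain ⟨x', hx', -, rfl⟩ := mem_atoms.mp hz
  rw [eq_of_mem_flatMap hnd hx hx' (mem_syms_atomIn.mp ha) (mem_syms_atomIn.mp hb)]

theorem mem_lang_clause {D : RawClause ℕ} (hD : IsClauseExpr D) {w : Multiset ℕ} :
    w ∈ (RawClause.toURE D).lang ↔ ∃ x ∈ D, w ∈ (rep (RawAtom.toURE x.1) x.2).lang := by
  rw [RawClause.toURE, mem_lang_altAll (by simpa using hD.1)]
  simp

/-- The outer interval is one of `1`, `?`, `+`, `*`, so its flag `opt` is never set and plays no
role here. -/
theorem clauseNorm_zero {D : RawClause ℕ × IntMult} (hD : IsFactor D)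
    (hnd : (clauseSyms D.1).Nodup) :
    (clauseNorm D).zero = true ↔ D.2.lo = 0 ∨ 0 ∈ (RawClause.toURE D.1).lang := by
  rw [mem_lang_clause hD.isClauseExpr]
  simp only [clauseNorm, Bool.or_eq_true, Nat.beq_eq, List.any_eq_true]
  refine or_congr_right (exists_congr fun x => and_congr_right fun hx => ?_)
  exact atomZero_iff (hD.isClauseExpr.2 x hx) ((List.nodup_flatMap.mp hnd).1 x hx)

/-- Only atoms whose interval contains a positive number are kept. Such an interval is not empty,
and copies of an atom without mandatory symbols may all be empty. -/
theorem clauseNorm_zero_of_mand {D : RawClause ℕ × IntMult} {y : NAtom}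
    (hy : y ∈ (clauseNorm D).atoms) (hm : y.mand = []) : (clauseNorm D).zero = true := by
  obtain ⟨x, hx, hlive, rfl⟩ := mem_atoms.mp hy
  have hm' : (atomNorm x.1 1 ⊤).mand = [] := by
    obtain ⟨lo, hi, e⟩ := exists_atomIn_eq D x
    rw [e] at hm
    exact hm
  have hle : (x.2.lo : ℕ∞) ≤ x.2.hi := by
    refine le_trans ?_ hlive
    rw [posLo_eq]
    exact_mod_cast le_max_right _ _
  have : atomZero x = true := by simp [atomZero, hm', hle]
  simp only [clauseNorm, Bool.or_eq_true, List.any_eq_true]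
  exact .inr ⟨x, hx, this⟩

theorem clauseNorm_wf {D : RawClause ℕ × IntMult} (hD : IsFactor D)
    (hnd : (clauseSyms D.1).Nodup) : WF [clauseNorm D] := by
  refine ⟨?_, ?_, ?_⟩ <;> simp only [List.mem_singleton, forall_eq]
  · intro y hy
    obtain ⟨x, hx, hlive, rfl⟩ := mem_atoms.mp hy
    exact atomIn_wf hD hnd hx hlive
  · exact fun y hy z hz a ha hb => ⟨trivial, atoms_disj hnd hy hz ha hb⟩
  · exact fun y hy => clauseNorm_zero_of_mand hy

end NormalForm

/-! ### Languages and normal forms -/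

namespace NormalForm

open URE

theorem NAtom.Fits.add {x : NAtom} {c d : ℕ → ℕ} {k l : ℕ} (hc : x.Fits c k) (hd : x.Fits d l) :
    x.Fits (fun a => c a + d a) (k + l) :=
  ⟨fun a ha => congrArg₂ _ (hc.mand a ha) (hd.mand a ha),
    fun a ha => add_le_add (hc.opt a ha) (hd.opt a ha)⟩

theorem NAtom.fits_zero (x : NAtom) : x.Fits (fun _ => 0) 0 := ⟨fun _ _ => rfl, fun _ _ => le_rfl⟩

theorem fits_zero_of_disjoint {x : NAtom} {w : Multiset ℕ} (h : ∀ a ∈ w, a ∉ x.syms) :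
    x.Fits (fun a => w.count a) 0 :=
  have h₀ : ∀ a ∈ x.syms, w.count a = 0 := fun a ha =>
    Multiset.count_eq_zero_of_notMem fun hw => h a hw ha
  ⟨fun a ha => h₀ a (NAtom.mem_syms.mpr (.inl ha)),
    fun a ha => (h₀ a (NAtom.mem_syms.mpr (.inr ha))).le⟩

/-! ### Words of a clause with its outer interval. -/

section

variable {D : RawClause ℕ × IntMult}

theorem range_atomIn {x : RawAtom ℕ × IntMult} {k : ℕ} (hlo : x.2.lo ≤ k)
    (hhi : (k : ℕ∞) ≤ x.2.hi) : (atomIn D x).InRange k := by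
  by_cases hk : k = 0
  · exact .inl hk
  · right
    unfold atomIn
    cases unbounded D.2
    · refine ⟨?_, hhi⟩
      simp only [atomNorm, cond_false, posLo_eq]
      omega
    · simp only [atomNorm, cond_true, le_top, and_true]
      omega

/-- Multiplicities of the atoms in a word of a clause. -/
theorem exists_mult_of_mem (hD : IsFactor D) (hnd : (clauseSyms D.1).Nodup) {w : Multiset ℕ}
    (hw : w ∈ (RawClause.toURE D.1).lang) : ∃ k : NAtom → ℕ,
      (∀ a ∈ w, ∃ y ∈ (clauseNorm D).atoms, a ∈ y.syms) ∧
      (∀ y ∈ (clauseNorm D).atoms, y.Fits (fun a => w.count a) (k y) ∧ y.InRange (k y)) ∧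
      (∀ y ∈ (clauseNorm D).atoms, ∀ z ∈ (clauseNorm D).atoms, k y ≠ 0 → k z ≠ 0 → y = z) ∧
      (w ≠ 0 → ∃ y ∈ (clauseNorm D).atoms, k y ≠ 0) := by
  classical
  by_cases hw₀ : w = 0
  · subst hw₀
    exact ⟨fun _ => 0, by simp, fun y _ => ⟨by simpa using y.fits_zero, .inl rfl⟩,
      fun _ _ _ _ h => absurd rfl h, fun h => absurd rfl h⟩
  · obtain ⟨x, hx, hwx⟩ := (mem_lang_clause hD.isClauseExpr).mp hw
    rw [mem_lang_rep_atom (hD.isClauseExpr.2 x hx) ((List.nodup_flatMap.mp hnd).1 x hx)] at hwx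
    obtain ⟨k, hlo, hhi, hk⟩ := hwx.resolve_right fun h => hw₀ h.2
    have hk₀ : k ≠ 0 := by
      rintro rfl
      exact hw₀ (atomPow_zero.mp hk)
    have hlive : (posLo x.2 : ℕ∞) ≤ x.2.hi := by
      refine le_trans ?_ hhi
      rw [posLo_eq]
      exact_mod_cast max_le (Nat.one_le_iff_ne_zero.mpr hk₀) hlo
    have hmem : atomIn D x ∈ (clauseNorm D).atoms := mem_atoms.mpr ⟨x, hx, hlive, rfl⟩
    obtain ⟨hsupp, hfits⟩ := (atomPow_iff_atomIn (D := D)).mp hk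
    simp only [← mem_syms_atomIn (D := D)] at hsupp
    -- A nonempty word of a clause uses one atom only, so the multiplicity is concentrated there.
    refine ⟨fun y => if y = atomIn D x then k else 0, fun a ha => ⟨_, hmem, hsupp a ha⟩,
      fun y hy => ?_, fun y _ z _ h₁ h₂ => ?_, fun _ => ⟨_, hmem, by simpa using hk₀⟩⟩
    · by_cases e : y = atomIn D x
      · subst e
        simpa using ⟨hfits, range_atomIn hlo hhi⟩
      · simp only [if_neg e]
        exact ⟨fits_zero_of_disjoint fun a ha hay => e (atoms_disj hnd hy hmem hay (hsupp a ha)),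
          .inl rfl⟩
    · rw [ite_ne_right_iff] at h₁ h₂
      rw [h₁.1, h₂.1]

theorem mem_clause_of_mult (hD : IsFactor D) (hnd : (clauseSyms D.1).Nodup) {w : Multiset ℕ}
    {x : RawAtom ℕ × IntMult} (hx : x ∈ D.1) {k : ℕ} (hlo : x.2.lo ≤ k) (hhi : (k : ℕ∞) ≤ x.2.hi)
    (hk : AtomPow x.1 k w) : w ∈ (RawClause.toURE D.1).lang := by
  rw [mem_lang_clause hD.isClauseExpr]
  refine ⟨x, hx, ?_⟩
  rw [mem_lang_rep_atom (hD.isClauseExpr.2 x hx) ((List.nodup_flatMap.mp hnd).1 x hx)]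
  exact .inl ⟨k, hlo, hhi, hk⟩

theorem eq_zero_of_mult {E : NExpr} {w : Multiset ℕ} {k : NAtom → ℕ}
    (h : Accepts E (fun a => w.count a) k) (hk : ∀ F ∈ E, ∀ y ∈ F.atoms, k y = 0) : w = 0 := by
  refine Multiset.eq_zero_of_forall_notMem fun a ha => ?_
  obtain ⟨F, hF, y, hy, -, hle, -⟩ := h.exists_atom (Multiset.count_ne_zero.mpr ha)
  rw [hk F hF y hy] at hle
  exact Multiset.count_ne_zero.mpr ha (Nat.le_zero.mp hle)

/-- Under `1` or `?` there is at most one word of the clause, hence copies of a single atom, and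
exclusivity recovers that atom from the multiplicities. If all multiplicities vanish, the word is
empty, and the flag `zero` decides. -/
theorem mem_lang_exclusive (hD : IsClauseExpr D.1 ∧ (D.2 = IntMult.one ∨ D.2 = IntMult.maybe))
    (hnd : (clauseSyms D.1).Nodup) {w : Multiset ℕ} :
    w ∈ (rep (RawClause.toURE D.1) D.2).lang ↔
      ∃ k, Accepts [clauseNorm D] (fun a => w.count a) k := by
  have hF : IsFactor D := .inr hD
  have hu : unbounded D.2 = false := by
    rcases hD.2 with e | e <;> simp [unbounded, e, IntMult.one, IntMult.maybe]
  have hrep : w ∈ (rep (RawClause.toURE D.1) D.2).lang ↔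
      w ∈ (RawClause.toURE D.1).lang ∨ (D.2.lo = 0 ∧ w = 0) := by
    rw [mem_lang_rep, ← isSum_one (L := (RawClause.toURE D.1).lang),
      ← isSum_zero (L := (RawClause.toURE D.1).lang)]
    rcases hD.2 with e | e
    · simp only [e, IntMult.one]
      simp only [Bool.false_eq_true, false_and, or_false, one_ne_zero]
      constructor
      · rintro ⟨k, h₁, h₂, h⟩
        obtain rfl : k = 1 := le_antisymm (by exact_mod_cast h₂) h₁
        exact h
      · exact fun h => ⟨1, le_rfl, by simp, h⟩
    · simp only [e, IntMult.maybe]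
      simp only [Bool.false_eq_true, false_and, or_false, true_and]
      constructor
      · rintro ⟨k, -, h₂, h⟩
        have hk : k ≤ 1 := by exact_mod_cast h₂
        interval_cases k
        · exact .inr h
        · exact .inl h
      · rintro (h | h)
        · exact ⟨1, by simp, by simp, h⟩
        · exact ⟨0, le_rfl, by simp, h⟩
  rw [hrep]
  constructor
  · intro h
    obtain ⟨k, hk₁, hk₂, hk₃, hk₄, hz⟩ : ∃ k : NAtom → ℕ,
        (∀ a ∈ w, ∃ y ∈ (clauseNorm D).atoms, a ∈ y.syms) ∧
        (∀ y ∈ (clauseNorm D).atoms, y.Fits (fun a => w.count a) (k y) ∧ y.InRange (k y)) ∧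
        (∀ y ∈ (clauseNorm D).atoms, ∀ z ∈ (clauseNorm D).atoms, k y ≠ 0 → k z ≠ 0 → y = z) ∧
        (w ≠ 0 → ∃ y ∈ (clauseNorm D).atoms, k y ≠ 0) ∧
        (w = 0 → (clauseNorm D).zero = true) := by
      rcases h with h | ⟨h₀, rfl⟩
      · obtain ⟨k, h₁, h₂, h₃, h₄⟩ := exists_mult_of_mem hF hnd h
        refine ⟨k, h₁, h₂, h₃, h₄, ?_⟩
        rintro rfl
        exact (clauseNorm_zero hF hnd).mpr (.inr h)
      · exact ⟨fun _ => 0, by simp, fun y _ => ⟨by simpa using y.fits_zero, .inl rfl⟩,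
          fun _ _ _ _ h => absurd rfl h, fun h => absurd rfl h,
          fun _ => (clauseNorm_zero hF hnd).mpr (.inl h₀)⟩
    refine ⟨k, ⟨?_, ?_, ?_⟩, ?_, ?_⟩ <;> simp only [List.mem_singleton, forall_eq, exists_eq_left]
    · exact fun y hy => (hk₂ y hy).2
    · exact fun _ => hk₃
    · by_cases hw : w = 0
      · exact .inl (hz hw)
      · exact .inr (hk₄ hw)
    · exact fun a ha => hk₁ a (Multiset.count_ne_zero.mp ha)
    · exact fun y hy => (hk₂ y hy).1
  · rintro ⟨k, h⟩
    by_cases hk : ∃ y ∈ (clauseNorm D).atoms, k y ≠ 0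
    · obtain ⟨y, hy, hky⟩ := hk
      left
      have hr := (h.range _ (List.mem_singleton.mpr rfl) y hy).resolve_left hky
      have hfit := h.fits _ (List.mem_singleton.mpr rfl) y hy
      have hsupp : ∀ a ∈ w, a ∈ y.syms := by
        intro a ha
        obtain ⟨F, hF', z, hz, haz, hle, -⟩ := h.exists_atom (Multiset.count_ne_zero.mpr ha)
        obtain rfl := List.mem_singleton.mp hF'
        have hkz : k z ≠ 0 := by
          have := Multiset.count_pos.mpr ha
          omega
        rwa [h.excl _ hF' (by simp [clauseNorm, hu]) y hy z hz hky hkz]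
      obtain ⟨x, hx, -, rfl⟩ := mem_atoms.mp hy
      simp only [mem_syms_atomIn] at hsupp
      have hpow := (atomPow_iff_atomIn (D := D)).mpr ⟨hsupp, hfit⟩
      generalize k (atomIn D x) = n at hr hpow
      simp only [atomIn, hu, cond_false, atomNorm, posLo_eq] at hr
      exact mem_clause_of_mult hF hnd hx (le_trans (le_max_right _ _) hr.1) hr.2 hpow
    · push Not at hk
      obtain rfl : w = 0 := eq_zero_of_mult h (by simpa using hk)
      have hz := (h.zero _ (List.mem_singleton.mpr rfl)).resolve_right fun ⟨y, hy, hky⟩ =>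
        hky (hk y hy)
      exact ((clauseNorm_zero hF hnd).mp hz).symm.imp_right fun h => ⟨h, rfl⟩

/-- Multiplicities add up along a sum of words of the clause. Conversely, any multiplicities can be
realised by taking single copies of atoms, because all inner intervals are `1` or `?`; this is why
iterated clauses have to be simple. Only the empty word needs separate care. -/
theorem mem_lang_repeated
    (hD : IsSimpleClauseExpr D.1 ∧ (D.2 = IntMult.plus ∨ D.2 = IntMult.star))
    (hnd : (clauseSyms D.1).Nodup) {w : Multiset ℕ} :
    w ∈ (rep (RawClause.toURE D.1) D.2).lang ↔
      ∃ k, Accepts [clauseNorm D] (fun a => w.count a) k := by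
  have hF : IsFactor D := .inl hD
  have hu : unbounded D.2 = true := by
    rcases hD.2 with e | e <;> simp [unbounded, e, IntMult.plus, IntMult.star]
  have hlive : ∀ x ∈ D.1, atomIn D x ∈ (clauseNorm D).atoms := by
    intro x hx
    refine mem_atoms.mpr ⟨x, hx, ?_, rfl⟩
    rcases hD.1.2 x hx with e | e <;> simp [e, posLo, IntMult.one, IntMult.maybe]
  have hrep : w ∈ (rep (RawClause.toURE D.1) D.2).lang ↔
      ∃ us : List (Multiset ℕ), (∀ u ∈ us, u ∈ (RawClause.toURE D.1).lang) ∧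
        (D.2.lo = 0 ∨ us ≠ []) ∧ w = us.sum := by
    have hlo (us : List (Multiset ℕ)) : D.2.lo ≤ us.length ↔ D.2.lo = 0 ∨ us ≠ [] := by
      rw [← List.length_pos_iff]
      rcases hD.2 with e | e
      · simp [e, IntMult.plus]
        omega
      · simp [e, IntMult.star]
    rw [mem_lang_rep]
    constructor
    · rintro (⟨_, h₁, -, us, h, rfl, rfl⟩ | ⟨h, -⟩)
      · exact ⟨us, h, (hlo us).mp h₁, rfl⟩
      · rcases hD.2 with e | e <;> simp [e, IntMult.plus, IntMult.star] at h
    · rintro ⟨us, h, h₁, rfl⟩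
      refine .inl ⟨us.length, (hlo us).mpr h₁, ?_, us, h, rfl, rfl⟩
      rw [unbounded_iff.mp hu]
      exact le_top
  rw [hrep]
  constructor
  · rintro ⟨us, hus, hlo, rfl⟩
    obtain ⟨k, hk₁, hk₂⟩ : ∃ k : NAtom → ℕ,
        (∀ a ∈ us.sum, ∃ y ∈ (clauseNorm D).atoms, a ∈ y.syms) ∧
        ∀ y ∈ (clauseNorm D).atoms, y.Fits (fun a => us.sum.count a) (k y) := by
      clear hlo hrep
      induction us with
      | nil => exact ⟨fun _ => 0, by simp, fun y _ => by simpa using y.fits_zero⟩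
      | cons u us ih =>
        rw [List.forall_mem_cons] at hus
        obtain ⟨k, h₁, h₂⟩ := ih hus.2
        obtain ⟨l, h₁', h₂', -⟩ := exists_mult_of_mem hF hnd hus.1
        refine ⟨fun y => l y + k y, fun a ha => ?_, fun y hy => ?_⟩
        · rw [List.sum_cons] at ha
          exact (Multiset.mem_add.mp ha).elim (h₁' a) (h₁ a)
        · simp only [List.sum_cons, Multiset.count_add]
          exact (h₂' y hy).1.add (h₂ y hy)
    refine ⟨k, ⟨?_, ?_, ?_⟩, ?_, ?_⟩ <;> simp only [List.mem_singleton, forall_eq, exists_eq_left]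
    · intro y hy
      obtain ⟨x, -, -, rfl⟩ := mem_atoms.mp hy
      simp only [NAtom.InRange, atomIn, hu, cond_true, atomNorm, le_top, and_true]
      omega
    · simp [clauseNorm, hu]
    · by_contra hcon
      push Not at hcon
      have h₀ : us.sum = 0 := by
        refine Multiset.eq_zero_of_forall_notMem fun a ha => ?_
        obtain ⟨y, hy, hay⟩ := hk₁ a ha
        have := (hk₂ y hy).le hay
        rw [hcon.2 y hy] at this
        exact Multiset.count_ne_zero.mpr ha (Nat.le_zero.mp this)
      -- No atom is present, so the sum is empty and so is each summand; under `+` there is a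
      -- summand, and the clause itself contains the empty word.
      refine hcon.1 ((clauseNorm_zero hF hnd).mpr (hlo.imp_right fun hne => ?_))
      obtain ⟨u, hu'⟩ := List.exists_mem_of_ne_nil _ hne
      have : u = 0 := by
        have h := List.single_le_sum (l := us) (fun _ _ => Multiset.zero_le _) u hu'
        rw [h₀] at h
        exact Multiset.le_zero.mp h
      exact this ▸ hus u hu'
    · exact fun a ha => hk₁ a (Multiset.count_ne_zero.mp ha)
    · exact hk₂
  · rintro ⟨k, h⟩
    -- The restriction of `w` to the symbols of an atom consists of copies of that atom, each of
    -- which is a word of the clause.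
    have hcl : w ∈ AddSubmonoid.closure (RawClause.toURE D.1).lang := by
      have hA (x) (hx : x ∈ D.1) : IsAtomExpr x.1 ∧ (x.1.map Prod.fst).Nodup :=
        ⟨hD.1.1.2 x hx, (List.nodup_flatMap.mp hnd).1 x hx⟩
      have hstar (x) (hx : x ∈ D.1) (u : Multiset ℕ) :
          u ∈ (rep (RawAtom.toURE x.1) IntMult.star).lang ↔ ∃ k, AtomPow x.1 k u := by
        rw [mem_lang_rep_atom (x := (x.1, IntMult.star)) (hA x hx).1 (hA x hx).2]
        simp [IntMult.star]
      refine lang_concAll_subset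
        (l := D.1.map fun x => rep (RawAtom.toURE x.1) IntMult.star) ?_ ?_
      · simp only [List.mem_map, forall_exists_index, and_imp, forall_apply_eq_imp_iff₂]
        intro x hx u hu
        obtain ⟨k, hk⟩ := (hstar x hx u).mp hu
        rw [← isSum_atom (hA x hx).1 (hA x hx).2] at hk
        refine AddSubmonoid.closure_mono ?_ hk.mem_closure
        intro v hv
        rw [mem_lang_atom (hA x hx).1 (hA x hx).2] at hv
        rcases hD.1.2 x hx with e | e
        · exact mem_clause_of_mult hF hnd hx (by simp [e, IntMult.maybe])
            (by simp [e, IntMult.maybe]) hv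
        · exact mem_clause_of_mult hF hnd hx (by simp [e, IntMult.one])
            (by simp [e, IntMult.one]) hv
      · have hsupp : ∀ a ∈ w, ∃ x ∈ D.1, a ∈ x.1.map Prod.fst := by
          intro a ha
          obtain ⟨F, hF', y, hy, hay⟩ := h.supp a (Multiset.count_ne_zero.mpr ha)
          obtain rfl := List.mem_singleton.mp hF'
          obtain ⟨x, hx, -, rfl⟩ := mem_atoms.mp hy
          exact ⟨x, hx, mem_syms_atomIn.mp hay⟩
        refine (mem_lang_concAll_map _ (fun x => x.1.map Prod.fst) ?_ ?_).mpr ⟨hsupp, ?_⟩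
        · intro x hx u hu
          obtain ⟨k, hk⟩ := (hstar x hx u).mp hu
          exact hk.1
        · exact (List.nodup_flatMap.mp hnd).2
        · intro x hx
          rw [hstar x hx]
          refine ⟨k (atomIn D x), (atomPow_iff_atomIn (D := D)).mpr
            ⟨fun a ha => (Multiset.mem_filter.mp ha).2, ?_⟩⟩
          have hfit := h.fits _ (List.mem_singleton.mpr rfl) _ (hlive x hx)
          have hcount : ∀ a ∈ (atomIn D x).syms,
              (w.filter (· ∈ x.1.map Prod.fst)).count a = w.count a := fun a ha =>
            Multiset.count_filter_of_pos (mem_syms_atomIn.mp ha)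
          refine ⟨fun a ha => ?_, fun a ha => ?_⟩
          · rw [hcount a (NAtom.mem_syms.mpr (.inl ha))]
            exact hfit.mand a ha
          · rw [hcount a (NAtom.mem_syms.mpr (.inr ha))]
            exact hfit.opt a ha
    obtain ⟨us, hus, rfl⟩ := AddSubmonoid.exists_list_of_mem_closure hcl
    -- Under `+` the empty list of summands is not allowed; the empty word must then be a word of
    -- the clause and serves as the only summand.
    by_cases hne : us = []
    · subst hne
      have hz : (clauseNorm D).zero = true := by
        rcases h.zero _ (List.mem_singleton.mpr rfl) with hz | ⟨y, hy, hky⟩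
        · exact hz
        · refine clauseNorm_zero_of_mand hy (List.eq_nil_iff_forall_not_mem.mpr fun a ha => hky ?_)
          rw [← (h.fits _ (List.mem_singleton.mpr rfl) y hy).mand a ha]
          simp
      rcases (clauseNorm_zero hF hnd).mp hz with h₀ | h₀
      · exact ⟨[], hus, .inl h₀, rfl⟩
      · exact ⟨[0], by simpa using h₀, .inr (by simp), by simp⟩
    · exact ⟨us, hus, .inr hne, rfl⟩

theorem mem_lang_factor (hD : IsFactor D) (hnd : (clauseSyms D.1).Nodup) {w : Multiset ℕ} :
    w ∈ (rep (RawClause.toURE D.1) D.2).lang ↔ Sat [clauseNorm D] (fun a => w.count a) := by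
  rw [sat_iff (clauseNorm_wf hD hnd)]
  rcases hD with hD | hD
  · exact mem_lang_repeated hD hnd
  · exact mem_lang_exclusive hD hnd

end

end NormalForm

/-! ### Membership and containment by normal forms -/

namespace NormalForm

open URE

/-- The constraints of a single clause. -/
structure NFactor.Sat (F : NFactor) (c : ℕ → ℕ) : Prop where
  atom : ∀ x ∈ F.atoms, x.Sat c
  excl : F.excl = true → ∀ x ∈ F.atoms, ∀ a ∈ x.syms, ∀ y ∈ F.atoms, ∀ b ∈ y.syms,
    c a ≠ 0 → c b ≠ 0 → b ∈ x.syms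
  zero : F.zero = true ∨ ∃ x ∈ F.atoms, ∃ a ∈ x.syms, c a ≠ 0

theorem sat_iff_forall {E : NExpr} {c : ℕ → ℕ} : Sat E c ↔
    (∀ a, c a ≠ 0 → ∃ F ∈ E, ∃ x ∈ F.atoms, a ∈ x.syms) ∧ ∀ F ∈ E, F.Sat c :=
  ⟨fun h => ⟨h.supp, fun F hF => ⟨h.atom F hF, h.excl F hF, h.zero F hF⟩⟩, fun h =>
    ⟨h.1, fun F hF => (h.2 F hF).atom, fun F hF => (h.2 F hF).excl, fun F hF => (h.2 F hF).zero⟩⟩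

/-- The constraints of a clause see only its own symbols. This allows passing between a word and its
restriction to the clause. -/
theorem NFactor.Sat.congr {F : NFactor} {c d : ℕ → ℕ}
    (h : ∀ x ∈ F.atoms, ∀ a ∈ x.syms, c a = d a) (hc : F.Sat c) : F.Sat d := by
  refine ⟨fun x hx => ?_, fun he x hx a ha y hy b hb => ?_, hc.zero.imp_right ?_⟩
  · have hm : ∀ a ∈ x.mand, a ∈ x.syms := fun a ha => NAtom.mem_syms.mpr (.inl ha)
    have hs := hc.atom x hx
    refine ⟨fun a ha b hb => ?_, fun a ha => ?_, fun a ha => ?_⟩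
    · rw [← h x hx a (hm a ha), ← h x hx b hb]
      exact hs.le a ha b hb
    · rw [← h x hx a ha]
      exact hs.hi a ha
    · rw [← h x hx a (hm a ha)]
      exact hs.lo a ha
  · rw [← h x hx a ha, ← h y hy b hb]
    exact hc.excl he x hx a ha y hy b hb
  · rintro ⟨x, hx, a, ha, hca⟩
    exact ⟨x, hx, a, ha, h x hx a ha ▸ hca⟩

theorem mem_clauseSyms {D : RawClause ℕ × IntMult} {y : NAtom} (hy : y ∈ (clauseNorm D).atoms)
    {a : ℕ} (ha : a ∈ y.syms) : a ∈ clauseSyms D.1 := by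
  obtain ⟨x, hx, -, rfl⟩ := mem_atoms.mp hy
  exact List.mem_flatMap.mpr ⟨x, hx, mem_syms_atomIn.mp ha⟩

theorem nodup_symbols {E : RawDIME ℕ} (hE : IsDIME E) :
    (E.flatMap fun D => clauseSyms D.1).Nodup := hE.2

theorem nodup_clauseSyms {E : RawDIME ℕ} (hE : IsDIME E) {D : RawClause ℕ × IntMult}
    (hD : D ∈ E) : (clauseSyms D.1).Nodup :=
  (List.nodup_flatMap.mp (nodup_symbols hE)).1 D hD

theorem norm_wf {E : RawDIME ℕ} (hE : IsDIME E) : WF (norm E) := by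
  simp only [norm]
  refine ⟨?_, ?_, ?_⟩ <;>
    simp only [List.mem_map, forall_exists_index, and_imp, forall_apply_eq_imp_iff₂]
  · exact fun D hD => (clauseNorm_wf (hE.1 D hD) (nodup_clauseSyms hE hD)).atom _
      (List.mem_singleton.mpr rfl)
  · intro D hD y hy D' hD' z hz a ha hb
    obtain rfl := eq_of_mem_flatMap (nodup_symbols hE) hD hD' (mem_clauseSyms hy ha)
      (mem_clauseSyms hz hb)
    exact ⟨rfl, atoms_disj (nodup_clauseSyms hE hD) hy hz ha hb⟩
  · exact fun D _ y hy => clauseNorm_zero_of_mand hy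

/-- Distinct clauses have disjoint symbols, so membership reduces to the restrictions of the word to
the clauses, and the constraints of a clause do not notice the restriction. -/
theorem mem_lang_iff {E : RawDIME ℕ} (hE : IsDIME E) {w : Multiset ℕ} :
    w ∈ (RawDIME.toURE E).lang ↔ Sat (norm E) (fun a => w.count a) := by
  have hfac (D) (hD : D ∈ E) (u : Multiset ℕ) :=
    mem_lang_factor (w := u) (hE.1 D hD) (nodup_clauseSyms hE hD)
  rw [RawDIME.toURE, mem_lang_concAll_map _ (fun D => clauseSyms D.1), sat_iff_forall]
  · have hcount (D : RawClause ℕ × IntMult) : ∀ y ∈ (clauseNorm D).atoms, ∀ a ∈ y.syms,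
        (w.filter (· ∈ clauseSyms D.1)).count a = w.count a := fun y hy a ha =>
      Multiset.count_filter_of_pos (mem_clauseSyms hy ha)
    simp only [norm, List.mem_map, forall_exists_index, and_imp, forall_apply_eq_imp_iff₂,
      exists_exists_and_eq_and]
    constructor
    · rintro ⟨h₁, h₂⟩
      have h₃ (D) (hD : D ∈ E) := sat_iff_forall.mp ((hfac D hD _).mp (h₂ D hD))
      refine ⟨fun a ha => ?_, fun D hD => ?_⟩
      · obtain ⟨D, hD, haD⟩ := h₁ a (Multiset.count_ne_zero.mp ha)
        obtain ⟨F, hF, y, hy, hay⟩ := (h₃ D hD).1 a (by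
          rwa [Multiset.count_filter_of_pos (p := (· ∈ clauseSyms D.1)) haD])
        obtain rfl := List.mem_singleton.mp hF
        exact ⟨D, hD, y, hy, hay⟩
      · exact ((h₃ D hD).2 _ (List.mem_singleton.mpr rfl)).congr (hcount D)
    · rintro ⟨h₁, h₂⟩
      refine ⟨fun a ha => ?_, fun D hD =>
        (hfac D hD _).mpr (sat_iff_forall.mpr ⟨fun a ha => ?_, ?_⟩)⟩
      · obtain ⟨D, hD, y, hy, hay⟩ := h₁ a (Multiset.count_ne_zero.mpr ha)
        exact ⟨D, hD, mem_clauseSyms hy hay⟩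
      · obtain ⟨haw, haD⟩ := Multiset.mem_filter.mp (Multiset.count_ne_zero.mp ha)
        obtain ⟨D', hD', y, hy, hay⟩ := h₁ a (Multiset.count_ne_zero.mpr haw)
        obtain rfl := eq_of_mem_flatMap (nodup_symbols hE) hD hD' haD (mem_clauseSyms hy hay)
        exact ⟨_, List.mem_singleton.mpr rfl, y, hy, hay⟩
      · intro F hF
        obtain rfl := List.mem_singleton.mp hF
        exact (h₂ D hD).congr fun y hy a ha => (hcount D y hy a ha).symm
  · intro D hD u hu a ha
    obtain ⟨F, hF, y, hy, hay⟩ := ((hfac D hD u).mp hu).supp a (Multiset.count_ne_zero.mpr ha)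
    obtain rfl := List.mem_singleton.mp hF
    exact mem_clauseSyms hy hay
  · exact (List.nodup_flatMap.mp (nodup_symbols hE)).2

/-- The normal forms speak of arbitrary functions of occurrence numbers; those accepted have finite
support and come from words. -/
theorem exists_multiset_count (c : ℕ → ℕ) (s : List ℕ) (h : ∀ a, c a ≠ 0 → a ∈ s) :
    ∃ w : Multiset ℕ, (fun a => w.count a) = c := by
  refine ⟨∑ a ∈ s.toFinset, Multiset.replicate (c a) a, funext fun b => ?_⟩
  rw [Multiset.count_sum']
  simp only [Multiset.count_replicate, Finset.sum_ite_eq', List.mem_toFinset]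
  by_cases hb : b ∈ s
  · rw [if_pos hb]
  · rw [if_neg hb]
    by_contra h'
    exact hb (h b (Ne.symm h'))

theorem subset_iff {E E' : RawDIME ℕ} (hE : IsDIME E) (hE' : IsDIME E') :
    (RawDIME.toURE E).lang ⊆ (RawDIME.toURE E').lang ↔ contained (norm E) (norm E') = true := by
  rw [contained_iff (norm_wf hE)]
  constructor
  · intro h c k hc
    obtain ⟨w, rfl⟩ := exists_multiset_count c
      ((norm E).flatMap fun F => F.atoms.flatMap fun x => x.syms) fun a ha => by
        simpa only [List.mem_flatMap] using hc.supp a ha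
    exact (mem_lang_iff hE').mp (h ((mem_lang_iff hE).mpr ((sat_iff (norm_wf hE) _).mpr ⟨k, hc⟩)))
  · intro h w hw
    obtain ⟨k, hk⟩ := (sat_iff (norm_wf hE) _).mp ((mem_lang_iff hE).mp hw)
    exact (mem_lang_iff hE').mpr (h _ k hk)

theorem length_filter_beq (w : List ℕ) (a : ℕ) :
    (w.filter fun b => Nat.beq a b).length = w.count a := by
  rw [List.count, List.countP_eq_length_filter]
  refine congrArg List.length (List.filter_congr fun b _ => ?_)
  rw [Bool.eq_iff_iff, Nat.beq_eq, beq_iff_eq, eq_comm]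

/-- A symbol that is repeated in `w` produces the same clause several times. Well-formedness allows
this, since it compares clauses as values. -/
theorem wordNorm_wf (w : List ℕ) : WF (wordNorm w) := by
  simp only [wordNorm, length_filter_beq]
  refine ⟨?_, ?_, ?_⟩ <;>
    simp only [List.mem_map, forall_exists_index, and_imp, forall_apply_eq_imp_iff₂,
      List.mem_singleton, forall_eq, NAtom.syms, List.append_nil]
  · exact fun a ha => ⟨by simp, by simp [NAtom.syms], List.one_le_count_iff.mpr ha, le_rfl⟩
  · rintro a - b - rfl
    exact ⟨rfl, rfl⟩
  · simp

/-- Each clause is compulsory and its interval consists of one number, so all occurrence numbers are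
forced. -/
theorem accepts_wordNorm {w : List ℕ} {c : ℕ → ℕ} :
    (∃ k, Accepts (wordNorm w) c k) ↔ c = fun a => w.count a := by
  rw [← sat_iff (wordNorm_wf w)]
  simp only [wordNorm, length_filter_beq]
  constructor
  · intro h
    funext a
    by_cases ha : a ∈ w
    · obtain ⟨-, h₂, h₃⟩ := h.atom _ (List.mem_map_of_mem ha) _ (List.mem_singleton.mpr rfl)
      have h₄ := h.zero _ (List.mem_map_of_mem ha)
      simp only [NAtom.syms, List.mem_singleton, forall_eq, List.append_nil, exists_eq_left,
        Bool.false_eq_true, false_or] at h₂ h₃ h₄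
      exact le_antisymm (by exact_mod_cast h₂) (h₃.resolve_left h₄)
    · rw [List.count_eq_zero_of_not_mem ha]
      by_contra hca
      obtain ⟨F, hF, x, hx, hax⟩ := h.supp a hca
      obtain ⟨b, hb, rfl⟩ := List.mem_map.mp hF
      obtain rfl := List.mem_singleton.mp hx
      obtain rfl : a = b := by simpa [NAtom.syms] using hax
      exact ha hb
  · rintro rfl
    refine ⟨fun a ha => ?_, ?_, ?_, ?_⟩ <;>
      simp only [List.mem_map, forall_exists_index, and_imp, forall_apply_eq_imp_iff₂,
        List.mem_singleton, forall_eq, NAtom.syms, List.append_nil, exists_exists_and_eq_and,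
        exists_eq_left]
    · exact ⟨a, List.count_pos_iff.mp (Nat.pos_of_ne_zero ha), rfl⟩
    · exact fun a ha => ⟨by simp [NAtom.syms], by simp [NAtom.syms], by simp⟩
    · simp
    · exact fun a ha => .inr (List.count_pos_iff.mpr ha).ne'

theorem mem_iff_contained {E : RawDIME ℕ} (hE : IsDIME E) (w : List ℕ) :
    (w : Multiset ℕ) ∈ (RawDIME.toURE E).lang ↔ contained (wordNorm w) (norm E) = true := by
  rw [contained_iff (wordNorm_wf w), mem_lang_iff hE]
  simp only [Multiset.coe_count]
  constructor
  · intro h c k hc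
    rwa [accepts_wordNorm.mp ⟨k, hc⟩]
  · intro h
    obtain ⟨k, hk⟩ := accepts_wordNorm.mpr (rfl : (fun a => w.count a) = _)
    exact h _ k hk

end NormalForm

/-! ### Polynomial time of the decision procedures -/

namespace RegMachine

open Enc NormalForm

instance : Enc NAtom := ⟨fun x => enc (x.mand, x.opt, x.lo, x.hi)⟩

instance : Enc NFactor := ⟨fun F => enc (F.excl, F.zero, F.atoms)⟩

/-! ### Polynomial time for the records, the tests and the normal forms. -/

namespace PolyTime

variable {α : Type} [Enc α]

@[fun_prop]
theorem intMult_lo {f : α → IntMult} (hf : PolyTime f) : PolyTime fun a => (f a).lo :=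
  Comp.left hf

@[fun_prop]
theorem intMult_hi {f : α → IntMult} (hf : PolyTime f) : PolyTime fun a => (f a).hi :=
  Comp.left (Comp.right hf)

@[fun_prop]
theorem intMult_opt {f : α → IntMult} (hf : PolyTime f) : PolyTime fun a => (f a).opt :=
  Comp.right (Comp.right hf)

@[fun_prop]
theorem nAtom_mand {f : α → NAtom} (hf : PolyTime f) : PolyTime fun a => (f a).mand :=
  Comp.left hf

@[fun_prop]
theorem nAtom_opt {f : α → NAtom} (hf : PolyTime f) : PolyTime fun a => (f a).opt :=
  Comp.left (Comp.right hf)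

@[fun_prop]
theorem nAtom_lo {f : α → NAtom} (hf : PolyTime f) : PolyTime fun a => (f a).lo :=
  Comp.left (Comp.right (Comp.right hf))

@[fun_prop]
theorem nAtom_hi {f : α → NAtom} (hf : PolyTime f) : PolyTime fun a => (f a).hi :=
  Comp.right (Comp.right (Comp.right hf))

@[fun_prop]
theorem nFactor_excl {f : α → NFactor} (hf : PolyTime f) : PolyTime fun a => (f a).excl :=
  Comp.left hf

@[fun_prop]
theorem nFactor_zero {f : α → NFactor} (hf : PolyTime f) : PolyTime fun a => (f a).zero :=
  Comp.left (Comp.right hf)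

@[fun_prop]
theorem nFactor_atoms {f : α → NFactor} (hf : PolyTime f) : PolyTime fun a => (f a).atoms :=
  Comp.right (Comp.right hf)

@[fun_prop]
theorem nAtom_mk {f g : α → List ℕ} {l : α → ℕ} {h : α → ℕ∞} (hf : PolyTime f) (hg : PolyTime g)
    (hl : PolyTime l) (hh : PolyTime h) : PolyTime fun a => NAtom.mk (f a) (g a) (l a) (h a) :=
  hf.prodMk (hg.prodMk (hl.prodMk hh))

@[fun_prop]
theorem nFactor_mk {f g : α → Bool} {l : α → List NAtom} (hf : PolyTime f) (hg : PolyTime g)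
    (hl : PolyTime l) : PolyTime fun a => NFactor.mk (f a) (g a) (l a) :=
  hf.prodMk (hg.prodMk hl)

@[fun_prop]
theorem mem {f : α → ℕ} {l : α → List ℕ} (hf : PolyTime f) (hl : PolyTime l) :
    PolyTime fun x => NormalForm.mem (f x) (l x) := by
  unfold NormalForm.mem
  fun_prop

@[fun_prop]
theorem syms {y : α → NAtom} (hy : PolyTime y) :
    PolyTime fun x => (y x).syms := by
  unfold NAtom.syms
  fun_prop

@[fun_prop]
theorem nFactor_has {F : α → NFactor} {f : α → ℕ} (hF : PolyTime F) (hf : PolyTime f) :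
    PolyTime fun x => (F x).has (f x) := by
  unfold NFactor.has
  fun_prop

@[fun_prop]
theorem has {E : α → NExpr} {f : α → ℕ} (hE : PolyTime E) (hf : PolyTime f) :
    PolyTime fun x => NormalForm.has (E x) (f x) := by
  unfold NormalForm.has
  fun_prop

@[fun_prop]
theorem inhabited {E : α → NExpr} (hE : PolyTime E) :
    PolyTime fun x => NormalForm.inhabited (E x) := by
  unfold NormalForm.inhabited
  fun_prop

@[fun_prop]
theorem allAtoms {E : α → NExpr} {p : α → NAtom → Bool} (hE : PolyTime E)
    (hp : PolyTime fun x : α × NAtom => p x.1 x.2) :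
    PolyTime fun x => NormalForm.allAtoms (E x) (p x) := by
  unfold NormalForm.allAtoms
  exact all hE (all (by fun_prop) (hp.comp (by fun_prop : PolyTime
    fun x : (α × NFactor) × NAtom => (x.1.1, x.2))))

@[fun_prop]
theorem avoids {E : α → NExpr} {G : α → NFactor} (hE : PolyTime E) (hG : PolyTime G) :
    PolyTime fun x => NormalForm.avoids (E x) (G x) := by
  unfold NormalForm.avoids
  fun_prop

@[fun_prop]
theorem avoidsWith {E : α → NExpr} {f : α → ℕ} {g : α → ℕ}
    (hE : PolyTime E) (hf : PolyTime f) (hg : PolyTime g) :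
    PolyTime fun x => NormalForm.avoidsWith (E x) (f x) (g x) := by
  unfold NormalForm.avoidsWith
  fun_prop

@[fun_prop]
theorem compatible {E : α → NExpr} {f : α → ℕ} {g : α → ℕ}
    (hE : PolyTime E) (hf : PolyTime f) (hg : PolyTime g) :
    PolyTime fun x => NormalForm.compatible (E x) (f x) (g x) := by
  unfold NormalForm.compatible
  fun_prop

@[fun_prop]
theorem boundedAbove {E : α → NExpr} {f : α → ℕ} {g : α → ℕ∞}
    (hE : PolyTime E) (hf : PolyTime f) (hg : PolyTime g) :
    PolyTime fun x => NormalForm.boundedAbove (E x) (f x) (g x) := by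
  unfold NormalForm.boundedAbove
  fun_prop

@[fun_prop]
theorem boundedBelow {E : α → NExpr} {f : α → ℕ} {g : α → ℕ}
    (hE : PolyTime E) (hf : PolyTime f) (hg : PolyTime g) :
    PolyTime fun x => NormalForm.boundedBelow (E x) (f x) (g x) := by
  unfold NormalForm.boundedBelow
  fun_prop

@[fun_prop]
theorem dominated {E : α → NExpr} {f : α → ℕ} {g : α → ℕ}
    (hE : PolyTime E) (hf : PolyTime f) (hg : PolyTime g) :
    PolyTime fun x => NormalForm.dominated (E x) (f x) (g x) := by
  unfold NormalForm.dominated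
  fun_prop

@[fun_prop]
theorem exclusive {E : α → NExpr} {f : α → ℕ} {g : α → ℕ}
    (hE : PolyTime E) (hf : PolyTime f) (hg : PolyTime g) :
    PolyTime fun x => NormalForm.exclusive (E x) (f x) (g x) := by
  unfold NormalForm.exclusive
  fun_prop

@[fun_prop]
theorem satAtom {E : α → NExpr} {y : α → NAtom} (hE : PolyTime E) (hy : PolyTime y) :
    PolyTime fun x => NormalForm.satAtom (E x) (y x) := by
  unfold NormalForm.satAtom
  fun_prop

@[fun_prop]
theorem satExcl {E : α → NExpr} {G : α → NFactor} (hE : PolyTime E) (hG : PolyTime G) :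
    PolyTime fun x => NormalForm.satExcl (E x) (G x) := by
  unfold NormalForm.satExcl
  fun_prop

@[fun_prop]
theorem satFactor {E : α → NExpr} {G : α → NFactor} (hE : PolyTime E) (hG : PolyTime G) :
    PolyTime fun x => NormalForm.satFactor (E x) (G x) := by
  unfold NormalForm.satFactor
  fun_prop

@[fun_prop]
theorem contained {E : α → NExpr} {E' : α → NExpr} (hE : PolyTime E) (hE' : PolyTime E') :
    PolyTime fun x => NormalForm.contained (E x) (E' x) := by
  unfold NormalForm.contained
  fun_prop

@[fun_prop]
theorem atomNorm {A : α → RawAtom ℕ} {f : α → ℕ} {g : α → ℕ∞}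
    (hA : PolyTime A) (hf : PolyTime f) (hg : PolyTime g) :
    PolyTime fun x => NormalForm.atomNorm (A x) (f x) (g x) := by
  unfold NormalForm.atomNorm
  fun_prop

@[fun_prop]
theorem posLo {I : α → IntMult} (hI : PolyTime I) :
    PolyTime fun x => NormalForm.posLo (I x) := by
  unfold NormalForm.posLo
  fun_prop

@[fun_prop]
theorem unbounded {I : α → IntMult} (hI : PolyTime I) :
    PolyTime fun x => NormalForm.unbounded (I x) := by
  unfold NormalForm.unbounded
  fun_prop

@[fun_prop]
theorem atomZero {y : α → RawAtom ℕ × IntMult} (hy : PolyTime y) :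
    PolyTime fun x => NormalForm.atomZero (y x) := by
  unfold NormalForm.atomZero
  fun_prop

@[fun_prop]
theorem clauseNorm {D : α → RawClause ℕ × IntMult} (hD : PolyTime D) :
    PolyTime fun x => NormalForm.clauseNorm (D x) := by
  unfold NormalForm.clauseNorm
  fun_prop

@[fun_prop]
theorem norm {E : α → RawDIME ℕ} (hE : PolyTime E) :
    PolyTime fun x => NormalForm.norm (E x) := by
  unfold NormalForm.norm
  fun_prop

@[fun_prop]
theorem wordNorm {w : α → List ℕ} (hw : PolyTime w) :
    PolyTime fun x => NormalForm.wordNorm (w x) := by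
  unfold NormalForm.wordNorm
  fun_prop

end PolyTime

end RegMachine

/-- Membership of an unordered word (given by a list of its symbol occurrences in any order) in
the language of a DIME, and containment of the languages of two DIMEs, are in PTIME. -/
theorem mainTheorem1 :
    InPTIME Encode.membership
      (fun x : List ℕ × DIME ℕ => (x.1 : Multiset ℕ) ∈ x.2.lang) ∧
    InPTIME Encode.containment
      (fun x : DIME ℕ × DIME ℕ => x.1.lang ⊆ x.2.lang) := by
  -- Both procedures run in polynomial time on all raw expressions; the grammar of DIMEs is needed
  -- only for the correctness of the answers.
  have h₁ : RegMachine.PolyTime fun x : List ℕ × RawDIME ℕ =>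
      NormalForm.contained (NormalForm.wordNorm x.1) (NormalForm.norm x.2) := by fun_prop
  have h₂ : RegMachine.PolyTime fun x : RawDIME ℕ × RawDIME ℕ =>
      NormalForm.contained (NormalForm.norm x.1) (NormalForm.norm x.2) := by fun_prop
  exact ⟨RegMachine.inPTIME_of_comp _
      (fun x : List ℕ × DIME ℕ => (NormalForm.mem_iff_contained x.2.2 x.1).symm)
      (RegMachine.Parses.membership.trans
        (RegMachine.Comp.restrict h₁ fun x : List ℕ × DIME ℕ => (x.1, x.2.1))),
    RegMachine.inPTIME_of_comp _
      (fun x : DIME ℕ × DIME ℕ => (NormalForm.subset_iff x.1.2 x.2.2).symm)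
      (RegMachine.Parses.containment.trans
        (RegMachine.Comp.restrict h₂ fun x : DIME ℕ × DIME ℕ => (x.1.1, x.2.1)))⟩
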